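/- Let $m\ge 1$, let $D$ be an open subset of $\mathbb{C}^m$ with coordinates $z_1,\dots,z_m$, and let $X$ be a compact complex manifold of dimension $n$ with a Kähler form $\omega$. Let $\pi:D\times X\to X$ be the projection. Subharmonic functions take values in $[-\infty,\infty)$, and the constant $-\infty$ is allowed. An upper semicontinuous function $v:U\times X\to[-\infty,\infty)$, with $U\subset D$ open, is called $\omega$-subharmonic on graphs if for every holomorphic map $f$ from an open subset of $U$ to $X$ and every local potential $\psi$ of $\omega$ (a real $C^2$ function with $i\partial\bar\partial\psi=\omega$ on an open subset of $X$), the function $z\mapsto\psi(f(z))+v(z,f(z))$ is subharmonic where it is defined. A lower semicontinuous function $u:D\times X\to(-\infty,\infty]$ is called $\omega$-superharmonic on graphs if for every open $U\subset D$ and every $v$ that is $\omega$-subharmonic on graphs in $U\times X$, the function $z\mapsto\sup_{x\in X}\big(v(z,x)-u(z,x)\big)$ is subharmonic in $U$. A function is called $\omega$-harmonic on graphs if it is both $\omega$-subharmonic and $\omega$-superharmonic on graphs. Theorem. Suppose $u$ is a real-valued $C^2$ function on $D\times X$ and $\omega+i\partial\bar\partial u(z,\cdot)>0$ on $X$ for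 all $z\in D$. Then $u$ is $\omega$-harmonic on graphs if and only if $u$ solves the Wess--Zumino--Witten equation $$(i\partial\bar\partial u+\pi^*\omega)^{n+1}\wedge\Big(i\sum_{j=1}^m dz_j\wedge d\bar z_j\Big)^{m-1}=0\quad\text{on } D\times X.$$ -/

import Mathlib

open scoped Manifold ContDiff ComplexOrder

noncomputable section

/-- Complex Euclidean space `ℂ^k` with its Euclidean norm. -/
abbrev CSpace (k : ℕ) : Type := EuclideanSpace ℂ (Fin k)

/-! ### Wirtinger derivatives and the complex Hessian -/

section Wirtinger

variable {V : Type*} [NormedAddCommGroup V] [NormedSpace ℝ V] [NormedSpace ℂ V]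

/-- `∂_v φ = (Dφ(v) - i Dφ(iv)) / 2`; for the `j`-th coordinate vector `v` this is `∂φ/∂w_j`. -/
def wirtinger (v : V) (φ : V → ℂ) (p : V) : ℂ :=
  (1 / 2) * (fderiv ℝ φ p v - Complex.I * fderiv ℝ φ p (Complex.I • v))

/-- `∂̄_v φ = (Dφ(v) + i Dφ(iv)) / 2`; for the `j`-th coordinate vector `v` this is `∂φ/∂w̄_j`. -/
def wirtingerBar (v : V) (φ : V → ℂ) (p : V) : ℂ :=
  (1 / 2) * (fderiv ℝ φ p v + Complex.I * fderiv ℝ φ p (Complex.I • v))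

/-- The complex Hessian of a real function: on the `j`-th and `k`-th coordinate vectors it is
`∂²φ/∂w_j∂w̄_k`, so that `i∂∂̄φ = i ∑ (complexHessian φ p e_j e_k) dw_j ∧ dw̄_k` at `p`. -/
def complexHessian (φ : V → ℝ) (p v w : V) : ℂ :=
  wirtinger v (wirtingerBar w (fun q => (φ q : ℂ))) p

end Wirtinger

/-! ### Subharmonic functions -/

/-- Subharmonic functions with values in `[-∞, ∞)` on an open set `U` of `ℂ^m` (the function `-∞`
is allowed): upper semicontinuous functions that lie below every harmonic function on a ball,
continuous up to the boundary, which dominates them on the boundary sphere. -/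
def IsSubharmonicOn {m : ℕ} (h : CSpace m → EReal) (U : Set (CSpace m)) : Prop :=
  UpperSemicontinuousOn h U ∧ (∀ z ∈ U, h z < ⊤) ∧
    ∀ (c : CSpace m) (r : ℝ), 0 < r → Metric.closedBall c r ⊆ U →
      ∀ g : CSpace m → ℝ, ContinuousOn g (Metric.closedBall c r) →
        InnerProductSpace.HarmonicOnNhd g (Metric.ball c r) →
        (∀ z ∈ Metric.sphere c r, h z ≤ (g z : EReal)) →
        ∀ z ∈ Metric.ball c r, h z ≤ (g z : EReal)

/-! ### Kähler forms -/

section Kaehler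

variable {n : ℕ} {X : Type*} [TopologicalSpace X] [ChartedSpace (CSpace n) X]

/-- A field of real alternating 2-forms on the tangent spaces of `X`, written in the coordinates
of the chart at `x₀`, i.e. pulled back by the inverse of that chart. The tangent space at `x`
is by definition the model space `ℂ^n`, through the preferred chart `chartAt _ x`. -/
def formInChart (A : X → CSpace n [⋀^Fin 2]→L[ℝ] ℝ) (x₀ : X) (y : CSpace n) :
    CSpace n [⋀^Fin 2]→L[ℝ] ℝ :=
  (A ((chartAt (CSpace n) x₀).symm y)).compContinuousLinearMap
    (mfderiv 𝓘(ℝ, CSpace n) 𝓘(ℝ, CSpace n) (chartAt (CSpace n) x₀).symm y)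

variable (n X) in
/-- A Kähler form: a smooth closed positive real (1,1)-form. -/
structure KaehlerForm where
  /-- the value of the form at a point, an alternating 2-form on the tangent space there -/
  form : X → CSpace n [⋀^Fin 2]→L[ℝ] ℝ
  /-- smoothness in charts -/
  smooth : ∀ x₀ : X, ContDiffOn ℝ ∞ (formInChart form x₀) (chartAt (CSpace n) x₀).target
  /-- closedness in charts -/
  closed : ∀ x₀ : X, ∀ y ∈ (chartAt (CSpace n) x₀).target, extDeriv (formInChart form x₀) y = 0
  /-- the form is of type (1,1) -/
  type_one_one : ∀ (x : X) (v w : CSpace n),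
    form x ![Complex.I • v, Complex.I • w] = form x ![v, w]
  /-- positivity -/
  pos : ∀ (x : X) (v : CSpace n), v ≠ 0 → 0 < form x ![v, Complex.I • v]

/-- The Hermitian coefficients `g(v, w) = (ω(v, iw) - i ω(v, w)) / 2` of the (1,1)-form `ω` at `x`:
in the coordinates of the chart at `x` one has `ω = i ∑ g(e_μ, e_λ) dx_μ ∧ dx̄_λ` at `x`. -/
def KaehlerForm.coeff (Ω : KaehlerForm n X) (x : X) (v w : CSpace n) : ℂ :=
  (1 / 2) * ((Ω.form x ![v, Complex.I • w] : ℂ) - Complex.I * (Ω.form x ![v, w] : ℂ))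

/-- `ψ` is a local potential of the Kähler form on the open set `O`: it is `C²` there and
`i∂∂̄ψ` is the Kähler form. -/
def KaehlerForm.IsPotentialOn (Ω : KaehlerForm n X) (ψ : X → ℝ) (O : Set X) : Prop :=
  IsOpen O ∧ ContMDiffOn 𝓘(ℝ, CSpace n) 𝓘(ℝ, ℝ) 2 ψ O ∧
    ∀ x ∈ O, ∀ v w : CSpace n,
      complexHessian (fun y => ψ ((chartAt (CSpace n) x).symm y)) (chartAt (CSpace n) x x) v w =
        Ω.coeff x v w

variable {m : ℕ}

/-! ### Subharmonicity, superharmonicity and harmonicity on graphs -/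

/-- `u : D × X → [-∞, ∞)` is upper semicontinuous, and for every holomorphic map `f` from an open
subset `W` of `D` to `X` the function `ψ(f(z)) + u(z, f(z))` is subharmonic wherever a local
potential `ψ` is defined along `f`. -/
def IsSubharmonicOnGraphs (Ω : KaehlerForm n X) (D : Set (CSpace m)) (u : CSpace m × X → EReal) :
    Prop :=
  UpperSemicontinuousOn u (D ×ˢ Set.univ) ∧ (∀ p ∈ D ×ˢ (Set.univ : Set X), u p < ⊤) ∧
    ∀ (W : Set (CSpace m)) (f : CSpace m → X), IsOpen W → W ⊆ D →
      MDifferentiableOn 𝓘(ℂ, CSpace m) 𝓘(ℂ, CSpace n) f W →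
      ∀ (O : Set X) (ψ : X → ℝ), Ω.IsPotentialOn ψ O →
        IsSubharmonicOn (fun z => (ψ (f z) : EReal) + u (z, f z)) (W ∩ f ⁻¹' O)

/-- `u : D × X → (-∞, ∞]` is lower semicontinuous, and `sup_x (v(z, x) - u(z, x))` is subharmonic
in `U` for every `v` which is subharmonic on graphs in `U × X`, with `U` open in `D`. -/
def IsSuperharmonicOnGraphs (Ω : KaehlerForm n X) (D : Set (CSpace m))
    (u : CSpace m × X → EReal) : Prop :=
  LowerSemicontinuousOn u (D ×ˢ Set.univ) ∧ (∀ p ∈ D ×ˢ (Set.univ : Set X), ⊥ < u p) ∧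
    ∀ (U : Set (CSpace m)) (v : CSpace m × X → EReal), IsOpen U → U ⊆ D →
      IsSubharmonicOnGraphs Ω U v →
      IsSubharmonicOn (fun z => ⨆ x : X, (v (z, x) - u (z, x))) U

/-- Harmonicity on graphs in `D × X`. -/
def IsHarmonicOnGraphs (Ω : KaehlerForm n X) (D : Set (CSpace m)) (u : CSpace m × X → EReal) :
    Prop :=
  IsSubharmonicOnGraphs Ω D u ∧ IsSuperharmonicOnGraphs Ω D u

/-! ### The WZW equation -/

/-- The coordinate vectors `∂/∂z_j` and `∂/∂x_μ` of `ℂ^m × ℂ^n`. -/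
def coordVec : Fin m ⊕ Fin n → CSpace m × CSpace n
  | .inl j => (EuclideanSpace.single j 1, 0)
  | .inr μ => (0, EuclideanSpace.single μ 1)

/-- The complexified cotangent space of `D × X` at a point, in coordinates: real linear maps
`ℂ^m × ℂ^n → ℂ`. -/
abbrev CCotangent (m n : ℕ) : Type := (CSpace m × CSpace n) →ₗ[ℝ] ℂ

/-- The differentials `dz_j` and `dx_μ`. -/
def dCoord : Fin m ⊕ Fin n → CCotangent m n
  | .inl j =>
    { toFun := fun p => p.1 j
      map_add' := fun _ _ => rfl
      map_smul' := fun _ _ => rfl }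
  | .inr μ =>
    { toFun := fun p => p.2 μ
      map_add' := fun _ _ => rfl
      map_smul' := fun _ _ => rfl }

/-- The differentials `dz̄_j` and `dx̄_μ`. -/
def dCoordBar (a : Fin m ⊕ Fin n) : CCotangent m n :=
  Complex.conjAe.toLinearMap ∘ₗ dCoord a

/-- The wedge product of two 1-forms, in the exterior algebra of the cotangent space. -/
def wedgeOne (α β : CCotangent m n) : ExteriorAlgebra ℂ (CCotangent m n) :=
  ExteriorAlgebra.ι ℂ α * ExteriorAlgebra.ι ℂ β

/-- `ω + i∂∂̄u(z,·) > 0` at `x`: its Hermitian coefficient matrix in the chart at `x` is positive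
definite. -/
def IsPositiveAt (Ω : KaehlerForm n X) (u : CSpace m × X → ℝ) (z : CSpace m) (x : X) : Prop :=
  Matrix.PosDef (Matrix.of fun μ ν : Fin n =>
    Ω.coeff x (EuclideanSpace.single μ 1) (EuclideanSpace.single ν 1) +
      complexHessian (fun y => u (z, (chartAt (CSpace n) x).symm y)) (chartAt (CSpace n) x x)
        (EuclideanSpace.single μ 1) (EuclideanSpace.single ν 1))

/-- The 2-form `i∂∂̄u + π^*ω` at `(z, x)`, in the coordinates `z` of `ℂ^m` and those of the chart
at `x`. -/
def totalForm (Ω : KaehlerForm n X) (u : CSpace m × X → ℝ) (z : CSpace m) (x : X) :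
    ExteriorAlgebra ℂ (CCotangent m n) :=
  ∑ a : Fin m ⊕ Fin n, ∑ b : Fin m ⊕ Fin n,
    (Complex.I *
      (complexHessian (fun p : CSpace m × CSpace n => u (p.1, (chartAt (CSpace n) x).symm p.2))
          (z, chartAt (CSpace n) x x) (coordVec a) (coordVec b) +
        Ω.coeff x (coordVec a).2 (coordVec b).2)) •
      wedgeOne (dCoord a) (dCoordBar b)

/-- The 2-form `i ∑ dz_j ∧ dz̄_j`. -/
def baseForm (m n : ℕ) : ExteriorAlgebra ℂ (CCotangent m n) :=
  Complex.I • ∑ j : Fin m, wedgeOne (dCoord (.inl j)) (dCoordBar (.inl j))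

/-- The WZW equation `(i∂∂̄u + π^*ω)^{n+1} ∧ (i ∑ dz_j ∧ dz̄_j)^{m-1} = 0` on `D × X`, for `m ≥ 1`. -/
def SolvesWZW (Ω : KaehlerForm n X) (D : Set (CSpace m)) (u : CSpace m × X → ℝ) : Prop :=
  ∀ z ∈ D, ∀ x : X, totalForm Ω u z x ^ (n + 1) * baseForm m n ^ (m - 1) = 0

end Kaehler

end

open scoped Manifold ContDiff ComplexOrder

noncomputable section

set_option linter.unusedSectionVars false

/-! ### Second derivatives of real `C²` functions. -/

section SecondDerivative

variable {V : Type*} [NormedAddCommGroup V] [NormedSpace ℝ V]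

/-! Let T be the Hermitian form of i∂∂̄u + π^*ω at a point of D × X (`totalHermitian`). By
hypothesis T is positive definite on vertical vectors, so each e_j has a unique lift (e_j, p_j) that
is T-orthogonal to the vertical space (existence is `exists_slopes`). Put τ = ∑_j T((e_j, p_j),
(e_j, p_j)). Everything compares both sides of the equivalence with the sign of τ.

WZW side: in the frame made of the orthogonal lifts and the vertical vectors T is block diagonal. Of
the (n+1)-st power of the form, only the terms with n vertical factors and one horizontal factor
survive multiplication by the (m-1)-st power of the base form, and they add up to a nonzero multiple
of τ times a top form (`twoFormOf_pow_mul_eq_zero_iff`). Hence the WZW equation says exactly that τ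
= 0 everywhere.

Subharmonicity on graphs: along a holomorphic graph with slopes q_j, a quarter of the Laplacian of
ψ(f) + u(·, f) is ∑_j T((e_j, q_j), (e_j, q_j)). Completing the square, this is τ plus a nonnegative
vertical term, with equality for q = p. So u is subharmonic on graphs if and only if τ ≥ 0
(`sum_totalHermitian_le`, `isSubharmonicOnGraphs_of_trace_nonneg`, `leviTrace_add_sum_nonneg`).

Superharmonicity, from τ ≤ 0: let G touch sup_x (v - u) from above at z. By compactness the supremum
is attained at some x, so v ≤ G + u with equality at (z, x). Testing v on a graph through (z, x)
with slopes p gives 0 ≤ tr G + τ ≤ tr G (`isSuperharmonicOnGraphs_of_trace_nonpos`).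

Conversely, suppose u is harmonic on graphs and τ > 0 at (z₀, x₀). Then the trace of T over all
lifts is positive definite there, hence bounded below nearby (`eventually_liftTrace_ge`), and u -
c(|z - z₀|² + |x - x₀|²), truncated below, is still subharmonic on graphs near z₀. Its difference
with u has supremum -c|z - z₀|² over X, which is not subharmonic
(`sum_totalHermitian_nonpos_of_isHarmonicOnGraphs`).

Two tools support this. Subharmonicity of upper semicontinuous functions is equivalent to a
viscosity condition on touching `C²` functions, so that suprema and truncations can be handled
pointwise. And ω has local potentials, without which a condition on graphs would say nothing; they
come from the Poincaré lemma and the Dolbeault lemma, the latter from the Cauchy–Pompeiu formula. -/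

lemma ContDiffAt.hasFDerivAt_fderiv_apply {F : Type*} [NormedAddCommGroup F] [NormedSpace ℝ F]
    {φ : V → F} {p : V} (h : ContDiffAt ℝ 2 φ p)
    (w : V) : HasFDerivAt (fun q => fderiv ℝ φ q w) ((fderiv ℝ (fderiv ℝ φ) p).flip w) p := by
  have h1 : DifferentiableAt ℝ (fderiv ℝ φ) p :=
    (h.fderiv_right (m := 1) (by norm_num)).differentiableAt (by norm_num)
  exact h1.hasFDerivAt.clm_apply (hasFDerivAt_const w p) |>.congr_fderiv (by ext; simp)

lemma ContDiffAt.fderiv_fderiv_symm {φ : V → ℝ} {p : V} (h : ContDiffAt ℝ 2 φ p) (v w : V) :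
    fderiv ℝ (fderiv ℝ φ) p v w = fderiv ℝ (fderiv ℝ φ) p w v :=
  (h.isSymmSndFDerivAt (by simp)) v w

end SecondDerivative

/-! ### The complex Hessian: sesquilinearity, naturality under holomorphic maps, continuity. -/

section ComplexHessian

open Complex Filter Topology

variable {V V' : Type*} [NormedAddCommGroup V] [NormedSpace ℝ V] [NormedSpace ℂ V]
  [NormedAddCommGroup V'] [NormedSpace ℝ V'] [NormedSpace ℂ V']
  [IsScalarTower ℝ ℂ V] [IsScalarTower ℝ ℂ V']

lemma fderiv_ofReal_comp {φ : V → ℝ} {p : V} (h : DifferentiableAt ℝ φ p) (v : V) :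
    fderiv ℝ (fun q => (φ q : ℂ)) p v = (fderiv ℝ φ p v : ℂ) := by
  have := (Complex.ofRealCLM.hasFDerivAt.comp p h.hasFDerivAt).fderiv
  have h2 : (fun q => (φ q : ℂ)) = Complex.ofRealCLM ∘ φ := rfl
  rw [h2, this]; rfl

lemma wirtingerBar_ofReal {φ : V → ℝ} {p : V} (h : DifferentiableAt ℝ φ p) (w : V) :
    wirtingerBar w (fun q => (φ q : ℂ)) p =
      (1 / 2) * ((fderiv ℝ φ p w : ℂ) + I * (fderiv ℝ φ p (I • w) : ℂ)) := by
  simp only [wirtingerBar, fderiv_ofReal_comp h]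

/-- The complex Hessian in terms of the real second derivative. -/
lemma complexHessian_eq {φ : V → ℝ} {p : V} (h : ContDiffAt ℝ 2 φ p) (v w : V) :
    complexHessian φ p v w =
      (1 / 4) * (((fderiv ℝ (fderiv ℝ φ) p v w + fderiv ℝ (fderiv ℝ φ) p (I • v) (I • w) : ℝ) : ℂ)
        + I * ((fderiv ℝ (fderiv ℝ φ) p v (I • w) - fderiv ℝ (fderiv ℝ φ) p (I • v) w : ℝ) : ℂ)) := by
  have hev : (wirtingerBar w (fun q => (φ q : ℂ))) =ᶠ[𝓝 p]
      fun q => (1 / 2 : ℂ) * ((fderiv ℝ φ q w : ℂ) + I * (fderiv ℝ φ q (I • w) : ℂ)) := by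
    filter_upwards [h.eventually (by simp)] with q hq
    exact wirtingerBar_ofReal (hq.differentiableAt (by norm_num)) w
  have hd (w : V) : HasFDerivAt (fun q => (fderiv ℝ φ q w : ℂ))
      (Complex.ofRealCLM ∘L ((fderiv ℝ (fderiv ℝ φ) p).flip w)) p :=
    Complex.ofRealCLM.hasFDerivAt.comp p (h.hasFDerivAt_fderiv_apply w)
  have hD := ((hd w).fun_add ((hd (I • w)).const_mul I)).const_mul (1 / 2 : ℂ)
  rw [complexHessian, wirtinger, hev.fderiv_eq, hD.fderiv]
  simp only [smul_apply, add_apply,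
    ContinuousLinearMap.comp_apply, ContinuousLinearMap.flip_apply, Complex.ofRealCLM_apply,
    smul_eq_mul, ofReal_add, ofReal_sub]
  linear_combination (-1 / 4 : ℂ) * (fderiv ℝ (fderiv ℝ φ) p (I • v) (I • w) : ℂ) * I_mul_I

lemma complexHessian_congr {φ φ' : V → ℝ} {p : V} (h : φ =ᶠ[𝓝 p] φ') (v w : V) :
    complexHessian φ p v w = complexHessian φ' p v w := by
  have h1 : (fun q => (φ q : ℂ)) =ᶠ[𝓝 p] (fun q => (φ' q : ℂ)) := h.fun_comp ofReal
  have h2 : wirtingerBar w (fun q => (φ q : ℂ)) =ᶠ[𝓝 p] wirtingerBar w (fun q => (φ' q : ℂ)) := by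
    filter_upwards [h1.fderiv (𝕜 := ℝ)] with q hq
    simp only [wirtingerBar, hq]
  simp only [complexHessian, wirtinger, h2.fderiv_eq]

lemma complexHessian_add_left {φ : V → ℝ} {p : V} (h : ContDiffAt ℝ 2 φ p) (v v' w : V) :
    complexHessian φ p (v + v') w = complexHessian φ p v w + complexHessian φ p v' w := by
  simp only [complexHessian_eq h, smul_add, map_add, add_apply]
  push_cast; ring

lemma complexHessian_conj {φ : V → ℝ} {p : V} (h : ContDiffAt ℝ 2 φ p) (v w : V) :
    (starRingEnd ℂ) (complexHessian φ p v w) = complexHessian φ p w v := by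
  simp only [complexHessian_eq h, map_mul, map_add, conj_ofReal, conj_I, map_div₀, map_one]
  rw [h.fderiv_fderiv_symm w v, h.fderiv_fderiv_symm (I • w) (I • v),
    h.fderiv_fderiv_symm w (I • v), h.fderiv_fderiv_symm (I • w) v]
  push_cast
  simp only [map_ofNat]
  ring

lemma complexHessian_smul_left {φ : V → ℝ} {p : V} (h : ContDiffAt ℝ 2 φ p) (c : ℂ) (v w : V) :
    complexHessian φ p (c • v) w = c * complexHessian φ p v w := by
  have hc : c • v = c.re • v + c.im • (I • v) := by
    conv_lhs => rw [← re_add_im c]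
    rw [add_smul, mul_smul, ← coe_algebraMap, algebraMap_smul, algebraMap_smul]
  have hIc : I • c • v = c.re • (I • v) - c.im • v := by
    rw [hc, smul_add, smul_comm I c.re v, smul_comm I c.im (I • v), smul_smul I I, I_mul_I]
    simp [sub_eq_add_neg]
  have hII : I • I • v = -v := by rw [smul_smul, I_mul_I]; simp
  simp only [complexHessian_eq h]
  rw [hIc, hc]
  simp only [map_add, map_sub, map_smul, add_apply,
    sub_apply, smul_apply, smul_eq_mul]
  push_cast
  set a : ℂ := ((fderiv ℝ (fderiv ℝ φ) p v w : ℝ) : ℂ)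
  set b : ℂ := ((fderiv ℝ (fderiv ℝ φ) p v (I • w) : ℝ) : ℂ)
  set d : ℂ := ((fderiv ℝ (fderiv ℝ φ) p (I • v) w : ℝ) : ℂ)
  set e : ℂ := ((fderiv ℝ (fderiv ℝ φ) p (I • v) (I • w) : ℝ) : ℂ)
  conv_rhs => rw [← re_add_im c]
  linear_combination (-1 / 4 : ℂ) * (c.im : ℂ) * (b - d) * I_mul_I

lemma complexHessian_self {φ : V → ℝ} {p : V} (h : ContDiffAt ℝ 2 φ p) (v : V) :
    complexHessian φ p v v = (((1 / 4) * (fderiv ℝ (fderiv ℝ φ) p v v +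
      fderiv ℝ (fderiv ℝ φ) p (I • v) (I • v)) : ℝ) : ℂ) := by
  rw [complexHessian_eq h, h.fderiv_fderiv_symm v (I • v)]
  push_cast; ring

lemma complexHessian_add {φ φ' : V → ℝ} {p : V} (h : ContDiffAt ℝ 2 φ p)
    (h' : ContDiffAt ℝ 2 φ' p) (v w : V) :
    complexHessian (fun q => φ q + φ' q) p v w =
      complexHessian φ p v w + complexHessian φ' p v w := by
  have hev : fderiv ℝ (fun q => φ q + φ' q) =ᶠ[𝓝 p] fun q => fderiv ℝ φ q + fderiv ℝ φ' q := by
    filter_upwards [h.eventually (by simp), h'.eventually (by simp)] with q hq hq'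
    exact fderiv_fun_add (hq.differentiableAt (by norm_num)) (hq'.differentiableAt (by norm_num))
  have h1 : DifferentiableAt ℝ (fderiv ℝ φ) p :=
    (h.fderiv_right (m := 1) (by norm_num)).differentiableAt (by norm_num)
  have h1' : DifferentiableAt ℝ (fderiv ℝ φ') p :=
    (h'.fderiv_right (m := 1) (by norm_num)).differentiableAt (by norm_num)
  rw [complexHessian_eq h, complexHessian_eq h', complexHessian_eq (h.add h'), hev.fderiv_eq,
    fderiv_fun_add h1 h1']
  simp only [add_apply]
  push_cast; ring

lemma complexHessian_const_mul {φ : V → ℝ} {p : V} (c : ℝ) (h : ContDiffAt ℝ 2 φ p) (v w : V) :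
    complexHessian (fun q => c * φ q) p v w = c * complexHessian φ p v w := by
  have hev : fderiv ℝ (fun q => c * φ q) =ᶠ[𝓝 p] fun q => c • fderiv ℝ φ q := by
    filter_upwards [h.eventually (by simp)] with q hq
    exact fderiv_const_mul (hq.differentiableAt (by norm_num)) c
  have h1 : DifferentiableAt ℝ (fderiv ℝ φ) p :=
    (h.fderiv_right (m := 1) (by norm_num)).differentiableAt (by norm_num)
  rw [complexHessian_eq h, complexHessian_eq (contDiffAt_const.mul h), hev.fderiv_eq,
    fderiv_fun_const_smul h1]
  simp only [smul_apply, smul_eq_mul]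
  push_cast; ring

lemma complexHessian_sub {φ φ' : V → ℝ} {p : V} (h : ContDiffAt ℝ 2 φ p)
    (h' : ContDiffAt ℝ 2 φ' p) (v w : V) :
    complexHessian (fun q => φ q - φ' q) p v w =
      complexHessian φ p v w - complexHessian φ' p v w := by
  have := complexHessian_add h (contDiffAt_const.mul h' : ContDiffAt ℝ 2 (fun q => (-1) * φ' q) p) v w
  rw [complexHessian_const_mul _ h'] at this
  simpa [sub_eq_add_neg] using this

/-- The second derivative of a composition. -/
lemma fderiv_fderiv_comp {F : V' → V} {φ : V → ℝ} {p : V'} (hφ : ContDiffAt ℝ 2 φ (F p))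
    (hF : ContDiffAt ℝ 2 F p) (v w : V') :
    fderiv ℝ (fderiv ℝ (φ ∘ F)) p v w =
      fderiv ℝ (fderiv ℝ φ) (F p) (fderiv ℝ F p v) (fderiv ℝ F p w) +
        fderiv ℝ φ (F p) (fderiv ℝ (fderiv ℝ F) p v w) := by
  have hev : (fun q => fderiv ℝ (φ ∘ F) q w) =ᶠ[𝓝 p] fun q => fderiv ℝ φ (F q) (fderiv ℝ F q w) := by
    filter_upwards [hF.eventually (by simp),
      hF.continuousAt.eventually (hφ.eventually (by simp))] with q hq hq'
    rw [fderiv_comp q (hq'.differentiableAt (by norm_num)) (hq.differentiableAt (by norm_num))]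
    rfl
  have hd : HasFDerivAt (fun q => fderiv ℝ φ (F q)) (fderiv ℝ (fderiv ℝ φ) (F p) ∘L fderiv ℝ F p) p :=
    ((hφ.fderiv_right (m := 1) (by norm_num)).differentiableAt (by norm_num)).hasFDerivAt.comp p
      (hF.differentiableAt (by norm_num)).hasFDerivAt
  have h1 := ((hφ.comp p hF).hasFDerivAt_fderiv_apply w).fderiv
  rw [hev.fderiv_eq, (hd.clm_apply (hF.hasFDerivAt_fderiv_apply w)).fderiv] at h1
  have h2 := DFunLike.congr_fun h1 v
  simp only [add_apply, ContinuousLinearMap.comp_apply, ContinuousLinearMap.flip_apply] at h2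
  rw [← h2, add_comm]

lemma fderiv_real_eq {F : V' → V} {p : V'} (hF : DifferentiableAt ℂ F p) (v : V') :
    fderiv ℝ F p v = fderiv ℂ F p v := by
  rw [hF.fderiv_restrictScalars ℝ]; rfl

/-- The real second derivative of a holomorphic map agrees with the complex one, hence is complex
bilinear. In the chain rule for the complex Hessian this makes the terms Dφ(D²F) cancel. -/
lemma fderiv_fderiv_I_smul {F : V' → V} {p : V'} (hF : ContDiffAt ℂ 2 F p) (v w : V') :
    fderiv ℝ (fderiv ℝ F) p v (I • w) = I • fderiv ℝ (fderiv ℝ F) p v w ∧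
    fderiv ℝ (fderiv ℝ F) p (I • v) w = I • fderiv ℝ (fderiv ℝ F) p v w := by
  have key (v w) : fderiv ℝ (fderiv ℝ F) p v w = fderiv ℂ (fderiv ℂ F) p v w := by
    have hd : DifferentiableAt ℂ (fderiv ℂ F) p :=
      (hF.fderiv_right (m := 1) (by norm_num)).differentiableAt (by norm_num)
    have h1 : HasFDerivAt (fun q => fderiv ℂ F q w) ((fderiv ℂ (fderiv ℂ F) p).flip w) p :=
      (hd.hasFDerivAt.clm_apply (hasFDerivAt_const w p)).congr_fderiv (by ext; simp)
    have hev : (fun q => fderiv ℝ F q w) =ᶠ[𝓝 p] fun q => fderiv ℂ F q w := by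
      filter_upwards [hF.eventually (by simp)] with q hq
      exact fderiv_real_eq (hq.differentiableAt (by norm_num)) w
    have h2 := ((hF.restrict_scalars ℝ).hasFDerivAt_fderiv_apply w).fderiv
    rw [hev.fderiv_eq] at h2
    have h3 := DFunLike.congr_fun h2 v
    rw [fderiv_real_eq h1.differentiableAt, h1.fderiv] at h3
    exact h3.symm
  simp [key]

/-- The complex Hessian is natural under holomorphic maps. -/
lemma complexHessian_comp {F : V' → V} {φ : V → ℝ} {p : V'} (hφ : ContDiffAt ℝ 2 φ (F p))
    (hF : ContDiffAt ℂ 2 F p) (v w : V') :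
    complexHessian (fun q => φ (F q)) p v w =
      complexHessian φ (F p) (fderiv ℂ F p v) (fderiv ℂ F p w) := by
  have hFR := hF.restrict_scalars ℝ
  have hd := hF.differentiableAt (by norm_num)
  have h1 := complexHessian_eq (hφ.comp p hFR) v w
  rw [complexHessian_eq hφ]
  refine h1.trans ?_
  simp only [fderiv_fderiv_comp hφ hFR, (fderiv_fderiv_I_smul hF _ _).1,
    (fderiv_fderiv_I_smul hF _ _).2, fderiv_real_eq hd, map_smul, smul_smul, I_mul_I, neg_smul,
    one_smul, map_neg]
  push_cast; ring

lemma continuousAt_complexHessian {φ : V → ℝ} {p : V} (h : ContDiffAt ℝ 2 φ p) (v w : V) :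
    ContinuousAt (fun q : V × V × V => complexHessian φ q.1 q.2.1 q.2.2) (p, v, w) := by
  have hc : ContinuousAt (fun q : V × V × V => fderiv ℝ (fderiv ℝ φ) q.1) (p, v, w) :=
    ContinuousAt.comp (f := Prod.fst) (g := fderiv ℝ (fderiv ℝ φ)) (x := (p, v, w))
      (((h.fderiv_right (m := 1) (by norm_num)).fderiv_right (m := 0)
        (by norm_num)).continuousAt) continuousAt_fst
  have hI : Continuous fun x : V => I • x := continuous_const_smul I
  have hev : (fun q : V × V × V => complexHessian φ q.1 q.2.1 q.2.2) =ᶠ[𝓝 (p, v, w)] fun q =>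
      (1 / 4) * (((fderiv ℝ (fderiv ℝ φ) q.1 q.2.1 q.2.2 +
        fderiv ℝ (fderiv ℝ φ) q.1 (I • q.2.1) (I • q.2.2) : ℝ) : ℂ)
        + I * ((fderiv ℝ (fderiv ℝ φ) q.1 q.2.1 (I • q.2.2) -
          fderiv ℝ (fderiv ℝ φ) q.1 (I • q.2.1) q.2.2 : ℝ) : ℂ)) := by
    filter_upwards [continuousAt_fst.eventually (h.eventually (by simp))] with q hq
    exact complexHessian_eq hq _ _
  refine ContinuousAt.congr ?_ hev.symm
  have a {f g : V × V × V → V} (hf : Continuous f) (hg : Continuous g) :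
      ContinuousAt (fun q => fderiv ℝ (fderiv ℝ φ) q.1 (f q) (g q)) (p, v, w) :=
    (hc.clm_apply hf.continuousAt).clm_apply hg.continuousAt
  have h1 : Continuous fun q : V × V × V => q.2.1 := by fun_prop
  have h2 : Continuous fun q : V × V × V => q.2.2 := by fun_prop
  refine continuousAt_const.mul (ContinuousAt.add ?_ (continuousAt_const.mul ?_))
  · exact Complex.continuous_ofReal.continuousAt.comp
      ((a h1 h2).add (a (hI.comp h1) (hI.comp h2)))
  · exact Complex.continuous_ofReal.continuousAt.comp
      ((a h1 (hI.comp h2)).sub (a (hI.comp h1) h2))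

end ComplexHessian

/-! ### Second derivative test and second-order Taylor polynomials. -/

section SecondDerivativeTest

open Filter Topology

variable {V : Type*} [NormedAddCommGroup V] [NormedSpace ℝ V]

/-- A negative second derivative would make the point a local maximum too, so the function would be
locally constant and its second derivative zero. -/
lemma deriv_deriv_nonneg_of_isLocalMin {f : ℝ → ℝ} {a : ℝ} (hf : ContDiffAt ℝ 2 f a)
    (hm : IsLocalMin f a) : 0 ≤ deriv (deriv f) a := by
  by_contra! hneg
  have hmax := isLocalMax_of_deriv_deriv_neg hneg hm.deriv_eq_zero hf.continuousAt
  have hc : f =ᶠ[𝓝 a] fun _ => f a := by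
    filter_upwards [hm, hmax] with x h1 h2 using le_antisymm h2 h1
  have : deriv (deriv f) a = 0 := by
    rw [hc.deriv.deriv_eq]; simp
  exact hneg.ne this

lemma fderiv_fderiv_nonneg_of_isLocalMin {φ : V → ℝ} {p : V} (hφ : ContDiffAt ℝ 2 φ p)
    (hm : IsLocalMin φ p) (v : V) : 0 ≤ fderiv ℝ (fderiv ℝ φ) p v v := by
  set γ : ℝ → V := fun t => p + t • v with hγ
  have hγ0 : γ 0 = p := by simp [hγ]
  have hγc : ContDiff ℝ 2 γ := by fun_prop
  have hφ' : ContDiffAt ℝ 2 φ (γ 0) := by rwa [hγ0]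
  have hdγ (t : ℝ) : HasDerivAt γ v t := by
    simpa [hγ] using ((hasDerivAt_id t).smul_const v).const_add p
  have hmin : IsLocalMin (φ ∘ γ) 0 := by
    have : Tendsto γ (𝓝 0) (𝓝 p) := by simpa [hγ0] using hγc.continuous.tendsto 0
    have := this.eventually hm
    simpa [IsLocalMin, IsMinFilter, hγ0] using this
  have h := deriv_deriv_nonneg_of_isLocalMin (hφ'.comp 0 hγc.contDiffAt) hmin
  have hev : deriv (φ ∘ γ) =ᶠ[𝓝 0] fun t => fderiv ℝ φ (γ t) v := by
    filter_upwards [hγc.continuous.continuousAt.eventually (hφ'.eventually (by simp))] with t ht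
    exact ((ht.differentiableAt (by norm_num)).hasFDerivAt.comp_hasDerivAt t (hdγ t)).deriv
  have h2 : HasDerivAt (fun t => fderiv ℝ φ (γ t) v) (fderiv ℝ (fderiv ℝ φ) (γ 0) v v) 0 :=
    (hφ'.hasFDerivAt_fderiv_apply v).comp_hasDerivAt 0 (hdγ 0)
  rwa [hev.deriv_eq, h2.deriv, hγ0] at h

/-- A `C²` function whose 2-jet vanishes at a point is `o(‖z - p‖²)` there. -/
lemma eventually_abs_le_of_fderiv_fderiv_eq_zero {φ : V → ℝ} {p : V} (hφ : ContDiffAt ℝ 2 φ p)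
    (h0 : φ p = 0) (h1 : fderiv ℝ φ p = 0) (h2 : fderiv ℝ (fderiv ℝ φ) p = 0) {ε : ℝ}
    (hε : 0 < ε) : ∀ᶠ z in 𝓝 p, |φ z| ≤ ε * ‖z - p‖ ^ 2 := by
  have hd : HasFDerivAt (fderiv ℝ φ) (0 : V →L[ℝ] V →L[ℝ] ℝ) p := by
    rw [← h2]
    exact ((hφ.fderiv_right (m := 1) (by norm_num)).differentiableAt (by norm_num)).hasFDerivAt
  have hev := (hasFDerivAt_iff_isLittleO.1 hd).def hε
  obtain ⟨r, hr, hball⟩ := Metric.eventually_nhds_iff_ball.1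
    (hev.and (hφ.eventually (by simp)))
  filter_upwards [Metric.ball_mem_nhds p hr] with z hz
  have hsub : Metric.closedBall p ‖z - p‖ ⊆ Metric.ball p r :=
    Metric.closedBall_subset_ball (by simpa [dist_eq_norm] using hz)
  -- Mean value inequality on the closed ball of radius ‖z - p‖, where the derivative is at most ε‖z
  -- - p‖ because it vanishes to first order at p.
  have := (convex_closedBall p ‖z - p‖).norm_image_sub_le_of_norm_fderiv_le (𝕜 := ℝ) (f := φ)
    (C := ε * ‖z - p‖) (x := p) (y := z)
    (fun w hw => ((hball w (hsub hw)).2.differentiableAt (by norm_num)))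
    (fun w hw => by
      have h3 := (hball w (hsub hw)).1
      simp only [h1, sub_zero, zero_apply] at h3
      refine h3.trans (mul_le_mul_of_nonneg_left ?_ hε.le)
      simpa [dist_eq_norm] using hw)
    (by simp) (by simp [dist_eq_norm])
  rw [h0, sub_zero, Real.norm_eq_abs] at this
  linarith [this, sq ‖z - p‖, mul_assoc ε ‖z - p‖ ‖z - p‖]

variable (p : V) (a : ℝ) (L : V →L[ℝ] ℝ) (B : V →L[ℝ] V →L[ℝ] ℝ)

/-- The quadratic polynomial with given 2-jet. -/
def quadPoly (z : V) : ℝ := a + L (z - p) + (1 / 2) * B (z - p) (z - p)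

lemma contDiff_quadPoly : ContDiff ℝ ∞ (quadPoly p a L B) := by
  unfold quadPoly
  have h1 : ContDiff ℝ ∞ fun z : V => z - p := by fun_prop
  exact (contDiff_const.add (L.contDiff.comp h1)).add
    (contDiff_const.mul ((B.contDiff.comp h1).clm_apply h1))

lemma fderiv_quadPoly (hB : ∀ v w, B v w = B w v) (z : V) :
    fderiv ℝ (quadPoly p a L B) z = L + B (z - p) := by
  have h1 : HasFDerivAt (fun z : V => z - p) (ContinuousLinearMap.id ℝ V) z :=
    (hasFDerivAt_id z).sub_const p
  have h2 : HasFDerivAt (quadPoly p a L B) _ z :=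
    (((L.hasFDerivAt.comp z h1).const_add a)).fun_add
      (((B.hasFDerivAt.comp z h1).clm_apply h1).const_mul (1 / 2))
  rw [h2.fderiv]
  ext v
  simp only [add_apply, smul_apply, ContinuousLinearMap.comp_apply, Function.comp_apply,
    ContinuousLinearMap.flip_apply, ContinuousLinearMap.id_apply, smul_eq_mul, hB v (z - p)]
  ring

lemma fderiv_fderiv_quadPoly (hB : ∀ v w, B v w = B w v) (z : V) :
    fderiv ℝ (fderiv ℝ (quadPoly p a L B)) z = B := by
  have : fderiv ℝ (quadPoly p a L B) = fun z => L + B (z - p) :=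
    funext (fderiv_quadPoly p a L B hB)
  rw [this]
  have h1 : HasFDerivAt (fun z : V => z - p) (ContinuousLinearMap.id ℝ V) z :=
    (hasFDerivAt_id z).sub_const p
  exact ((B.hasFDerivAt.comp z h1).const_add L).fderiv

end SecondDerivativeTest

/-! ### The complex Hessian of the squared norm. -/

section NormSq

variable {k : ℕ}

lemma complexHessian_norm_sub_sq (a p v : CSpace k) :
    complexHessian (fun z => ‖z - a‖ ^ 2) p v v = ((‖v‖ ^ 2 : ℝ) : ℂ) := by
  have hc : ContDiff ℝ 2 fun z : CSpace k => ‖z - a‖ ^ 2 :=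
    (contDiff_id.sub contDiff_const).norm_sq ℝ
  have h1 (z : CSpace k) : fderiv ℝ (fun z => ‖z - a‖ ^ 2) z = 2 • innerSL ℝ (z - a) := by
    have := ((hasStrictFDerivAt_norm_sq (z - a)).hasFDerivAt.comp z
      ((hasFDerivAt_id z).sub_const a))
    exact this.fderiv
  have h2 : fderiv ℝ (fderiv ℝ (fun z : CSpace k => ‖z - a‖ ^ 2)) p = 2 • innerSL ℝ := by
    rw [funext h1]
    have := ((innerSL ℝ (E := CSpace k)).hasFDerivAt.comp p
      ((hasFDerivAt_id p).sub_const a)).const_smul (2 : ℕ)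
    exact this.fderiv
  rw [complexHessian_self hc.contDiffAt, h2]
  have h3 (w : CSpace k) : (2 • innerSL ℝ (E := CSpace k)) w w = 2 * ‖w‖ ^ 2 := by
    rw [← real_inner_self_eq_norm_sq, two_smul, two_mul]; rfl
  rw [h3, h3, norm_smul, Complex.norm_I]
  congr 1
  ring

end NormSq

/-! ### Subharmonicity in the viscosity sense. -/

section Viscosity

open Filter Topology Metric InnerProductSpace

variable {m : ℕ}

/-- The trace of the complex Hessian, a quarter of the Laplacian. -/
def leviTrace (G : CSpace m → ℝ) (z : CSpace m) : ℝ :=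
  ∑ j : Fin m, (complexHessian G z (EuclideanSpace.single j 1) (EuclideanSpace.single j 1)).re

/-- The Laplacian is computed in the real orthonormal basis e_j, ie_j; the Hessian at (e_j, e_j) is
a quarter of the two corresponding second derivatives. -/
lemma laplacian_eq_leviTrace {G : CSpace m → ℝ} {z : CSpace m} (hG : ContDiffAt ℝ 2 G z) :
    Laplacian.laplacian G z = 4 * leviTrace G z := by
  rw [InnerProductSpace.laplacian_eq_iteratedFDeriv_orthonormalBasis G
    (Pi.orthonormalBasis fun _ : Fin m => Complex.orthonormalBasisOneI)]
  simp only [Pi.orthonormalBasis_apply, iteratedFDeriv_two_apply, leviTrace, Finset.mul_sum]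
  rw [Fintype.sum_sigma]
  refine Finset.sum_congr rfl fun j _ => ?_
  rw [complexHessian_self hG, Complex.ofReal_re, Fin.sum_univ_two]
  have : (Complex.I • EuclideanSpace.single j (1 : ℂ) : CSpace m) = EuclideanSpace.single j Complex.I := by
    ext i; simp
  rw [this]
  simp

lemma leviTrace_add {G G' : CSpace m → ℝ} {z : CSpace m} (h : ContDiffAt ℝ 2 G z)
    (h' : ContDiffAt ℝ 2 G' z) :
    leviTrace (fun w => G w + G' w) z = leviTrace G z + leviTrace G' z := by
  simp [leviTrace, complexHessian_add h h', Finset.sum_add_distrib]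

lemma leviTrace_norm_sub_sq (a z : CSpace m) : leviTrace (fun w => ‖w - a‖ ^ 2) z = m := by
  simp [leviTrace, complexHessian_norm_sub_sq]

lemma leviTrace_const_mul {G : CSpace m → ℝ} {z : CSpace m} (c : ℝ) (h : ContDiffAt ℝ 2 G z) :
    leviTrace (fun w => c * G w) z = c * leviTrace G z := by
  simp [leviTrace, complexHessian_const_mul c h, Finset.mul_sum]

lemma leviTrace_const (c : ℝ) (z : CSpace m) : leviTrace (fun _ => c) z = 0 := by
  have h (v : CSpace m) : wirtingerBar v (fun _ => (c : ℂ)) = fun _ => 0 := by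
    ext; simp [wirtingerBar]
  simp [leviTrace, complexHessian, wirtinger, h]

/-- `C²` functions touching `h` from above at `z` have nonnegative Laplacian at `z`. -/
def IsViscositySubharmonicAt (h : CSpace m → EReal) (z : CSpace m) : Prop :=
  ∀ G : CSpace m → ℝ, ContDiffAt ℝ 2 G z → (∀ᶠ w in 𝓝 z, h w ≤ G w) → h z = G z →
    0 ≤ leviTrace G z

/-- A touching function with negative trace could be replaced, near z, by a harmonic quadratic
polynomial that dominates h on a small sphere but lies below h at the centre. -/
lemma IsSubharmonicOn.isViscositySubharmonicAt {h : CSpace m → EReal} {U : Set (CSpace m)}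
    (hU : IsOpen U) (hh : IsSubharmonicOn h U) {z : CSpace m} (hz : z ∈ U) :
    IsViscositySubharmonicAt h z := by
  intro G hG hle heq
  by_contra! hneg
  have hm : 0 < (m : ℝ) := by
    rcases Nat.eq_zero_or_pos m with rfl | h
    · simp [leviTrace] at hneg
    · exact_mod_cast h
  -- With this κ the polynomial Q + κ‖w - z‖² is harmonic; half of κ is then spent on the Taylor
  -- remainder and half is left over as a strict gap.
  set κ : ℝ := -leviTrace G z / m with hκ
  have hκ0 : 0 < κ := div_pos (by linarith) hm
  set Q := quadPoly z (G z) (fderiv ℝ G z) (fderiv ℝ (fderiv ℝ G) z) with hQ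
  have hQc : ContDiff ℝ 2 Q := (contDiff_quadPoly _ _ _ _).of_le (by norm_cast)
  have hNc : ContDiff ℝ 2 fun w : CSpace m => ‖w - z‖ ^ 2 :=
    (contDiff_id.sub contDiff_const).norm_sq ℝ
  have hsymm : ∀ v w, fderiv ℝ (fderiv ℝ G) z v w = fderiv ℝ (fderiv ℝ G) z w v :=
    fun v w => hG.fderiv_fderiv_symm v w
  have hQQ := fderiv_fderiv_quadPoly z (G z) (fderiv ℝ G z) (fderiv ℝ (fderiv ℝ G) z) hsymm
  have hQl (w : CSpace m) : leviTrace Q w = leviTrace G z := by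
    simp only [leviTrace, complexHessian_self hG, complexHessian_self hQc.contDiffAt]
    simp only [hQ, hQQ]
  have hR : ∀ᶠ w in 𝓝 z, |G w - Q w| ≤ κ / 2 * ‖w - z‖ ^ 2 := by
    have hd1 : DifferentiableAt ℝ (fderiv ℝ G) z :=
      (hG.fderiv_right (m := 1) (by norm_num)).differentiableAt (by norm_num)
    have hd2 : DifferentiableAt ℝ (fderiv ℝ Q) z :=
      (hQc.contDiffAt.fderiv_right (m := 1) (by norm_num)).differentiableAt (by norm_num)
    refine eventually_abs_le_of_fderiv_fderiv_eq_zero (φ := fun w => G w - Q w)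
      (hG.sub hQc.contDiffAt) (by simp [hQ, quadPoly]) ?_ ?_ (by linarith)
    · rw [fderiv_fun_sub (hG.differentiableAt (by norm_num)) (hQc.differentiable (by norm_num) _), hQ,
        fderiv_quadPoly _ _ _ _ hsymm]
      simp
    · have hev : fderiv ℝ (fun w => G w - Q w) =ᶠ[𝓝 z] fun w => fderiv ℝ G w - fderiv ℝ Q w := by
        filter_upwards [hG.eventually (by simp)] with w hw
        exact fderiv_fun_sub (hw.differentiableAt (by norm_num))
          (hQc.differentiable (by norm_num) _)
      rw [hev.fderiv_eq, fderiv_fun_sub hd1 hd2, hQ, hQQ, sub_self]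
  obtain ⟨r, hr, hball⟩ := Metric.nhds_basis_closedBall.eventually_iff.1
    ((hle.and hR).and (hU.mem_nhds hz))
  -- On the sphere g = Q + κr²/2 ≥ G ≥ h, while at the centre g = G(z) - κr²/2 < h(z).
  set g : CSpace m → ℝ := fun w => (Q w + κ * ‖w - z‖ ^ 2) + -(κ / 2 * r ^ 2) with hg
  have hgc : ContDiff ℝ 2 g := (hQc.add (contDiff_const.mul hNc)).add contDiff_const
  have hgl (w : CSpace m) : Laplacian.laplacian g w = 0 := by
    rw [laplacian_eq_leviTrace hgc.contDiffAt, hg,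
      leviTrace_add (hQc.add (contDiff_const.mul hNc)).contDiffAt contDiffAt_const,
      leviTrace_add hQc.contDiffAt (contDiff_const.mul hNc).contDiffAt, hQl,
      leviTrace_const_mul κ hNc.contDiffAt, leviTrace_norm_sub_sq, leviTrace_const, hκ]
    field_simp
    ring
  have := hh.2.2 z r hr (fun w hw => (hball hw).2) g hgc.continuous.continuousOn
    (fun w _ => ⟨hgc.contDiffAt, Eventually.of_forall hgl⟩)
    (fun w hw => by
      refine ((hball (sphere_subset_closedBall hw)).1.1).trans ?_
      have h1 := (hball (sphere_subset_closedBall hw)).1.2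
      have h2 : ‖w - z‖ = r := by simpa [dist_eq_norm] using hw
      rw [h2] at h1
      have h3 := (abs_le.1 h1).2
      rw [EReal.coe_le_coe_iff, hg]
      simp only [h2]
      linarith) z (mem_ball_self hr)
  rw [heq, EReal.coe_le_coe_iff] at this
  simp only [hg, hQ, quadPoly] at this
  simp at this
  nlinarith [mul_pos hκ0 (pow_pos hr 2)]

/-- If h exceeds g somewhere inside the ball, then h - g + ε‖z - c‖² has an interior maximum for
small ε. There g - ε‖z - c‖² plus a constant touches h from above with trace -εm, which is negative
because m ≥ 1. -/
lemma isSubharmonicOn_of_viscosity (hm : 1 ≤ m) {h : CSpace m → EReal} {U : Set (CSpace m)}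
    (husc : UpperSemicontinuousOn h U) (htop : ∀ z ∈ U, h z < ⊤)
    (hv : ∀ z ∈ U, IsViscositySubharmonicAt h z) : IsSubharmonicOn h U := by
  refine ⟨husc, htop, fun c r hr hsub g hgc hgh hsph z₀ hz₀ => ?_⟩
  by_contra! hlt
  have hz₀U := hsub (ball_subset_closedBall hz₀)
  obtain ⟨a, ha⟩ : ∃ a : ℝ, h z₀ = a :=
    ⟨(h z₀).toReal, (EReal.coe_toReal (htop z₀ hz₀U).ne (bot_lt_iff_ne_bot.1
      ((EReal.bot_lt_coe _).trans hlt))).symm⟩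
  rw [ha, EReal.coe_lt_coe_iff] at hlt
  -- Small enough that the boundary values, at most εr², stay below the value at z₀.
  set ε : ℝ := (a - g z₀) / (2 * r ^ 2) with hε
  have hε0 : 0 < ε := div_pos (by linarith) (by positivity)
  have hεr : ε * r ^ 2 < a - g z₀ := by
    rw [hε]; field_simp; linarith
  set F : CSpace m → EReal := fun z => h z + ((ε * ‖z - c‖ ^ 2 - g z : ℝ) : EReal) with hF
  have hFusc : UpperSemicontinuousOn F (closedBall c r) := by
    refine (husc.mono hsub).add' (g := fun z => ((ε * ‖z - c‖ ^ 2 - g z : ℝ) : EReal)) ?_ ?_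
    · refine ContinuousOn.upperSemicontinuousOn ?_
      refine continuous_coe_real_ereal.comp_continuousOn (ContinuousOn.sub ?_ hgc)
      fun_prop
    · intro z _
      exact EReal.continuousAt_add (Or.inr (EReal.coe_ne_bot _)) (Or.inr (EReal.coe_ne_top _))
  obtain ⟨z₁, hz₁, hmax⟩ := hFusc.exists_isMaxOn (nonempty_closedBall.2 hr.le)
    (isCompact_closedBall c r)
  have hF0 : ((ε * r ^ 2 : ℝ) : EReal) < F z₀ := by
    rw [hF]; simp only [ha]
    rw [← EReal.coe_add, EReal.coe_lt_coe_iff]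
    nlinarith [mul_nonneg hε0.le (sq_nonneg ‖z₀ - c‖)]
  have hF1 : ((ε * r ^ 2 : ℝ) : EReal) < F z₁ :=
    hF0.trans_le (hmax (ball_subset_closedBall hz₀))
  obtain ⟨b, hb⟩ : ∃ b : ℝ, h z₁ = b := by
    refine ⟨(h z₁).toReal, (EReal.coe_toReal (htop z₁ (hsub hz₁)).ne ?_).symm⟩
    intro hbot
    simp [hF, hbot] at hF1
  have hz₁b : z₁ ∈ ball c r := by
    rcases (mem_closedBall.1 hz₁).lt_or_eq with h1 | h1
    · exact h1
    · exfalso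
      have h2 := hsph z₁ h1
      rw [hb, EReal.coe_le_coe_iff] at h2
      simp only [hF, hb] at hF1
      rw [← EReal.coe_add, EReal.coe_lt_coe_iff, ← dist_eq_norm, h1] at hF1
      linarith
  have hg1 := hgh z₁ hz₁b
  have hNc : ContDiff ℝ 2 fun w : CSpace m => ‖w - c‖ ^ 2 :=
    (contDiff_id.sub contDiff_const).norm_sq ℝ
  set M : ℝ := b + (ε * ‖z₁ - c‖ ^ 2 - g z₁) with hM
  have h2 := hv z₁ (hsub hz₁) (fun w => (g w + (-ε) * ‖w - c‖ ^ 2) + M)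
    ((hg1.1.add (contDiff_const.mul hNc).contDiffAt).add contDiffAt_const) ?_ ?_
  · rw [leviTrace_add (hg1.1.add (contDiff_const.mul hNc).contDiffAt) contDiffAt_const,
      leviTrace_add hg1.1 (contDiff_const.mul hNc).contDiffAt, leviTrace_const,
      leviTrace_const_mul _ hNc.contDiffAt, leviTrace_norm_sub_sq] at h2
    have h3 : Laplacian.laplacian g z₁ = 0 := hg1.2.eq_of_nhds
    rw [laplacian_eq_leviTrace hg1.1] at h3
    have : (1 : ℝ) ≤ m := by exact_mod_cast hm
    nlinarith
  · filter_upwards [isOpen_ball.mem_nhds hz₁b] with w hw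
    have h3 : F w ≤ F z₁ := hmax (ball_subset_closedBall hw)
    simp only [hF, hb] at h3
    rw [← EReal.coe_add, ← hM] at h3
    rcases eq_or_ne (h w) ⊥ with h4 | h4
    · rw [h4]; exact bot_le
    · lift h w to ℝ using ⟨(htop w (hsub (ball_subset_closedBall hw))).ne, h4⟩ with t
      rw [← EReal.coe_add, EReal.coe_le_coe_iff] at h3
      rw [EReal.coe_le_coe_iff]
      linarith
  · rw [hb]; congr 1; rw [hM]; ring

/-- Comparison of the complex Hessians of touching functions along a complex line. -/
lemma complexHessian_re_le_of_touch {φ : ℂ → ℝ} {G : CSpace m → ℝ} {z : CSpace m}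
    (v : CSpace m) (hφ : ContDiffAt ℝ 2 φ 0) (hG : ContDiffAt ℝ 2 G z)
    (hle : ∀ᶠ ζ in 𝓝 (0 : ℂ), φ ζ ≤ G (z + ζ • v)) (heq : φ 0 = G z) :
    (complexHessian φ 0 1 1).re ≤ (complexHessian G z v v).re := by
  set γ : ℂ → CSpace m := fun ζ => z + ζ • v with hγ
  have hγ0 : γ 0 = z := by simp [hγ]
  have hγc : ContDiffAt ℂ 2 γ 0 := by fun_prop
  have hdγ : fderiv ℂ γ 0 1 = v := by
    have : HasDerivAt γ v 0 := by
      simpa [hγ] using ((hasDerivAt_id (0 : ℂ)).smul_const v).const_add z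
    simpa using DFunLike.congr_fun this.hasFDerivAt.fderiv 1
  have hG' : ContDiffAt ℝ 2 G (γ 0) := by rwa [hγ0]
  have h1 := complexHessian_comp hG' hγc 1 1
  rw [hdγ, hγ0] at h1
  have hGγ : ContDiffAt ℝ 2 (fun ζ => G (γ ζ)) 0 := hG'.comp 0 (hγc.restrict_scalars ℝ)
  have hd := hGγ.sub hφ
  have hmin : IsLocalMin (fun ζ => G (γ ζ) - φ ζ) 0 := by
    filter_upwards [hle] with ζ hζ
    simp only [hγ0, heq, sub_self]
    linarith
  rw [← h1, ← sub_nonneg, ← Complex.sub_re, ← complexHessian_sub hGγ hφ, complexHessian_self hd,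
    Complex.ofReal_re]
  have := fderiv_fderiv_nonneg_of_isLocalMin hd hmin
  have h3 := this 1
  have h4 := this (Complex.I • 1)
  linarith

end Viscosity

/-! ### The Cauchy–Pompeiu formula. -/

section CauchyPompeiu

open MeasureTheory Set Filter Topology Complex

/-- In polar coordinates the Jacobian r cancels the singularity 1/r. -/
lemma locallyIntegrable_inv_complex : LocallyIntegrable (fun z : ℂ => z⁻¹) volume := by
  intro x
  obtain ⟨R, hR⟩ : ∃ R : ℝ, ‖x‖ < R := exists_gt _
  have hR0 : 0 < R := (norm_nonneg x).trans_lt hR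
  refine ⟨Metric.ball 0 R, Metric.isOpen_ball.mem_nhds (by simpa using hR), ?_⟩
  have h : Integrable (fun z : ℂ => (Iio R).indicator (fun y : ℝ => y⁻¹) ‖z‖) volume := by
    rw [integrable_fun_norm_addHaar volume (f := (Iio R).indicator fun y : ℝ => y⁻¹)]
    have : IntegrableOn ((Iio R).indicator fun _ : ℝ => (1 : ℝ)) (Ioi 0) := by
      rw [IntegrableOn, integrable_indicator_iff measurableSet_Iio, IntegrableOn,
        Measure.restrict_restrict measurableSet_Iio, Iio_inter_Ioi]
      simp
    refine this.congr_fun (fun y hy => ?_) measurableSet_Ioi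
    have : y ≠ 0 := (mem_Ioi.1 hy).ne'
    by_cases hyR : y < R <;> simp [hyR, Complex.finrank_real_complex, this]
  have h2 : IntegrableOn (fun z : ℂ => (Iio R).indicator (fun y : ℝ => y⁻¹) ‖z‖) (Metric.ball 0 R) :=
    h.integrableOn
  refine Integrable.mono' h2 (measurable_inv.aestronglyMeasurable) ?_
  filter_upwards [ae_restrict_mem Metric.isOpen_ball.measurableSet] with z hz
  have : ‖z‖ < R := by simpa using hz
  simp [this]

variable {φ : ℂ → ℂ}

/-- The Cauchy–Pompeiu formula for compactly supported functions. -/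
theorem integral_inv_mul_wirtingerBar (hφ : ContDiff ℝ 1 φ) (hc : HasCompactSupport φ) :
    ∫ z : ℂ, z⁻¹ * wirtingerBar 1 φ z = -Real.pi * φ 0 := by
  set e : ℝ → ℂ := fun θ => Complex.exp (θ * I) with he
  set P : ℝ × ℝ → ℂ := fun p => p.1 * e p.2 with hP
  have hPc : Continuous P := by fun_prop
  have hdc : Continuous (fderiv ℝ φ) := hφ.continuous_fderiv (by norm_num)
  -- In polar coordinates A is the radial derivative of φ and r B is the angular one.
  set A : ℝ × ℝ → ℂ := fun p => fderiv ℝ φ (P p) (e p.2) with hA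
  set B : ℝ × ℝ → ℂ := fun p => fderiv ℝ φ (P p) (I * e p.2) with hB
  have hAc : Continuous A := (hdc.comp hPc).clm_apply (by fun_prop)
  have hBc : Continuous B := (hdc.comp hPc).clm_apply (by fun_prop)
  have hne : ∀ θ, ‖e θ‖ = 1 := fun θ => by simp [he, Complex.norm_exp_ofReal_mul_I]
  obtain ⟨R, hR⟩ : ∃ R : ℝ, ∀ z : ℂ, R < ‖z‖ → fderiv ℝ φ z = 0 := by
    obtain ⟨R, hR⟩ := (hc.fderiv (𝕜 := ℝ)).isCompact.isBounded.subset_closedBall 0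
    refine ⟨R, fun z hz => by_contra fun h => ?_⟩
    have := hR (subset_tsupport _ h)
    simp at this
    linarith
  have hint {F : ℝ × ℝ → ℂ} (hF : Continuous F) (h0 : ∀ p : ℝ × ℝ, R < p.1 → F p = 0) :
      IntegrableOn F (Ioi 0 ×ˢ Ioo (-Real.pi) Real.pi) := by
    have h1 : IntegrableOn F (Icc 0 R ×ˢ Icc (-Real.pi) Real.pi) :=
      hF.continuousOn.integrableOn_compact (isCompact_Icc.prod isCompact_Icc)
    refine h1.of_forall_sdiff_eq_zero (measurableSet_Ioi.prod measurableSet_Ioo) ?_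
    rintro ⟨r, θ⟩ ⟨⟨hr, hθ⟩, hn⟩
    refine h0 _ (lt_of_not_ge fun hle => hn ⟨⟨(mem_Ioi.1 hr).le, hle⟩, Ioo_subset_Icc_self hθ⟩)
  have hPn : ∀ p : ℝ × ℝ, R < p.1 → R < ‖P p‖ := fun p hp => by
    rw [hP]; simp only [norm_mul, hne, mul_one, Complex.norm_real]
    exact hp.trans_le (le_abs_self _)
  have hAi := hint hAc (fun p hp => by simp [hA, hR _ (hPn p hp)])
  have hBi := hint hBc (fun p hp => by simp [hB, hR _ (hPn p hp)])
  have hdP1 (r θ : ℝ) : HasDerivAt (fun r : ℝ => P (r, θ)) (e θ) r := by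
    simpa [hP] using (Complex.ofRealCLM.hasDerivAt (x := r)).mul_const (e θ)
  have hdP2 (r θ : ℝ) : HasDerivAt (fun θ : ℝ => P (r, θ)) (r • (I * e θ)) θ := by
    have h1 : HasDerivAt (fun θ : ℝ => (θ : ℂ) * I) I θ := by
      simpa using (Complex.ofRealCLM.hasDerivAt (x := θ)).mul_const I
    refine (h1.cexp.const_mul (r : ℂ)).congr_deriv ?_
    simp only [he, real_smul]; ring
  have hφd (z : ℂ) : HasFDerivAt φ (fderiv ℝ φ z) z :=
    (hφ.differentiable (by norm_num) z).hasFDerivAt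
  have hIA : ∫ p in Ioi (0:ℝ) ×ˢ Ioo (-Real.pi) Real.pi, A p = -(2 * Real.pi) * φ 0 := by
    have hsw := setIntegral_prod_swap (μ := (volume : Measure ℝ)) (ν := (volume : Measure ℝ))
      (Ioi (0:ℝ)) (Ioo (-Real.pi) Real.pi) A
    have hAi' : IntegrableOn (fun z : ℝ × ℝ => A z.swap) (Ioo (-Real.pi) Real.pi ×ˢ Ioi (0:ℝ))
        (volume.prod volume) := hAi.swap
    rw [Measure.volume_eq_prod, ← hsw, setIntegral_prod _ hAi']
    have hin (θ : ℝ) : ∫ r in Ioi (0:ℝ), A (Prod.swap (θ, r)) = -φ 0 := by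
      have h1 : ContDiff ℝ 1 fun r : ℝ => φ (P (r, θ)) := by
        refine hφ.comp ?_
        simp only [hP]
        exact (Complex.ofRealCLM.contDiff).mul contDiff_const
      have h2 : HasCompactSupport fun r : ℝ => φ (P (r, θ)) := by
        obtain ⟨S, hS⟩ := hc.isCompact.isBounded.subset_closedBall 0
        refine HasCompactSupport.of_support_subset_isCompact (isCompact_closedBall (0 : ℝ) S) ?_
        intro r hr
        have := hS (subset_tsupport _ hr)
        simpa [hP, hne] using this
      have h3 := h2.integral_Ioi_deriv_eq h1 0
      have h4 : deriv (fun r : ℝ => φ (P (r, θ))) = fun r => A (r, θ) := by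
        ext r
        exact ((hφd _).comp_hasDerivAt r (hdP1 r θ)).deriv
      rw [h4] at h3
      simpa [hP] using h3
    simp only [hin]
    rw [setIntegral_const, Measure.real, Real.volume_Ioo, ENNReal.toReal_ofReal
      (by linarith [Real.pi_pos]), real_smul]
    push_cast; ring
  have hIB : ∫ p in Ioi (0:ℝ) ×ˢ Ioo (-Real.pi) Real.pi, B p = 0 := by
    rw [Measure.volume_eq_prod, setIntegral_prod _ hBi]
    refine setIntegral_eq_zero_of_forall_eq_zero fun r hr => ?_
    have hr0 : (r : ℝ) ≠ 0 := (mem_Ioi.1 hr).ne'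
    -- The angular derivative integrates to zero over a period.
    have h1 : ∫ θ in (-Real.pi)..Real.pi, r • B (r, θ) = 0 := by
      rw [intervalIntegral.integral_eq_sub_of_hasDerivAt (f := fun θ => φ (P (r, θ)))]
      · have : e Real.pi = e (-Real.pi) := by simp [he, Complex.exp_neg]
        simp [hP, this]
      · intro θ _
        refine ((hφd _).comp_hasDerivAt θ (hdP2 r θ)).congr_deriv ?_
        rw [map_smul]
      · exact (Continuous.intervalIntegrable (by fun_prop) _ _)
    rw [intervalIntegral.integral_smul, smul_eq_zero] at h1
    rw [← integral_Ioc_eq_integral_Ioo, ← intervalIntegral.integral_of_le (by linarith [Real.pi_pos])]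
    exact h1.resolve_left hr0
  rw [← Complex.integral_comp_polarCoord_symm, show polarCoord.target =
    Ioi (0 : ℝ) ×ˢ Ioo (-Real.pi) Real.pi from rfl]
  -- The Jacobian cancels the modulus of z⁻¹, and the phase of z⁻¹ turns ∂̄ into half of (radial + i
  -- · angular/r).
  have hcong : ∀ p ∈ Ioi (0:ℝ) ×ˢ Ioo (-Real.pi) Real.pi,
      p.1 • ((Complex.polarCoord.symm p)⁻¹ * wirtingerBar 1 φ (Complex.polarCoord.symm p)) =
        (1 / 2) * (A p + I * B p) := by
    rintro ⟨r, θ⟩ ⟨hr, -⟩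
    have hr0 : (r : ℂ) ≠ 0 := by exact_mod_cast (mem_Ioi.1 hr).ne'
    have hp : Complex.polarCoord.symm (r, θ) = P (r, θ) := by
      rw [Complex.polarCoord_symm_apply, hP, he]
      simp only [Complex.exp_mul_I, Complex.ofReal_cos, Complex.ofReal_sin]
    have hcs : e θ = ((Real.cos θ : ℝ) : ℂ) + ((Real.sin θ : ℝ) : ℂ) * I := by
      simp only [he, Complex.exp_mul_I, Complex.ofReal_cos, Complex.ofReal_sin]
    have h1 : e θ = Real.cos θ • (1 : ℂ) + Real.sin θ • I := by
      rw [hcs]; simp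
    have h2 : I * e θ = Real.cos θ • I - Real.sin θ • (1 : ℂ) := by
      rw [hcs]; simp; linear_combination (Complex.sin θ) * I_mul_I
    have he0 : e θ ≠ 0 := Complex.exp_ne_zero _
    have hinv : (e θ)⁻¹ = ((Real.cos θ : ℝ) : ℂ) - ((Real.sin θ : ℝ) : ℂ) * I := by
      have h3 : (e θ)⁻¹ = e (-θ) := by simp [he, Complex.exp_neg]
      rw [h3]
      simp only [he, Complex.exp_mul_I, Complex.ofReal_neg, Complex.cos_neg, Complex.sin_neg,
        Complex.ofReal_cos, Complex.ofReal_sin]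
      ring
    rw [hp]
    simp only [hA, hB, wirtingerBar, smul_eq_mul, mul_one]
    rw [h2, h1]
    simp only [map_add, map_sub, map_smul]
    simp only [hP, mul_inv, hinv, real_smul]
    field_simp
    linear_combination -(fderiv ℝ φ (r * e θ) I) * (Real.sin θ : ℂ) * I_mul_I
  rw [setIntegral_congr_fun (measurableSet_Ioi.prod measurableSet_Ioo) hcong,
    integral_const_mul, integral_add hAi (hBi.const_mul I), integral_const_mul, hIA, hIB]
  ring

end CauchyPompeiu

/-! ### The Dolbeault lemma on polydiscs. -/

section Dolbeault

open MeasureTheory Set Filter Topology Complex Convolution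

variable {n : ℕ}

/-- The open polydisc. -/
def polydisc (c : CSpace n) (r : ℝ) : Set (CSpace n) := {z | ∀ j, ‖z j - c j‖ < r}

lemma isOpen_polydisc (c : CSpace n) (r : ℝ) : IsOpen (polydisc c r) := by
  simp only [polydisc, ofPred_forall]
  exact isOpen_iInter_of_finite fun j => isOpen_lt (by fun_prop) continuous_const

lemma mem_polydisc_self (c : CSpace n) {r : ℝ} (hr : 0 < r) : c ∈ polydisc c r := by
  intro j; simpa

lemma polydisc_subset (c : CSpace n) {r s : ℝ} (h : r ≤ s) : polydisc c r ⊆ polydisc c s :=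
  fun _ hz j => (hz j).trans_le h

lemma exists_polydisc_subset {c : CSpace n} {U : Set (CSpace n)} (hU : U ∈ 𝓝 c) :
    ∃ r > 0, polydisc c r ⊆ U := by
  obtain ⟨ε, hε, h⟩ := Metric.mem_nhds_iff.1 hU
  refine ⟨ε / (n + 1), by positivity, fun z hz => h ?_⟩
  rw [Metric.mem_ball, EuclideanSpace.dist_eq]
  have hn : (0 : ℝ) < n + 1 := by positivity
  have h1 : ∑ j, dist (z j) (c j) ^ 2 ≤ n * (ε / (n + 1)) ^ 2 := by
    refine (Finset.sum_le_card_nsmul _ _ ((ε / (n + 1)) ^ 2) fun j _ => ?_).trans (by simp)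
    rw [dist_eq_norm]
    exact pow_le_pow_left₀ (norm_nonneg _) (hz j).le 2
  rw [Real.sqrt_lt' hε]
  refine h1.trans_lt ?_
  rw [div_pow, mul_div_assoc', div_lt_iff₀ (by positivity)]
  have : (0:ℝ) ≤ n := by positivity
  nlinarith [pow_pos hε 2, mul_nonneg this (pow_pos hε 2).le]

section wirtingerBar

variable {V : Type*} [NormedAddCommGroup V] [NormedSpace ℝ V] [NormedSpace ℂ V]
  {f g : V → ℂ} {p : V}

lemma wirtingerBar_congr (h : f =ᶠ[𝓝 p] g) (v : V) : wirtingerBar v f p = wirtingerBar v g p := by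
  simp only [wirtingerBar, h.fderiv_eq]

lemma wirtingerBar_add (hf : DifferentiableAt ℝ f p) (hg : DifferentiableAt ℝ g p) (v : V) :
    wirtingerBar v (fun z => f z + g z) p = wirtingerBar v f p + wirtingerBar v g p := by
  simp only [wirtingerBar, fderiv_fun_add hf hg, add_apply]; ring

lemma wirtingerBar_sub (hf : DifferentiableAt ℝ f p) (hg : DifferentiableAt ℝ g p) (v : V) :
    wirtingerBar v (fun z => f z - g z) p = wirtingerBar v f p - wirtingerBar v g p := by
  simp only [wirtingerBar, fderiv_fun_sub hf hg, sub_apply]; ring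

lemma wirtingerBar_mul (hf : DifferentiableAt ℝ f p) (hg : DifferentiableAt ℝ g p) (v : V) :
    wirtingerBar v (fun z => f z * g z) p = f p * wirtingerBar v g p + g p * wirtingerBar v f p := by
  simp only [wirtingerBar, fderiv_fun_mul hf hg, add_apply, smul_apply, smul_eq_mul]; ring

lemma ContDiffOn.wirtingerBar {U : Set V} (hU : IsOpen U) (hf : ContDiffOn ℝ ∞ f U) (v : V) :
    ContDiffOn ℝ ∞ (wirtingerBar v f) U := by
  have h := hf.fderiv_of_isOpen (m := ∞) hU (by simp)
  have h1 (w : V) : ContDiffOn ℝ ∞ (fun z => fderiv ℝ f z w) U := h.clm_apply contDiffOn_const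
  exact contDiffOn_const.mul ((h1 v).add (contDiffOn_const.mul (h1 _)))

lemma wirtingerBar_comm (hf : ContDiffAt ℝ 2 f p) (v w : V) :
    wirtingerBar v (wirtingerBar w f) p = wirtingerBar w (wirtingerBar v f) p := by
  have hD (v : V) : HasFDerivAt (wirtingerBar v f) _ p :=
    (((hf.hasFDerivAt_fderiv_apply v).fun_add
      ((hf.hasFDerivAt_fderiv_apply (I • v)).const_mul I)).const_mul (1 / 2 : ℂ))
  have hs (v w : V) : fderiv ℝ (fderiv ℝ f) p v w = fderiv ℝ (fderiv ℝ f) p w v :=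
    (hf.isSymmSndFDerivAt (by simp)) v w
  rw [wirtingerBar, wirtingerBar, (hD v).fderiv, (hD w).fderiv]
  simp only [smul_apply, add_apply, ContinuousLinearMap.flip_apply, smul_eq_mul]
  rw [hs w v, hs w (I • v), hs (I • w) v, hs (I • w) (I • v)]
  ring

end wirtingerBar

/-- Solution of the `∂̄`-equation in one variable, the other variables being parameters. -/
lemma exists_wirtingerBar_eq {c : CSpace n} {r : ℝ} (hr : 0 < r) (k : Fin n) {g : CSpace n → ℂ}
    (hg : ContDiffOn ℝ ∞ g (polydisc c r)) :
    ∃ G : CSpace n → ℂ, ContDiffOn ℝ ∞ G (polydisc c r) ∧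
      (∀ z ∈ polydisc c (r / 2), wirtingerBar (EuclideanSpace.single k 1) G z = g z) ∧
      ∀ l, l ≠ k → (∀ z ∈ polydisc c r, wirtingerBar (EuclideanSpace.single l 1) g z = 0) →
        ∀ z ∈ polydisc c r, wirtingerBar (EuclideanSpace.single l 1) G z = 0 := by
  set e : CSpace n := EuclideanSpace.single k 1 with he
  -- The cut-off acts on the variable z_k only: it is 1 on the disc where the equation is to be
  -- solved, and it lets g be extended by zero to all values of z_k.
  let χ : ContDiffBump (c k) := ⟨r / 2, 3 * r / 4, by linarith, by linarith⟩
  set H : CSpace n → ℂ := fun z => (χ (z k) : ℂ) * g z with hH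
  set S : Set (CSpace n) := {z | ∀ j, j ≠ k → ‖z j - c j‖ < r} with hS
  have hSo : IsOpen S := by
    simp only [hS, ofPred_forall]
    exact isOpen_iInter_of_finite fun j => isOpen_iInter_of_finite fun _ =>
      isOpen_lt (by fun_prop) continuous_const
  have hPS : ∀ z ∈ S, ‖z k - c k‖ < r → z ∈ polydisc c r := fun z hz h j => by
    rcases eq_or_ne j k with rfl | hj
    exacts [h, hz j hj]
  have hproj : ContDiff ℝ ∞ fun z : CSpace n => z k :=
    (PiLp.proj (𝕜 := ℝ) 2 (fun _ : Fin n => ℂ) k).contDiff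
  have hχ : ContDiff ℝ ∞ fun z : CSpace n => (χ (z k) : ℂ) :=
    Complex.ofRealCLM.contDiff.comp (χ.contDiff.comp hproj)
  have hH0 : ∀ z : CSpace n, 3 * r / 4 < ‖z k - c k‖ → H =ᶠ[𝓝 z] fun _ => 0 := fun z hz => by
    have ho : IsOpen {z : CSpace n | 3 * r / 4 < ‖z k - c k‖} :=
      isOpen_lt continuous_const (by fun_prop)
    filter_upwards [ho.mem_nhds hz] with w hw
    have : χ (w k) = 0 := χ.zero_of_le_dist (by rw [dist_eq_norm]; exact (le_of_lt hw))
    simp [hH, this]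
  have hHs : ContDiffOn ℝ ∞ H S := fun z hz => by
    refine ContDiffAt.contDiffWithinAt ?_
    rcases lt_or_ge ‖z k - c k‖ r with h | h
    · exact hχ.contDiffAt.mul (hg.contDiffAt ((isOpen_polydisc c r).mem_nhds (hPS z hz h)))
    · exact contDiffAt_const.congr_of_eventuallyEq (hH0 z (by linarith))
  set h : CSpace n → ℂ → ℂ := fun p x => H (p + x • e) with hh
  have hadd : ContDiff ℝ ∞ fun q : CSpace n × ℂ => q.1 + q.2 • e := by fun_prop
  have hcoord (p : CSpace n) (x : ℂ) (j : Fin n) (hj : j ≠ k) : (p + x • e) j = p j := by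
    simp [he, hj]
  have hcoordk (p : CSpace n) (x : ℂ) : (p + x • e) k = p k + x := by simp [he]
  have hmaps : ∀ p ∈ polydisc c r, ∀ x : ℂ, p + x • e ∈ S := fun p hp x j hj => by
    rw [hcoord p x j hj]; exact hp j
  have hhs : ContDiffOn ℝ ∞ ↿h (polydisc c r ×ˢ univ) :=
    hHs.comp hadd.contDiffOn fun q hq => hmaps q.1 hq.1 q.2
  -- If |x| > 2r and |p_k - c_k| < r, then p_k + x is at distance more than r from c_k, beyond the
  -- support of the cut-off; this gives a support bound uniform in p.
  have hfar : ∀ p ∈ polydisc c r, ∀ x : ℂ, x ∉ Metric.closedBall (0 : ℂ) (2 * r) →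
      3 * r / 4 < ‖(p + x • e) k - c k‖ := fun p hp x hx => by
    rw [hcoordk]
    have h1 : 2 * r < ‖x‖ := by simpa using hx
    have h2 := hp k
    have h3 : ‖x‖ ≤ ‖p k + x - c k‖ + ‖p k - c k‖ := by
      have := norm_sub_le (p k + x - c k) (p k - c k)
      rwa [show p k + x - c k - (p k - c k) = x by ring] at this
    linarith
  have hzero : ∀ p, ∀ x : ℂ, p ∈ polydisc c r → x ∉ Metric.closedBall (0 : ℂ) (2 * r) → h p x = 0 :=
    fun p x hp hx => (hH0 _ (hfar p hp x hx)).eq_of_nhds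
  -- The Cauchy kernel: G is the Cauchy transform of χg in the variable z_k, so differentiation in p
  -- falls on χg alone.
  set K : ℂ → ℂ := fun t => (Real.pi : ℂ)⁻¹ * t⁻¹ with hK
  have hKl : LocallyIntegrable K volume := fun x =>
    (locallyIntegrable_inv_complex x).imp fun s hs => ⟨hs.1, hs.2.const_mul _⟩
  set Lm := ContinuousLinearMap.mul ℝ ℂ with hLm
  set G : CSpace n → ℂ := fun p => (K ⋆[Lm, volume] h p) 0 with hG
  have hGs : ContDiffOn ℝ ∞ G (polydisc c r) :=
    contDiffOn_convolution_right_with_param_comp (n := ⊤) Lm contDiffOn_const (isOpen_polydisc c r)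
      (isCompact_closedBall (0 : ℂ) (2 * r)) hzero hKl hhs
  have hHd : ∀ z ∈ S, DifferentiableAt ℝ H z := fun z hz =>
    (hHs.contDiffAt (hSo.mem_nhds hz)).differentiableAt (by simp)
  have hHdc : ContinuousOn (fderiv ℝ H) S := hHs.continuousOn_fderiv_of_isOpen hSo (by simp)
  have hdv (p : CSpace n) (hp : p ∈ polydisc c r) (v : CSpace n) :
      Integrable (fun t => K t * fderiv ℝ H (p - t • e) v) volume ∧
      fderiv ℝ G p v = ∫ t, K t * fderiv ℝ H (p - t • e) v := by
    have h1 := hasFDerivAt_convolution_right_with_param (μ := volume) Lm (isOpen_polydisc c r)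
      (isCompact_closedBall (0 : ℂ) (2 * r)) hzero hKl (hhs.of_le (by simp)) (p, 0) hp
    have h2 : HasFDerivAt G _ p :=
      HasFDerivAt.comp (g := fun q : CSpace n × ℂ => (K ⋆[Lm, volume] h q.1) q.2)
        (f := fun x : CSpace n => (x, (0 : ℂ))) p h1
        ((hasFDerivAt_id p).prodMk (hasFDerivAt_const (0 : ℂ) p))
    have hdh (x : ℂ) : fderiv ℝ ↿h (p, x) = (fderiv ℝ H (p + x • e)).comp
        (ContinuousLinearMap.fst ℝ (CSpace n) ℂ +
          (ContinuousLinearMap.snd ℝ (CSpace n) ℂ).smulRight e) := by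
      have h5 : HasFDerivAt (fun q : CSpace n × ℂ => q.1 + q.2 • e)
          (ContinuousLinearMap.fst ℝ (CSpace n) ℂ +
            (ContinuousLinearMap.snd ℝ (CSpace n) ℂ).smulRight e) (p, x) :=
        hasFDerivAt_fst.fun_add (hasFDerivAt_snd.smul_const e)
      exact (HasFDerivAt.comp (g := H) (p, x) (hHd _ (hmaps p hp x)).hasFDerivAt h5).fderiv
    have hc1 : Continuous fun x : ℂ => fderiv ℝ H (p + x • e) :=
      hHdc.comp_continuous (by fun_prop) (hmaps p hp)
    have hcs : ∀ x ∉ Metric.closedBall (0 : ℂ) (2 * r), fderiv ℝ H (p + x • e) = 0 := fun x hx => by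
      rw [(hH0 _ (hfar p hp x hx)).fderiv_eq]; simp
    have h3 := convolution_precompR_apply (μ := volume) Lm hKl
      (g := fun x => fderiv ℝ ↿h (p, x))
      (HasCompactSupport.intro (isCompact_closedBall (0 : ℂ) (2 * r)) fun x hx => by
        rw [hdh, hcs x hx]; simp)
      (by simp only [hdh]; exact hc1.clm_comp continuous_const) 0 (v, 0)
    have h4 : fderiv ℝ G p v = (K ⋆[Lm.precompR (CSpace n × ℂ), volume]
        fun x => fderiv ℝ ↿h (p, x)) 0 (v, 0) := by
      rw [h2.fderiv]; rfl
    refine ⟨?_, ?_⟩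
    · have := HasCompactSupport.convolutionExists_right (μ := volume) (f := K) Lm
        (g := fun x : ℂ => fderiv ℝ H (p + x • e) v)
        (HasCompactSupport.intro (isCompact_closedBall (0 : ℂ) (2 * r)) fun x hx => by
          rw [hcs x hx]; simp) hKl (hc1.clm_apply continuous_const) 0
      simpa [ConvolutionExistsAt, sub_eq_add_neg, hLm] using this
    · rw [h4, h3, convolution_def]
      simp [hdh, sub_eq_add_neg, hLm]
  have hwb (p : CSpace n) (hp : p ∈ polydisc c r) (v : CSpace n) :
      wirtingerBar v G p = ∫ t, K t * wirtingerBar v H (p - t • e) := by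
    obtain ⟨i1, e1⟩ := hdv p hp v
    obtain ⟨i2, e2⟩ := hdv p hp (I • v)
    rw [wirtingerBar, e1, e2, ← integral_const_mul, ← integral_add i1 (i2.const_mul I),
      ← integral_const_mul]
    congr 1
    ext t
    rw [wirtingerBar]; ring
  have hsubS (p : CSpace n) (hp : p ∈ polydisc c r) (t : ℂ) : p - t • e ∈ S := by
    have := hmaps p hp (-t)
    rwa [neg_smul, ← sub_eq_add_neg] at this
  refine ⟨G, hGs, fun p hp => ?_, fun l hl hgl p hp => ?_⟩
  · have hp' := polydisc_subset c (by linarith : r / 2 ≤ r) hp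
    rw [hwb p hp']
    set φ : ℂ → ℂ := fun t => H (p - t • e) with hφ
    have hφs : ContDiff ℝ 1 φ := by
      rw [← contDiffOn_univ]
      exact (hHs.of_le (by simp)).comp (t := S)
        (by fun_prop : ContDiff ℝ 1 fun t : ℂ => p - t • e).contDiffOn fun t _ => hsubS p hp' t
    have hφc : HasCompactSupport φ :=
      HasCompactSupport.intro (isCompact_closedBall (0 : ℂ) (2 * r)) fun x hx => by
        have := hzero p (-x) hp' (by simpa using hx)
        simpa [hh, hφ, sub_eq_add_neg] using this
    -- The sign from p - te matches the minus sign in the Cauchy–Pompeiu formula.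
    have hwφ (t : ℂ) : wirtingerBar 1 φ t = -wirtingerBar e H (p - t • e) := by
      have h7 := ((hHd _ (hsubS p hp' t)).hasFDerivAt.comp t
        (((hasFDerivAt_id (𝕜 := ℝ) t).smul_const e).const_sub p)).fderiv
      have h8 (v : ℂ) : fderiv ℝ φ t v = -fderiv ℝ H (p - t • e) (v • e) := by
        rw [← map_neg]
        exact (DFunLike.congr_fun h7 v).trans (by simp)
      rw [wirtingerBar, wirtingerBar, h8, h8]
      simp only [one_smul, smul_eq_mul, mul_one]
      ring
    have h5 := integral_inv_mul_wirtingerBar hφs hφc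
    simp only [hwφ, mul_neg, integral_neg] at h5
    simp only [hK, mul_assoc, integral_const_mul]
    have h6 : φ 0 = g p := by
      have : χ (p k) = 1 := χ.one_of_mem_closedBall (by
        rw [Metric.mem_closedBall, dist_eq_norm]; exact (hp k).le)
      simp [hφ, hH, this]
    rw [h6] at h5
    have hpi : (Real.pi : ℂ) ≠ 0 := by exact_mod_cast Real.pi_ne_zero
    rw [inv_mul_eq_iff_eq_mul₀ hpi]
    linear_combination -h5
  -- The cut-off does not depend on z_l, so ∂̄_l of the integrand vanishes with ∂̄_l g.
  · rw [hwb p hp]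
    refine integral_eq_zero_of_ae (Eventually.of_forall fun t => ?_)
    have hz := hsubS p hp t
    simp only [Pi.zero_apply, mul_eq_zero]
    right
    rcases lt_or_ge ‖(p - t • e) k - c k‖ r with h | h
    · have hzP := hPS _ hz h
      have hχl : wirtingerBar (EuclideanSpace.single l 1) (fun z : CSpace n => (χ (z k) : ℂ))
          (p - t • e) = 0 := by
        have h9 := (((Complex.ofRealCLM.contDiff.comp χ.contDiff : ContDiff ℝ ∞ fun w : ℂ =>
          (χ w : ℂ)).differentiable (by simp) _).hasFDerivAt.comp (p - t • e)
          (PiLp.proj (𝕜 := ℝ) 2 (fun _ : Fin n => ℂ) k).hasFDerivAt).fderiv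
        have h10 (v : CSpace n) (hv : v k = 0) :
            fderiv ℝ (fun z : CSpace n => (χ (z k) : ℂ)) (p - t • e) v = 0 := by
          refine (DFunLike.congr_fun h9 v).trans ?_
          simp [hv]
        rw [wirtingerBar, h10 _ (by simp [hl.symm]), h10 _ (by simp [hl.symm])]
        simp
      rw [hH, wirtingerBar_mul (hχ.differentiable (by simp) _)
        ((hg.contDiffAt ((isOpen_polydisc c r).mem_nhds hzP)).differentiableAt (by simp)),
        hgl _ hzP, hχl]
      simp
    · rw [wirtingerBar_congr (hH0 _ (by linarith))]
      simp [wirtingerBar]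

/-- The Dolbeault lemma for `(0,1)`-forms. -/
theorem exists_wirtingerBar_eq_of_closed (c : CSpace n) (k : ℕ) (hk : k ≤ n) {r : ℝ} (hr : 0 < r)
    (g : Fin n → CSpace n → ℂ) (hg : ∀ j, ContDiffOn ℝ ∞ (g j) (polydisc c r))
    (hcl : ∀ j l, ∀ z ∈ polydisc c r, wirtingerBar (EuclideanSpace.single l 1) (g j) z =
      wirtingerBar (EuclideanSpace.single j 1) (g l) z)
    (h0 : ∀ j : Fin n, k ≤ j → ∀ z ∈ polydisc c r, g j z = 0) :
    ∃ s > 0, ∃ f : CSpace n → ℂ, ContDiffOn ℝ ∞ f (polydisc c s) ∧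
      ∀ j, ∀ z ∈ polydisc c s, wirtingerBar (EuclideanSpace.single j 1) f z = g j z := by
  -- The index k bounds which dz̄_j may occur. Subtracting ∂̄G, where ∂̄_k G = g_k, removes the last
  -- component. Closedness makes g_k, hence G, holomorphic in the later variables, so the components
  -- after it remain zero.
  induction k generalizing r g with
  | zero =>
    refine ⟨r, hr, fun _ => 0, contDiffOn_const, fun j z hz => ?_⟩
    rw [h0 j (by simp) z hz]
    simp [wirtingerBar]
  | succ k ih =>
    obtain ⟨G, hGs, hG1, hG2⟩ := exists_wirtingerBar_eq hr ⟨k, hk⟩ (hg ⟨k, hk⟩)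
    have hr2 : r / 2 ≤ r := by linarith
    have hsub := polydisc_subset c hr2
    have hd {f : CSpace n → ℂ} (hf : ContDiffOn ℝ ∞ f (polydisc c r)) {z : CSpace n}
        (hz : z ∈ polydisc c (r / 2)) : ContDiffAt ℝ ∞ f z :=
      hf.contDiffAt ((isOpen_polydisc c r).mem_nhds (hsub hz))
    have hGw (j : Fin n) := hGs.wirtingerBar (isOpen_polydisc c r) (EuclideanSpace.single j 1)
    obtain ⟨s, hs, f, hf, hfg⟩ := ih (by omega) (half_pos hr)
      (fun j z => g j z - wirtingerBar (EuclideanSpace.single j 1) G z)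
      (fun j => ((hg j).sub (hGw j)).mono hsub)
      (fun j l z hz => by
        rw [wirtingerBar_sub ((hd (hg j) hz).differentiableAt (by simp))
            ((hd (hGw j) hz).differentiableAt (by simp)),
          wirtingerBar_sub ((hd (hg l) hz).differentiableAt (by simp))
            ((hd (hGw l) hz).differentiableAt (by simp)), hcl j l z (hsub hz),
          wirtingerBar_comm ((hd hGs hz).of_le (by norm_cast))])
      (fun j hj z hz => by
        rcases hj.eq_or_lt with h | h
        · have : j = ⟨k, hk⟩ := Fin.ext h.symm
          rw [this, hG1 z hz, sub_self]
        · have hne : j ≠ ⟨k, hk⟩ := fun h' => by simp [h'] at h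
          rw [h0 j h z (hsub hz), hG2 j hne (fun w hw => ?_) z (hsub hz), sub_zero]
          rw [hcl ⟨k, hk⟩ j w hw]
          have : g j =ᶠ[𝓝 w] fun _ => 0 := by
            filter_upwards [(isOpen_polydisc c r).mem_nhds hw] with y hy using h0 j h y hy
          rw [wirtingerBar_congr this]
          simp [wirtingerBar])
    refine ⟨min s (r / 2), lt_min hs (half_pos hr), fun z => f z + G z,
      (hf.mono (polydisc_subset c (min_le_left _ _))).add
        (hGs.mono ((polydisc_subset c (min_le_right _ _)).trans hsub)), fun j z hz => ?_⟩
    have hz1 := polydisc_subset c (min_le_left _ _) hz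
    have hz2 := polydisc_subset c (min_le_right _ _) hz
    rw [wirtingerBar_add ((hf.contDiffAt ((isOpen_polydisc c s).mem_nhds hz1)).differentiableAt
      (by simp)) ((hd hGs hz2).differentiableAt (by simp)), hfg j z hz1]
    ring

end Dolbeault

/-! ### The Poincaré lemma for 2-forms. -/

section Poincare

open MeasureTheory Set Filter Topology Convolution

variable {V : Type*} [NormedAddCommGroup V] [NormedSpace ℝ V]

/-- Smoothness of parametric integrals and differentiation under the integral sign. -/
lemma contDiffOn_intervalIntegral_param {s : Set V} (hs : IsOpen s) {f : V × ℝ → ℝ}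
    (hf : ContDiffOn ℝ ∞ f (s ×ˢ Ioo (-1) 2)) :
    ContDiffOn ℝ ∞ (fun x => ∫ t in (0 : ℝ)..1, f (x, t)) s ∧ ∀ x ∈ s, ∀ v,
      fderiv ℝ (fun x => ∫ t in (0 : ℝ)..1, f (x, t)) x v =
        ∫ t in (0 : ℝ)..1, fderiv ℝ f (x, t) (v, 0) := by
  have hso : IsOpen (s ×ˢ Ioo (-1 : ℝ) 2) := hs.prod isOpen_Ioo
  -- Equal to 1 near [0, 1] and supported in [-1/2, 3/2], inside (-1, 2). The cut-off turns the
  -- integral into a convolution with compactly supported second factor, which depends smoothly on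
  -- parameters.
  let χ : ContDiffBump (1 / 2 : ℝ) := ⟨3 / 4, 1, by norm_num, by norm_num⟩
  set g : V → ℝ → ℝ := fun x t => χ t * f (x, t) with hg
  have hg0 : ∀ x, ∀ t ∉ Metric.closedBall (1 / 2 : ℝ) 1, g x t = 0 := fun x t ht => by
    have : χ t = 0 := χ.zero_of_le_dist (le_of_lt (by simpa using ht))
    simp [hg, this]
  have hgs : ContDiffOn ℝ ∞ ↿g (s ×ˢ univ) := by
    rintro ⟨x, t⟩ ⟨hx, -⟩
    refine ContDiffAt.contDiffWithinAt ?_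
    by_cases ht : t ∈ Ioo (-1 : ℝ) 2
    · exact (χ.contDiffAt.comp (x, t) contDiffAt_snd).mul (hf.contDiffAt (hso.mem_nhds ⟨hx, ht⟩))
    · have ht' : t ∉ Metric.closedBall (1 / 2 : ℝ) 1 := by
        rw [Real.closedBall_eq_Icc]
        intro h
        exact ht ⟨by linarith [h.1], by linarith [h.2]⟩
      have hev : ↿g =ᶠ[𝓝 (x, t)] fun _ => 0 := by
        filter_upwards [(Metric.isClosed_closedBall.isOpen_compl.preimage
          (continuous_snd (X := V))).mem_nhds ht'] with q hq
        exact hg0 q.1 q.2 hq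
      exact contDiffAt_const.congr_of_eventuallyEq hev
  have hgf : ∀ x t, t ∈ Icc (0 : ℝ) 1 → ↿g =ᶠ[𝓝 (x, t)] f := fun x t ht => by
    have ho : t ∈ Metric.ball (1 / 2 : ℝ) (3 / 4) := by
      rw [Real.ball_eq_Ioo]; constructor <;> linarith [ht.1, ht.2]
    filter_upwards [(Metric.isOpen_ball.preimage (continuous_snd (X := V))).mem_nhds ho] with q hq
    have : χ q.2 = 1 := χ.one_of_mem_closedBall (Metric.ball_subset_closedBall hq)
    simp [hg, this, Function.HasUncurry.uncurry]
  -- The reflected interval, since a convolution at 0 evaluates the second factor at -t.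
  set K : ℝ → ℝ := (Ioc (-1 : ℝ) 0).indicator fun _ => 1 with hK
  have hKl : LocallyIntegrable K volume :=
    ((integrable_indicator_iff measurableSet_Ioc).2 (by simp)).locallyIntegrable
  set Lm := ContinuousLinearMap.mul ℝ ℝ with hLm
  have hconv (F : ℝ → ℝ) : (K ⋆[Lm, volume] F) 0 = ∫ t in (0 : ℝ)..1, F t := by
    have h1 : ∀ t, Lm (K t) (F (0 - t)) = (Ioc (-1 : ℝ) 0).indicator (fun t => F (-t)) t := by
      intro t
      by_cases ht : t ∈ Ioc (-1 : ℝ) 0 <;> simp [hK, hLm, ht]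
    rw [convolution_def]
    simp only [h1]
    rw [integral_indicator measurableSet_Ioc,
      ← intervalIntegral.integral_of_le (by norm_num : (-1 : ℝ) ≤ 0),
      intervalIntegral.integral_comp_neg (fun t => F t)]
    simp
  have hfun : ∀ x, ∫ t in (0 : ℝ)..1, f (x, t) = (K ⋆[Lm, volume] g x) 0 := fun x => by
    rw [hconv]
    refine intervalIntegral.integral_congr fun t ht => ?_
    rw [uIcc_of_le zero_le_one] at ht
    exact (hgf x t ht).eq_of_nhds.symm
  have hk : IsCompact (Metric.closedBall (1 / 2 : ℝ) 1) := isCompact_closedBall _ _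
  simp only [hfun]
  refine ⟨contDiffOn_convolution_right_with_param_comp (n := ⊤) Lm contDiffOn_const hs hk
    (fun p x _ hx => hg0 p x hx) hKl hgs, fun x hx v => ?_⟩
  have h1 := hasFDerivAt_convolution_right_with_param (μ := volume) Lm hs hk
    (fun p x _ hx => hg0 p x hx) hKl (hgs.of_le (by simp)) (x, 0) hx
  have h2 : HasFDerivAt (fun x => (K ⋆[Lm, volume] g x) 0) _ x :=
    HasFDerivAt.comp (g := fun q : V × ℝ => (K ⋆[Lm, volume] g q.1) q.2)
      (f := fun x : V => (x, (0 : ℝ))) x h1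
      ((hasFDerivAt_id x).prodMk (hasFDerivAt_const (0 : ℝ) x))
  have hcont : Continuous fun t => fderiv ℝ ↿g (x, t) :=
    (hgs.continuousOn_fderiv_of_isOpen (hs.prod isOpen_univ) (by simp)).comp_continuous
      (by fun_prop) fun t => ⟨hx, mem_univ _⟩
  have h3 := convolution_precompR_apply (μ := volume) Lm hKl (g := fun t => fderiv ℝ ↿g (x, t))
    (HasCompactSupport.intro hk fun t ht => by
      have hev : ↿g =ᶠ[𝓝 (x, t)] fun _ => 0 := by
        filter_upwards [(Metric.isClosed_closedBall.isOpen_compl.preimage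
          (continuous_snd (X := V))).mem_nhds ht] with q hq
        exact hg0 q.1 q.2 hq
      rw [hev.fderiv_eq]; simp) hcont 0 (v, 0)
  have h4 : fderiv ℝ (fun x => (K ⋆[Lm, volume] g x) 0) x v =
      (K ⋆[Lm.precompR (V × ℝ), volume] fun t => fderiv ℝ ↿g (x, t)) 0 (v, 0) := by
    rw [h2.fderiv]; rfl
  rw [h4, h3, hconv]
  refine intervalIntegral.integral_congr fun t ht => ?_
  rw [uIcc_of_le zero_le_one] at ht
  simp only [(hgf x t ht).fderiv_eq]

lemma hasDerivAt_comp_apply_apply {B : V → V →L[ℝ] V →L[ℝ] ℝ} {B' : V →L[ℝ] V →L[ℝ] V →L[ℝ] ℝ}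
    {γ : ℝ → V} {γ' : V} {t : ℝ} (hB : HasFDerivAt B B' (γ t)) (hγ : HasDerivAt γ γ' t) (v w : V) :
    HasDerivAt (fun t => B (γ t) v w) (B' γ' v w) t := by
  have h1 := (hB.clm_apply (hasFDerivAt_const v (γ t))).clm_apply (hasFDerivAt_const w (γ t))
  exact (h1.comp_hasDerivAt t hγ).congr_deriv (by simp)

/-- The Poincaré lemma for closed 2-forms on a ball. -/
theorem exists_primitive_of_closed_two_form {c : V} {r : ℝ} (hr : 0 < r)
    {B : V → V →L[ℝ] V →L[ℝ] ℝ} (hB : ContDiffOn ℝ ∞ B (Metric.ball c (2 * r)))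
    (halt : ∀ x v w, B x v w = -B x w v)
    (hcl : ∀ x ∈ Metric.ball c (2 * r), ∀ u v w, fderiv ℝ B x u v w - fderiv ℝ B x v u w +
      fderiv ℝ B x w u v = 0) :
    ∃ η : V → V → ℝ, (∀ w, ContDiffOn ℝ ∞ (η w) (Metric.ball c r)) ∧
      ∀ x ∈ Metric.ball c r, ∀ v w, fderiv ℝ (η w) x v - fderiv ℝ (η v) x w = B x v w := by
  -- The integrand of the radial homotopy formula. As t runs over (-1, 2), the point c + t(x - c)
  -- stays in the ball of doubled radius.
  set f : V → V × ℝ → ℝ := fun w q => q.2 * B (c + q.2 • (q.1 - c)) (q.1 - c) w with hf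
  have hmaps : ∀ q ∈ Metric.ball c r ×ˢ Ioo (-1 : ℝ) 2, c + q.2 • (q.1 - c) ∈
      Metric.ball c (2 * r) := by
    rintro ⟨x, t⟩ ⟨hx, ht⟩
    simp only [Metric.mem_ball, dist_eq_norm, add_sub_cancel_left, norm_smul] at hx ⊢
    have : |t| < 2 := abs_lt.2 ⟨by linarith [ht.1], ht.2⟩
    rw [Real.norm_eq_abs]
    nlinarith [norm_nonneg (x - c), abs_nonneg t]
  have hy : ContDiff ℝ ∞ fun q : V × ℝ => c + q.2 • (q.1 - c) := by fun_prop
  have hfs (w : V) : ContDiffOn ℝ ∞ (f w) (Metric.ball c r ×ˢ Ioo (-1 : ℝ) 2) := by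
    have h1 := hB.comp hy.contDiffOn hmaps
    exact contDiffOn_snd.mul ((h1.clm_apply (contDiffOn_fst.sub contDiffOn_const)).clm_apply
      contDiffOn_const)
  have H (w : V) := contDiffOn_intervalIntegral_param Metric.isOpen_ball (hfs w)
  refine ⟨fun w x => ∫ t in (0 : ℝ)..1, f w (x, t), fun w => (H w).1, fun x hx v w => ?_⟩
  rw [(H w).2 x hx v, (H v).2 x hx w]
  have hIcc : ∀ t ∈ uIcc (0 : ℝ) 1, t ∈ Ioo (-1 : ℝ) 2 := fun t ht => by
    rw [uIcc_of_le zero_le_one] at ht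
    exact ⟨by linarith [ht.1], by linarith [ht.2]⟩
  have hBd (t : ℝ) (ht : t ∈ uIcc (0 : ℝ) 1) :
      HasFDerivAt B (fderiv ℝ B (c + t • (x - c))) (c + t • (x - c)) :=
    ((hB.contDiffAt (Metric.isOpen_ball.mem_nhds (hmaps (x, t) ⟨hx, hIcc t ht⟩))).differentiableAt
      (by simp)).hasFDerivAt
  have hd (t : ℝ) (ht : t ∈ uIcc (0 : ℝ) 1) (v w : V) : fderiv ℝ (f w) (x, t) (v, 0) =
      t * (t * fderiv ℝ B (c + t • (x - c)) v (x - c) w + B (c + t • (x - c)) v w) := by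
    have hsl : HasFDerivAt (fun x' => f w (x', t))
        ((fderiv ℝ (f w) (x, t)).comp (ContinuousLinearMap.inl ℝ V ℝ)) x := by
      refine HasFDerivAt.comp (g := f w) (f := fun x' => (x', t)) x ?_
        (hasFDerivAt_prodMk_left x t)
      exact (((hfs w).contDiffAt ((Metric.isOpen_ball.prod isOpen_Ioo).mem_nhds
        ⟨hx, hIcc t ht⟩)).differentiableAt (by simp)).hasFDerivAt
    have h1 : HasFDerivAt (fun x' : V => x' - c) (ContinuousLinearMap.id ℝ V) x :=
      (hasFDerivAt_id x).sub_const c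
    have h2 : HasFDerivAt (fun x' => c + t • (x' - c)) (t • ContinuousLinearMap.id ℝ V) x :=
      (h1.const_smul t).const_add c
    have h3 := ((((hBd t ht).comp x h2).clm_apply h1).clm_apply
      (hasFDerivAt_const w x)).const_mul t
    have h4 := DFunLike.congr_fun (hsl.unique h3) v
    simp at h4
    rw [h4, map_sub, sub_apply]
    ring
  have hcont (v w : V) : ContinuousOn (fun t : ℝ => fderiv ℝ (f w) (x, t) (v, 0)) (uIcc 0 1) := by
    refine ContinuousOn.clm_apply ?_ continuousOn_const
    exact ((hfs w).continuousOn_fderiv_of_isOpen (Metric.isOpen_ball.prod isOpen_Ioo)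
      (by simp)).comp (by fun_prop) fun t ht => ⟨hx, hIcc t ht⟩
  rw [← intervalIntegral.integral_sub (hcont v w).intervalIntegrable
    (hcont w v).intervalIntegrable]
  -- Closedness exchanges the antisymmetrised derivatives in v, w for the derivative in the
  -- direction x - c, so the integrand of dη is the t-derivative of t²B(v, w), whose increment over
  -- [0, 1] is B at x.
  have key : ∀ t ∈ uIcc (0 : ℝ) 1, HasDerivAt (fun t : ℝ => t ^ 2 * B (c + t • (x - c)) v w)
      (fderiv ℝ (f w) (x, t) (v, 0) - fderiv ℝ (f v) (x, t) (w, 0)) t := fun t ht => by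
    have h1 : HasDerivAt (fun t : ℝ => c + t • (x - c)) (x - c) t := by
      simpa using ((hasDerivAt_id t).smul_const (x - c)).const_add c
    refine ((hasDerivAt_pow 2 t).fun_mul (hasDerivAt_comp_apply_apply (hBd t ht) h1 v w)).congr_deriv ?_
    rw [hd t ht, hd t ht]
    have h4 := hcl _ (hmaps (x, t) ⟨hx, hIcc t ht⟩) (x - c) v w
    have h5 := halt (c + t • (x - c)) v w
    simp only at h4
    push_cast
    linear_combination t ^ 2 * h4 + t * h5
  rw [intervalIntegral.integral_eq_sub_of_hasDerivAt key
    ((hcont v w).sub (hcont w v)).intervalIntegrable]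
  simp

end Poincare

/-! ### Hermitian forms in a complex vector space. -/

section HermitianForm

open Complex

variable {V : Type*} [AddCommGroup V] [Module ℂ V]

/-- Hermitian sesquilinear forms, linear in the first variable. -/
structure IsHermitianForm (T : V → V → ℂ) : Prop where
  add_left : ∀ v v' w, T (v + v') w = T v w + T v' w
  smul_left : ∀ (c : ℂ) v w, T (c • v) w = c * T v w
  conj : ∀ v w, (starRingEnd ℂ) (T v w) = T w v

namespace IsHermitianForm

variable {T : V → V → ℂ} (hT : IsHermitianForm T)
include hT

lemma add_right (v w w' : V) : T v (w + w') = T v w + T v w' := by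
  rw [← hT.conj, hT.add_left, map_add, hT.conj, hT.conj]

lemma smul_right (c : ℂ) (v w : V) : T v (c • w) = (starRingEnd ℂ) c * T v w := by
  rw [← hT.conj, hT.smul_left, map_mul, hT.conj]

lemma zero_left (w : V) : T 0 w = 0 := by
  simpa using hT.smul_left 0 0 w

lemma sum_smul_left {ι : Type*} (s : Finset ι) (a : ι → ℂ) (b : ι → V) (w : V) :
    T (∑ i ∈ s, a i • b i) w = ∑ i ∈ s, a i * T (b i) w := by
  classical
  induction s using Finset.induction_on with
  | empty => simp [hT.zero_left]
  | insert i s hi ih => rw [Finset.sum_insert hi, Finset.sum_insert hi, hT.add_left,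
      hT.smul_left, ih]

lemma sum_smul_right {ι : Type*} (s : Finset ι) (a : ι → ℂ) (b : ι → V) (v : V) :
    T v (∑ i ∈ s, a i • b i) = ∑ i ∈ s, (starRingEnd ℂ) (a i) * T v (b i) := by
  rw [← hT.conj, hT.sum_smul_left, map_sum]
  simp only [map_mul, hT.conj]

lemma re_self (v : V) : ((T v v).re : ℂ) = T v v :=
  conj_eq_iff_re.1 (hT.conj v v)

lemma add {T' : V → V → ℂ} (hT' : IsHermitianForm T') :
    IsHermitianForm fun v w => T v w + T' v w where
  add_left v v' w := by rw [hT.add_left, hT'.add_left]; ring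
  smul_left c v w := by rw [hT.smul_left, hT'.smul_left]; ring
  conj v w := by rw [map_add, hT.conj, hT'.conj]

lemma comp {W : Type*} [AddCommGroup W] [Module ℂ W] (L : W →ₗ[ℂ] V) :
    IsHermitianForm fun v w => T (L v) (L w) where
  add_left v v' w := by rw [map_add, hT.add_left]
  smul_left c v w := by rw [map_smul, hT.smul_left]
  conj v w := hT.conj _ _

end IsHermitianForm

lemma sum_smul_single {k : ℕ} (v : CSpace k) :
    ∑ j, v j • (EuclideanSpace.single j 1 : CSpace k) = v := by
  ext i
  simp [Finset.sum_apply, Pi.single_apply]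

lemma IsHermitianForm.ext_single {k : ℕ} {T T' : CSpace k → CSpace k → ℂ}
    (hT : IsHermitianForm T) (hT' : IsHermitianForm T')
    (h : ∀ i j, T (EuclideanSpace.single i 1) (EuclideanSpace.single j 1) =
      T' (EuclideanSpace.single i 1) (EuclideanSpace.single j 1)) (v w : CSpace k) :
    T v w = T' v w := by
  rw [← sum_smul_single v, ← sum_smul_single w, hT.sum_smul_left, hT'.sum_smul_left]
  simp only [hT.sum_smul_right, hT'.sum_smul_right, h]

lemma isHermitianForm_complexHessian {V : Type*} [NormedAddCommGroup V] [NormedSpace ℝ V]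
    [NormedSpace ℂ V] [IsScalarTower ℝ ℂ V] {φ : V → ℝ} {p : V} (h : ContDiffAt ℝ 2 φ p) :
    IsHermitianForm (complexHessian φ p) :=
  ⟨complexHessian_add_left h, complexHessian_smul_left h, complexHessian_conj h⟩

end HermitianForm

/-! ### Local potentials of closed (1,1)-forms. -/

section LocalPotential

open Complex Filter Topology

variable {n : ℕ}

/-- Currying of alternating 2-forms. -/
def curryTwoForm (n : ℕ) :
    (CSpace n [⋀^Fin 2]→L[ℝ] ℝ) →L[ℝ] CSpace n →L[ℝ] CSpace n →L[ℝ] ℝ :=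
  (ContinuousLinearMap.compL ℝ (CSpace n) (CSpace n [×1]→L[ℝ] ℝ) (CSpace n →L[ℝ] ℝ)
      (continuousMultilinearCurryFin1 ℝ (CSpace n) ℝ).toContinuousLinearEquiv.toContinuousLinearMap)
    ∘L (continuousMultilinearCurryLeftEquiv ℝ (fun _ : Fin 2 => CSpace n)
        ℝ).toContinuousLinearEquiv.toContinuousLinearMap
    ∘L ContinuousAlternatingMap.toContinuousMultilinearMapCLM ℝ

lemma curryTwoForm_apply (A : CSpace n [⋀^Fin 2]→L[ℝ] ℝ) (v w : CSpace n) :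
    curryTwoForm n A v w = A ![v, w] := by
  simp [curryTwoForm]

lemma contDiff_curryTwoForm (n : ℕ) : ContDiff ℝ ∞ (fun A => curryTwoForm n A) := by
  apply ContinuousLinearMap.contDiff (E := CSpace n [⋀^Fin 2]→L[ℝ] ℝ)
    (F := CSpace n →L[ℝ] CSpace n →L[ℝ] ℝ)

lemma alternating_swap (A : CSpace n [⋀^Fin 2]→L[ℝ] ℝ) (v w : CSpace n) :
    A ![v, w] = -A ![w, v] := by
  have := A.map_swap ![w, v] (i := 0) (j := 1) (by decide)
  refine Eq.trans ?_ this
  change A _ = A _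
  congr 1
  ext i
  fin_cases i <;> rfl

/-- The Hermitian form of an alternating real 2-form. -/
def hermitianOfForm (A : CSpace n [⋀^Fin 2]→L[ℝ] ℝ) (v w : CSpace n) : ℂ :=
  (1 / 2) * ((A ![v, I • w] : ℂ) - I * (A ![v, w] : ℂ))

/-- Invariance under multiplication by i gives A(iv, w) = -A(v, iw), which yields complex linearity
in the first slot and, with antisymmetry, Hermitian symmetry. -/
lemma isHermitianForm_hermitianOfForm {A : CSpace n [⋀^Fin 2]→L[ℝ] ℝ}
    (hJ : ∀ v w, A ![I • v, I • w] = A ![v, w]) : IsHermitianForm (hermitianOfForm A) := by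
  have hII (v : CSpace n) : I • I • v = -v := by rw [smul_smul, I_mul_I]; simp
  have hc (c : ℂ) (v : CSpace n) : c • v = c.re • v + c.im • (I • v) := by
    conv_lhs => rw [← re_add_im c]
    rw [add_smul, mul_smul, ← coe_algebraMap, algebraMap_smul, algebraMap_smul]
  have hJ' (v w : CSpace n) : A ![I • v, w] = -A ![v, I • w] := by
    rw [← hJ v (I • w), hII]
    simp only [← curryTwoForm_apply, map_neg, neg_neg]
  constructor
  · intro v v' w
    simp only [hermitianOfForm, ← curryTwoForm_apply, map_add, add_apply]
    push_cast; ring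
  · intro c v w
    simp only [hermitianOfForm]
    rw [hc c v]
    simp only [← curryTwoForm_apply, map_add, map_smul, add_apply, smul_apply, smul_eq_mul]
    simp only [curryTwoForm_apply, hJ', hII]
    have : A ![v, -w] = -A ![v, w] := by simp only [← curryTwoForm_apply, map_neg]
    rw [this]
    conv_rhs => rw [← re_add_im c]
    push_cast
    linear_combination (1 / 2 : ℂ) * c.im * (A ![v, w] : ℂ) * I_mul_I
  · intro v w
    simp only [hermitianOfForm, map_mul, map_sub, conj_ofReal, conj_I, map_div₀, map_one,
      map_ofNat]
    rw [alternating_swap A w (I • v), alternating_swap A w v, hJ']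
    push_cast; ring

/-- Closed `(1,1)`-forms have local potentials. -/
theorem exists_potential_of_closed {c : CSpace n} {U : Set (CSpace n)} (hU : IsOpen U)
    (hc : c ∈ U) {β : CSpace n → CSpace n [⋀^Fin 2]→L[ℝ] ℝ} (hβ : ContDiffOn ℝ ∞ β U)
    (hcl : ∀ y ∈ U, extDeriv β y = 0)
    (hJ : ∀ y ∈ U, ∀ v w, β y ![I • v, I • w] = β y ![v, w]) :
    ∃ W ⊆ U, IsOpen W ∧ c ∈ W ∧ ∃ φ : CSpace n → ℝ, ContDiffOn ℝ ∞ φ W ∧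
      ∀ y ∈ W, ∀ v w, complexHessian φ y v w = hermitianOfForm (β y) v w := by
  obtain ⟨r', hr', hrU⟩ := Metric.isOpen_iff.1 hU c hc
  obtain ⟨r, hr, rfl⟩ : ∃ r > 0, r' = 2 * r := ⟨r' / 2, half_pos hr', by ring⟩
  set B : CSpace n → CSpace n →L[ℝ] CSpace n →L[ℝ] ℝ := fun y => curryTwoForm n (β y) with hB
  have hBs : ContDiffOn ℝ ∞ B (Metric.ball c (2 * r)) :=
    (contDiff_curryTwoForm n).comp_contDiffOn (hβ.mono hrU)
  have hBapp (y v w) : B y v w = β y ![v, w] := curryTwoForm_apply _ _ _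
  obtain ⟨η, hη, hdη⟩ := exists_primitive_of_closed_two_form hr hBs
    (fun x v w => by rw [hBapp, hBapp, alternating_swap])
    (fun x hx u v w => by
      have hd : DifferentiableAt ℝ β x :=
        (hβ.contDiffAt (hU.mem_nhds (hrU hx))).differentiableAt (by simp)
      have hBd (u v w) : fderiv ℝ B x u v w = fderiv ℝ (fun y => β y ![v, w]) x u := by
        have h1 : DifferentiableAt ℝ B x :=
          (hBs.contDiffAt (Metric.isOpen_ball.mem_nhds hx)).differentiableAt (by simp)
        have h2 := (h1.hasFDerivAt.clm_apply (hasFDerivAt_const v x)).clm_apply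
          (hasFDerivAt_const w x)
        simp only [hBapp] at h2
        rw [h2.fderiv]
        simp
      have h2 := extDeriv_apply hd ![u, v, w]
      rw [hcl x (hrU hx)] at h2
      have r0 : Fin.removeNth 0 ![u, v, w] = ![v, w] := by ext i; fin_cases i <;> rfl
      have r1 : Fin.removeNth 1 ![u, v, w] = ![u, w] := by ext i; fin_cases i <;> rfl
      have r2 : Fin.removeNth 2 ![u, v, w] = ![u, v] := by ext i; fin_cases i <;> rfl
      rw [Fin.sum_univ_three, r0, r1, r2] at h2
      rw [hBd, hBd, hBd]
      simp at h2
      linarith)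
  obtain ⟨ρ, hρ, hρU⟩ := exists_polydisc_subset (Metric.ball_mem_nhds c hr)
  set e : Fin n → CSpace n := fun k => EuclideanSpace.single k 1 with he
  have hη2 (w : CSpace n) {z} (hz : z ∈ Metric.ball c r) : DifferentiableAt ℝ (η w) z :=
    ((hη w).contDiffAt (Metric.isOpen_ball.mem_nhds hz)).differentiableAt (by simp)
  have hrr {z} (hz : z ∈ Metric.ball c r) : z ∈ U :=
    hrU (Metric.ball_subset_ball (by linarith) hz)
  -- The dz̄_k-coefficients of the (0,1)-part of the real primitive η.
  set g : Fin n → CSpace n → ℂ := fun k z => (1 / 2) * ((η (e k) z : ℂ) + I * (η (I • e k) z : ℂ))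
    with hg
  have hof (w : CSpace n) : ContDiffOn ℝ ∞ (fun z => (η w z : ℂ)) (Metric.ball c r) :=
    ofRealCLM.contDiff.comp_contDiffOn (hη w)
  have hgs (k) : ContDiffOn ℝ ∞ (g k) (polydisc c ρ) :=
    (contDiffOn_const.mul ((hof _).add (contDiffOn_const.mul (hof _)))).mono hρU
  have hgd (k : Fin n) {z} (hz : z ∈ Metric.ball c r) (v : CSpace n) : fderiv ℝ (g k) z v =
      (1 / 2) * ((fderiv ℝ (η (e k)) z v : ℂ) + I * (fderiv ℝ (η (I • e k)) z v : ℂ)) := by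
    have hd (w : CSpace n) : HasFDerivAt (fun z => (η w z : ℂ)) (ofRealCLM ∘L fderiv ℝ (η w) z) z :=
      ofRealCLM.hasFDerivAt.comp z (hη2 w hz).hasFDerivAt
    have : HasFDerivAt (g k) _ z :=
      ((hd (e k)).fun_add ((hd (I • e k)).const_mul I)).const_mul (1 / 2 : ℂ)
    rw [this.fderiv]
    simp only [smul_apply, add_apply, ContinuousLinearMap.comp_apply, ofRealCLM_apply, smul_eq_mul]
  have hII (v : CSpace n) : I • I • v = -v := by rw [smul_smul, I_mul_I]; simp
  -- The (0,1)-part of η is ∂̄-closed because dη = β has no (0,2)-part.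
  obtain ⟨s, hs, f, hf, hfg⟩ := exists_wirtingerBar_eq_of_closed c n le_rfl hρ g hgs
    (fun j l z hz => by
      have hzr := hρU hz
      have hd (v w) := hdη z hzr v w
      simp only [hBapp] at hd
      have h1 := hd (e l) (e j)
      have h2 := hd (I • e l) (I • e j)
      have h3 := hd (e l) (I • e j)
      have h4 := hd (I • e l) (e j)
      rw [hJ z (hrr hzr)] at h2
      have h5 : β z ![I • e l, e j] = -β z ![e l, I • e j] := by
        rw [← hJ z (hrr hzr) (e l) (I • e j), hII]
        simp only [← curryTwoForm_apply, map_neg, neg_neg]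
      rw [h5] at h4
      simp only [wirtingerBar, hgd j hzr, hgd l hzr]
      apply_fun ((↑) : ℝ → ℂ) at h1 h2 h3 h4
      push_cast at h1 h2 h3 h4
      linear_combination (1 / 4 : ℂ) * h1 - (1 / 4 : ℂ) * h2 + (1 / 4 : ℂ) * I * h3 +
        (1 / 4 : ℂ) * I * h4 + (1 / 4 : ℂ) * ((fderiv ℝ (η (I • e j)) z (I • e l) : ℂ) -
        (fderiv ℝ (η (I • e l)) z (I • e j) : ℂ)) * I_mul_I)
    (fun j hj => absurd j.2 (by omega))
  set W := polydisc c (min s ρ) with hW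
  have hWo : IsOpen W := isOpen_polydisc _ _
  have hWs : W ⊆ polydisc c s := polydisc_subset c (min_le_left _ _)
  have hWr : W ⊆ Metric.ball c r := (polydisc_subset c (min_le_right _ _)).trans hρU
  set a : CSpace n → ℝ := fun z => (f z).re with ha
  set b : CSpace n → ℝ := fun z => (f z).im with hb
  have has : ContDiffOn ℝ ∞ a W := reCLM.contDiff.comp_contDiffOn (hf.mono hWs)
  have hbs : ContDiffOn ℝ ∞ b W := imCLM.contDiff.comp_contDiffOn (hf.mono hWs)
  have ha2 {z} (hz : z ∈ W) : ContDiffAt ℝ 2 a z :=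
    (has.contDiffAt (hWo.mem_nhds hz)).of_le (by norm_cast)
  have hb2 {z} (hz : z ∈ W) : ContDiffAt ℝ 2 b z :=
    (hbs.contDiffAt (hWo.mem_nhds hz)).of_le (by norm_cast)
  have hfab {z} (hz : z ∈ W) (v : CSpace n) : fderiv ℝ f z v = fderiv ℝ a z v + fderiv ℝ b z v * I := by
    have hfd : HasFDerivAt f (fderiv ℝ f z) z :=
      ((hf.contDiffAt ((isOpen_polydisc c s).mem_nhds (hWs hz))).differentiableAt (by simp)).hasFDerivAt
    have h1 : HasFDerivAt a (reCLM ∘L fderiv ℝ f z) z := reCLM.hasFDerivAt.comp z hfd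
    have h2 : HasFDerivAt b (imCLM ∘L fderiv ℝ f z) z := imCLM.hasFDerivAt.comp z hfd
    rw [h1.fderiv, h2.fderiv]
    simp [re_add_im]
  have hab {z} (hz : z ∈ W) (k : Fin n) :
      fderiv ℝ a z (e k) - fderiv ℝ b z (I • e k) = η (e k) z ∧
        fderiv ℝ b z (e k) + fderiv ℝ a z (I • e k) = η (I • e k) z := by
    have h := hfg k z (hWs hz)
    rw [wirtingerBar, hfab hz, hfab hz] at h
    simp only [hg] at h
    have h' := mul_left_cancel₀ (by norm_num : (1 / 2 : ℂ) ≠ 0) h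
    constructor
    · simpa [sub_eq_add_neg] using congrArg re h'
    · simpa using congrArg im h'
  -- Since η = ∂̄f + ∂f̄ is real, dη = ∂∂̄(f - f̄) = i∂∂̄(2 Im f), so the potential is 2 Im f.
  refine ⟨W, fun z hz => hrr (hWr hz), hWo, mem_polydisc_self c (lt_min hs hρ),
    fun z => 2 * b z, contDiffOn_const.mul hbs, fun y hy v w => ?_⟩
  refine IsHermitianForm.ext_single (isHermitianForm_complexHessian
    (contDiffAt_const.mul (hb2 hy))) (isHermitianForm_hermitianOfForm (hJ y (hrr (hWr hy))))
    (fun j k => ?_) v w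
  have h1 (k : Fin n) (v : CSpace n) : fderiv ℝ (η (e k)) y v =
      fderiv ℝ (fderiv ℝ a) y v (e k) - fderiv ℝ (fderiv ℝ b) y v (I • e k) := by
    have hev : η (e k) =ᶠ[𝓝 y] fun z => fderiv ℝ a z (e k) - fderiv ℝ b z (I • e k) := by
      filter_upwards [hWo.mem_nhds hy] with z hz using ((hab hz k).1).symm
    rw [hev.fderiv_eq, (((ha2 hy).hasFDerivAt_fderiv_apply (e k)).fun_sub
      ((hb2 hy).hasFDerivAt_fderiv_apply (I • e k))).fderiv]
    rfl
  have h2 (k : Fin n) (v : CSpace n) : fderiv ℝ (η (I • e k)) y v =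
      fderiv ℝ (fderiv ℝ b) y v (e k) + fderiv ℝ (fderiv ℝ a) y v (I • e k) := by
    have hev : η (I • e k) =ᶠ[𝓝 y] fun z => fderiv ℝ b z (e k) + fderiv ℝ a z (I • e k) := by
      filter_upwards [hWo.mem_nhds hy] with z hz using ((hab hz k).2).symm
    rw [hev.fderiv_eq, (((hb2 hy).hasFDerivAt_fderiv_apply (e k)).fun_add
      ((ha2 hy).hasFDerivAt_fderiv_apply (I • e k))).fderiv]
    rfl
  have h3 := hdη y (hWr hy) (e j) (I • e k)
  have h4 := hdη y (hWr hy) (e j) (e k)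
  rw [hBapp, h1, h2] at h3
  rw [hBapp, h1, h1] at h4
  rw [(ha2 hy).fderiv_fderiv_symm (I • e k), (hb2 hy).fderiv_fderiv_symm (I • e k)] at h3
  rw [(ha2 hy).fderiv_fderiv_symm (e k), (hb2 hy).fderiv_fderiv_symm (e k)] at h4
  rw [complexHessian_const_mul 2 (hb2 hy), complexHessian_eq (hb2 hy), hermitianOfForm, ← h3, ← h4]
  push_cast
  ring

end LocalPotential

/-! ### Forms and potentials on the manifold, read in charts. -/

section Charts

open Filter Topology Set

variable {n : ℕ} {X : Type*} [TopologicalSpace X] [ChartedSpace (CSpace n) X]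

section

variable [IsManifold 𝓘(ℂ, CSpace n) ω X]

lemma contDiffOn_transition_of_mem_atlas {e e' : OpenPartialHomeomorph X (CSpace n)}
    (he : e ∈ atlas (CSpace n) X) (he' : e' ∈ atlas (CSpace n) X) :
    ContDiffOn ℂ ω (e' ∘ e.symm) (e.symm ≫ₕ e').source := by
  have h := (HasGroupoid.compatible (G := contDiffGroupoid ω 𝓘(ℂ, CSpace n)) he he').1
  simpa [contDiffPregroupoid] using h

variable (n X) in
/-- A complex manifold is a real manifold. -/
lemma isManifold_real : IsManifold 𝓘(ℝ, CSpace n) ω X := by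
  refine isManifold_of_contDiffOn _ _ _ fun e e' he he' => ?_
  simpa using (contDiffOn_transition_of_mem_atlas he he').restrict_scalars ℝ

lemma contDiffAt_transition (x x' : X) {y : CSpace n} (hy : y ∈ (chartAt (CSpace n) x).target)
    (hy' : (chartAt (CSpace n) x).symm y ∈ (chartAt (CSpace n) x').source) :
    ContDiffAt ℂ 2 (fun y => chartAt (CSpace n) x' ((chartAt (CSpace n) x).symm y)) y := by
  have h := contDiffOn_transition_of_mem_atlas (chart_mem_atlas (CSpace n) x)
    (chart_mem_atlas (CSpace n) x')
  refine (h.contDiffAt (IsOpen.mem_nhds ((chartAt (CSpace n) x).symm.trans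
    (chartAt (CSpace n) x')).open_source ?_)).of_le le_top
  simpa using ⟨hy, hy'⟩

/-- The tangent space at a point is the model space through the preferred chart there, so the
derivative of an inverse chart is that of a transition map into the chart preferred at the image
point. -/
lemma mfderiv_chart_symm (x₀ : X) {y : CSpace n} (hy : y ∈ (chartAt (CSpace n) x₀).target) :
    mfderiv 𝓘(ℝ, CSpace n) 𝓘(ℝ, CSpace n) (chartAt (CSpace n) x₀).symm y =
      fderiv ℝ (fun y' => chartAt (CSpace n) ((chartAt (CSpace n) x₀).symm y)
        ((chartAt (CSpace n) x₀).symm y')) y := by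
  have := isManifold_real n X
  have : IsManifold 𝓘(ℝ, CSpace n) 1 X := IsManifold.of_le (n := ω) le_top
  have hd := mdifferentiableAt_atlas_symm (I := 𝓘(ℝ, CSpace n)) (chart_mem_atlas (CSpace n) x₀) hy
  refine hd.mfderiv.trans ?_
  simp [writtenInExtChartAt, Function.comp_def, chartAt_self_eq]
  rfl

lemma formInChart_apply (A : X → CSpace n [⋀^Fin 2]→L[ℝ] ℝ) (x₀ : X) {y : CSpace n}
    (hy : y ∈ (chartAt (CSpace n) x₀).target) (v w : CSpace n) :
    formInChart A x₀ y ![v, w] =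
      A ((chartAt (CSpace n) x₀).symm y)
        ![fderiv ℂ (fun y' => chartAt (CSpace n) ((chartAt (CSpace n) x₀).symm y)
          ((chartAt (CSpace n) x₀).symm y')) y v,
          fderiv ℂ (fun y' => chartAt (CSpace n) ((chartAt (CSpace n) x₀).symm y)
          ((chartAt (CSpace n) x₀).symm y')) y w] := by
  have hd := (contDiffAt_transition x₀ ((chartAt (CSpace n) x₀).symm y) hy
    (mem_chart_source _ _)).differentiableAt (by norm_num)
  rw [formInChart, mfderiv_chart_symm x₀ hy, ContinuousAlternatingMap.compContinuousLinearMap_apply]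
  congr 1
  ext i
  fin_cases i <;> simp [fderiv_real_eq hd]

/-- The Hermitian form of a Kähler form in a chart is the pull-back of its coefficients. -/
lemma hermitianOfForm_formInChart (Ω : KaehlerForm n X) (x₀ : X) {y : CSpace n}
    (hy : y ∈ (chartAt (CSpace n) x₀).target) (v w : CSpace n) :
    hermitianOfForm (formInChart Ω.form x₀ y) v w =
      Ω.coeff ((chartAt (CSpace n) x₀).symm y)
        (fderiv ℂ (fun y' => chartAt (CSpace n) ((chartAt (CSpace n) x₀).symm y)
          ((chartAt (CSpace n) x₀).symm y')) y v)
        (fderiv ℂ (fun y' => chartAt (CSpace n) ((chartAt (CSpace n) x₀).symm y)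
          ((chartAt (CSpace n) x₀).symm y')) y w) := by
  simp only [hermitianOfForm, formInChart_apply Ω.form x₀ hy, KaehlerForm.coeff, map_smul]

lemma isHermitianForm_coeff (Ω : KaehlerForm n X) (x : X) : IsHermitianForm (Ω.coeff x) :=
  isHermitianForm_hermitianOfForm (Ω.type_one_one x)

lemma fderiv_transition_comp (x x' : X) {y : CSpace n} (hy : y ∈ (chartAt (CSpace n) x).target)
    (hy' : (chartAt (CSpace n) x).symm y ∈ (chartAt (CSpace n) x').source) (v : CSpace n) :
    fderiv ℂ (fun y => chartAt (CSpace n) x ((chartAt (CSpace n) x').symm y))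
      (chartAt (CSpace n) x' ((chartAt (CSpace n) x).symm y))
      (fderiv ℂ (fun y => chartAt (CSpace n) x' ((chartAt (CSpace n) x).symm y)) y v) = v := by
  set e := chartAt (CSpace n) x
  set e' := chartAt (CSpace n) x'
  have h1 := (contDiffAt_transition x x' hy hy').differentiableAt (by norm_num)
  have hback : e'.symm (e' (e.symm y)) = e.symm y := e'.left_inv hy'
  have h2 := (contDiffAt_transition x' x (y := e' (e.symm y)) (e'.map_source hy')
    (by rw [hback]; exact e.map_target hy)).differentiableAt (by norm_num)
  have h3 := HasFDerivAt.comp (f := fun y => e' (e.symm y)) (g := fun y => e (e'.symm y)) y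
    h2.hasFDerivAt h1.hasFDerivAt
  have hid : (fun y => e (e'.symm y)) ∘ (fun y => e' (e.symm y)) =ᶠ[𝓝 y] fun y => y := by
    have ho := (e.symm.trans e').open_source.mem_nhds (x := y) (by simpa using ⟨hy, hy'⟩)
    filter_upwards [ho] with w hw
    rw [OpenPartialHomeomorph.trans_source] at hw
    simp only [Function.comp]
    rw [e'.left_inv hw.2, e.right_inv hw.1]
  have h4 := (h3.congr_of_eventuallyEq hid.symm).fderiv
  have h5 : fderiv ℂ (fun y : CSpace n => y) y = ContinuousLinearMap.id ℂ _ := fderiv_fun_id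
  rw [h5] at h4
  exact (DFunLike.congr_fun h4 v).symm

/-- A Kähler form has local potentials near each point. -/
theorem KaehlerForm.exists_isPotentialOn (Ω : KaehlerForm n X) (x₀ : X) :
    ∃ (O : Set X) (ψ : X → ℝ), x₀ ∈ O ∧ Ω.IsPotentialOn ψ O := by
  set e := chartAt (CSpace n) x₀ with he
  have hJ : ∀ y ∈ e.target, ∀ v w, formInChart Ω.form x₀ y ![Complex.I • v, Complex.I • w] =
      formInChart Ω.form x₀ y ![v, w] := fun y hy v w => by
    rw [formInChart_apply _ _ hy, formInChart_apply _ _ hy, map_smul, map_smul, Ω.type_one_one]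
  obtain ⟨W, hWe, hWo, hW0, φ, hφ, hφh⟩ := exists_potential_of_closed e.open_target
    (mem_chart_target _ x₀) (Ω.smooth x₀) (Ω.closed x₀) hJ
  have := isManifold_real n X
  have : IsManifold 𝓘(ℝ, CSpace n) 2 X := IsManifold.of_le (n := ω) le_top
  refine ⟨e.source ∩ e ⁻¹' W, φ ∘ e, ⟨mem_chart_source _ x₀, hW0⟩,
    e.isOpen_inter_preimage hWo, ?_, fun x hx v w => ?_⟩
  · have h1 : ContMDiffOn 𝓘(ℝ, CSpace n) 𝓘(ℝ, ℝ) 2 φ W := (hφ.of_le (by norm_cast)).contMDiffOn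
    exact h1.comp ((contMDiffOn_chart (x := x₀)).mono inter_subset_left) fun x hx => hx.2
  · have hy := mem_chart_target (CSpace n) x
    have hback : (chartAt (CSpace n) x).symm (chartAt (CSpace n) x x) = x :=
      (chartAt (CSpace n) x).left_inv (mem_chart_source _ x)
    have hy' : (chartAt (CSpace n) x).symm (chartAt (CSpace n) x x) ∈ e.source := by
      rw [hback]; exact hx.1
    have hφ2 : ContDiffAt ℝ 2 φ (e ((chartAt (CSpace n) x).symm (chartAt (CSpace n) x x))) := by
      rw [hback]
      exact (hφ.contDiffAt (hWo.mem_nhds hx.2)).of_le (by norm_cast)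
    have hc := complexHessian_comp
      (F := fun y => e ((chartAt (CSpace n) x).symm y)) (φ := φ) hφ2 (contDiffAt_transition x x₀ hy hy') v w
    refine hc.trans ?_
    have hz : e.symm (e x) = x := e.left_inv hx.1
    have key := hermitianOfForm_formInChart Ω x₀ (e.map_source hx.1)
    rw [← he, hz] at key
    -- Two transition derivatives occur, one from pulling the potential to the chart at x and one
    -- from writing the form in the chart at x₀; they are mutually inverse.
    have hf := fderiv_transition_comp x x₀ hy hy'
    rw [← he, hback] at hf
    rw [hback, hφh _ hx.2, key, hf, hf]

end

end Charts

/-! ### Powers of sums of elements of square zero. -/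

section SquareZero

variable {R ι : Type*} [CommRing R]

/-- The binomial expansion stops after the term linear in a. Only the product a²g is assumed to
vanish, since the horizontal part of the form squares to zero only after multiplication by the power
of the base form. -/
lemma add_pow_succ_mul_of_sq_mul_eq_zero {a g : R} (h : a ^ 2 * g = 0) (b : R) (k : ℕ) :
    (a + b) ^ (k + 1) * g = b ^ (k + 1) * g + (k + 1) * (a * b ^ k) * g := by
  induction k with
  | zero => simp; ring
  | succ k ih =>
    rw [pow_succ', mul_assoc, ih]
    push_cast
    linear_combination (k + 1) * b ^ k * h

lemma add_pow_succ_of_sq_eq_zero {a : R} (h : a ^ 2 = 0) (b : R) (k : ℕ) :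
    (a + b) ^ (k + 1) = b ^ (k + 1) + (k + 1) * (a * b ^ k) := by
  simpa using add_pow_succ_mul_of_sq_mul_eq_zero (g := 1) (by simpa using h) b k

/-- Pigeonhole: each monomial of degree larger than the number of summands repeats a factor. -/
lemma sum_pow_card_lt_eq_zero (x : ι → R) (hx : ∀ i, x i ^ 2 = 0) (s : Finset ι) :
    ∀ k, s.card < k → (∑ i ∈ s, x i) ^ k = 0 := by
  classical
  induction s using Finset.induction_on with
  | empty => intro k hk; rw [Finset.sum_empty, zero_pow (by simp at hk; omega)]
  | insert i s hi ih =>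
    intro k hk
    rw [Finset.card_insert_of_notMem hi] at hk
    obtain ⟨k, rfl⟩ : ∃ l, k = l + 1 := ⟨k - 1, by omega⟩
    rw [Finset.sum_insert hi, add_pow_succ_of_sq_eq_zero (hx i), ih _ (by omega), ih _ (by omega)]
    simp

/-- Only the square-free monomial survives, once for each ordering of the factors. -/
lemma sum_pow_card_eq_prod (x : ι → R) (hx : ∀ i, x i ^ 2 = 0) (s : Finset ι) :
    (∑ i ∈ s, x i) ^ s.card = s.card.factorial * ∏ i ∈ s, x i := by
  classical
  induction s using Finset.induction_on with
  | empty => simp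
  | insert i s hi ih =>
    rw [Finset.card_insert_of_notMem hi, Finset.sum_insert hi, Finset.prod_insert hi,
      add_pow_succ_of_sq_eq_zero (hx i), ih, sum_pow_card_lt_eq_zero x hx s _ (by omega),
      Nat.factorial_succ]
    push_cast
    ring

end SquareZero

/-! ### Wedge products of pairs as central elements of the exterior algebra. -/

section ExteriorWedge

variable {M : Type*} [AddCommGroup M] [Module ℂ M]

lemma ExteriorAlgebra.ι_mul_ι_swap (a b : M) :
    ExteriorAlgebra.ι ℂ a * ExteriorAlgebra.ι ℂ b = -(ExteriorAlgebra.ι ℂ b * ExteriorAlgebra.ι ℂ a) :=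
  eq_neg_of_add_eq_zero_left (ExteriorAlgebra.ι_add_mul_swap a b)

/-- Moving a vector past two others costs two signs. All later computations with 2-forms can
therefore be done in the centre, a commutative ring. -/
lemma ExteriorAlgebra.ι_mul_ι_mem_center (a b : M) :
    ExteriorAlgebra.ι ℂ a * ExteriorAlgebra.ι ℂ b ∈ Subalgebra.center ℂ (ExteriorAlgebra ℂ M) := by
  rw [Subalgebra.mem_center_iff]
  intro x
  change Commute x _
  induction x using ExteriorAlgebra.induction with
  | algebraMap r => exact Algebra.commute_algebraMap_left r _
  | ι c =>
    change _ = _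
    rw [← mul_assoc, ι_mul_ι_swap c a, neg_mul, mul_assoc, ι_mul_ι_swap c b, mul_neg, neg_neg,
      mul_assoc]
  | mul x y hx hy => exact hx.mul_left hy
  | add x y hx hy => exact hx.add_left hy

variable (M) in
/-- The wedge product of two vectors, as a central element of the exterior algebra. -/
def wedgeCenter : M →ₗ[ℂ] M →ₗ[ℂ] Subalgebra.center ℂ (ExteriorAlgebra ℂ M) :=
  LinearMap.mk₂ ℂ (fun a b => ⟨_, ExteriorAlgebra.ι_mul_ι_mem_center a b⟩)
    (fun a a' b => Subtype.ext (by simp [add_mul]))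
    (fun c a b => Subtype.ext (by simp))
    (fun a b b' => Subtype.ext (by simp [mul_add]))
    (fun c a b => Subtype.ext (by simp))

lemma coe_wedgeCenter (a b : M) :
    (wedgeCenter M a b : ExteriorAlgebra ℂ M) = ExteriorAlgebra.ι ℂ a * ExteriorAlgebra.ι ℂ b := rfl

lemma wedgeCenter_mul_left (a b c : M) : wedgeCenter M a b * wedgeCenter M a c = 0 := by
  apply Subtype.ext
  change ExteriorAlgebra.ι ℂ a * ExteriorAlgebra.ι ℂ b * (ExteriorAlgebra.ι ℂ a * ExteriorAlgebra.ι ℂ c) = 0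
  rw [ExteriorAlgebra.ι_mul_ι_swap a b, neg_mul, mul_assoc, ← mul_assoc (ExteriorAlgebra.ι ℂ a)]
  simp

lemma wedgeCenter_mul_right (a b c : M) : wedgeCenter M a b * wedgeCenter M c b = 0 := by
  apply Subtype.ext
  change ExteriorAlgebra.ι ℂ a * ExteriorAlgebra.ι ℂ b * (ExteriorAlgebra.ι ℂ c * ExteriorAlgebra.ι ℂ b) = 0
  rw [ExteriorAlgebra.ι_mul_ι_swap c b, mul_neg, mul_assoc, ← mul_assoc (ExteriorAlgebra.ι ℂ b)]
  simp

lemma wedgeCenter_sq (a b : M) : wedgeCenter M a b ^ 2 = 0 := by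
  rw [sq, wedgeCenter_mul_left]

/-- A product of 2-vectors does not vanish if the vectors have a dual system. -/
lemma prod_wedgeCenter_ne_zero {ι : Type*} (a b : ι → M) (δ δ' : ι → Module.Dual ℂ M)
    (h1 : ∀ i, δ i (a i) = 1) (h2 : ∀ i j, i ≠ j → δ i (a j) = 0) (h3 : ∀ i j, δ i (b j) = 0)
    (h4 : ∀ i, δ' i (b i) = 1) (h5 : ∀ i j, i ≠ j → δ' i (b j) = 0) (h6 : ∀ i j, δ' i (a j) = 0) (s : Finset ι) :
    ∏ i ∈ s, wedgeCenter M (a i) (b i) ≠ 0 := by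
  classical
  have hc (d : Module.Dual ℂ M) (v : M) (x : ExteriorAlgebra ℂ M) :
      CliffordAlgebra.contractLeft (Q := (0 : QuadraticForm ℂ M)) d (ExteriorAlgebra.ι ℂ v * x) =
        d v • x - ExteriorAlgebra.ι ℂ v *
          CliffordAlgebra.contractLeft (Q := (0 : QuadraticForm ℂ M)) d x :=
    CliffordAlgebra.contractLeft_ι_mul (Q := (0 : QuadraticForm ℂ M)) (d := d) v x
  -- Contraction is an antiderivation, so it kills a product of vectors on all of which d vanishes.
  have hk (d : Module.Dual ℂ M) (s : Finset ι) (ha : ∀ i ∈ s, d (a i) = 0)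
      (hb : ∀ i ∈ s, d (b i) = 0) :
      CliffordAlgebra.contractLeft (Q := (0 : QuadraticForm ℂ M)) d
        (((∏ i ∈ s, wedgeCenter M (a i) (b i) :
          Subalgebra.center ℂ (ExteriorAlgebra ℂ M)) : ExteriorAlgebra ℂ M)) = 0 := by
    induction s using Finset.induction_on with
    | empty => exact CliffordAlgebra.contractLeft_one (Q := (0 : QuadraticForm ℂ M)) d
    | insert i s hi ih =>
      rw [Finset.prod_insert hi, MulMemClass.coe_mul, coe_wedgeCenter, mul_assoc, hc, hc,
        ih (fun j hj => ha j (Finset.mem_insert_of_mem hj))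
          (fun j hj => hb j (Finset.mem_insert_of_mem hj)),
        ha i (Finset.mem_insert_self i s), hb i (Finset.mem_insert_self i s)]
      simp
  induction s using Finset.induction_on with
  | empty =>
    simp only [Finset.prod_empty]
    intro h
    exact one_ne_zero (α := ExteriorAlgebra ℂ M) (congrArg Subtype.val h)
  | insert i s hi ih =>
    intro h
    apply ih
    apply Subtype.ext
    have h' := congrArg Subtype.val h
    rw [Finset.prod_insert hi, MulMemClass.coe_mul, coe_wedgeCenter, mul_assoc] at h'
    have hne : ∀ j ∈ s, i ≠ j := fun j hj hij => hi (hij ▸ hj)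
    -- Contracting with the two dual vectors of index i strips off the i-th pair and leaves the
    -- product over s.
    have e1 := congrArg (CliffordAlgebra.contractLeft (Q := (0 : QuadraticForm ℂ M)) (δ i)) h'
    rw [hc, hc, hk (δ i) s (fun j hj => h2 i j (hne j hj)) (fun j _ => h3 i j), h1, h3] at e1
    simp only [one_smul, zero_smul, mul_zero, sub_zero] at e1
    have e2 := congrArg (CliffordAlgebra.contractLeft (Q := (0 : QuadraticForm ℂ M)) (δ' i)) e1
    rw [hc, hk (δ' i) s (fun j _ => h6 i j) (fun j hj => h5 i j (hne j hj)), h4] at e2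
    simpa only [one_smul, mul_zero, sub_zero, map_zero, ZeroMemClass.coe_zero] using e2

end ExteriorWedge

lemma mul_add_pow_eq_of_mul_eq_zero {R : Type*} [CommRing R] {w x : R} (h : w * x = 0) (y : R)
    (N : ℕ) : w * (x + y) ^ N = w * y ^ N := by
  induction N with
  | zero => simp
  | succ N ih => rw [pow_succ, pow_succ, ← mul_assoc, ih]; linear_combination y ^ N * h

lemma bilin_sum_smul_sum_smul {R M N ι : Type*} [CommRing R] [AddCommGroup M] [Module R M]
    [AddCommGroup N] [Module R N] [Fintype ι] (B : M →ₗ[R] M →ₗ[R] N) (f g : ι → R)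
    (x y : ι → M) :
    B (∑ c, f c • x c) (∑ d, g d • y d) = ∑ c, ∑ d, (f c * g d) • B (x c) (y d) := by
  rw [map_sum B, LinearMap.sum_apply]
  refine Finset.sum_congr rfl fun c _ => ?_
  rw [map_sum]
  refine Finset.sum_congr rfl fun d _ => ?_
  rw [map_smul, map_smul, LinearMap.smul_apply, smul_smul, mul_comm]

/-! ### The top power of a block-diagonal 2-form. -/

section TraceForm

open Complex

variable {M : Type*} [AddCommGroup M] [Module ℂ M] {m n : ℕ}

/-- The factor a_j kills the summand l = j, leaving m - 1 summands, whose (m-1)-st power is a single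
product. If k ≠ j, the factor b_k kills one more summand, and m - 2 summands are too few. -/
lemma wedgeCenter_mul_sum_pow (a b : Fin m → M) (j k : Fin m) :
    wedgeCenter M (a j) (b k) * (∑ l, wedgeCenter M (a l) (b l)) ^ (m - 1) =
      if j = k then ((m - 1).factorial : Subalgebra.center ℂ (ExteriorAlgebra ℂ M)) *
        ∏ l, wedgeCenter M (a l) (b l) else 0 := by
  set d : Fin m → Subalgebra.center ℂ (ExteriorAlgebra ℂ M) := fun l => wedgeCenter M (a l) (b l)
    with hd
  have hsq : ∀ l, d l ^ 2 = 0 := fun l => wedgeCenter_sq _ _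
  have h1 : ∑ l, d l = d j + ∑ l ∈ Finset.univ.erase j, d l :=
    (Finset.add_sum_erase _ d (Finset.mem_univ j)).symm
  rw [h1, mul_add_pow_eq_of_mul_eq_zero (wedgeCenter_mul_left _ _ _)]
  have hcard : (Finset.univ.erase j : Finset (Fin m)).card = m - 1 := by simp
  split_ifs with hjk
  · subst hjk
    rw [← hcard, sum_pow_card_eq_prod d hsq, hcard, ← Finset.mul_prod_erase _ d (Finset.mem_univ j)]
    ring
  · have hk : k ∈ (Finset.univ.erase j : Finset (Fin m)) := by simp [Ne.symm hjk]
    rw [← Finset.add_sum_erase _ d hk, mul_add_pow_eq_of_mul_eq_zero (wedgeCenter_mul_right _ _ _),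
      sum_pow_card_lt_eq_zero d hsq, mul_zero]
    rw [Finset.card_erase_of_mem hk, hcard]
    have := Finset.card_pos.2 ⟨k, hk⟩
    omega

/-- The top exterior power computing the trace of the horizontal part. -/
lemma pow_mul_pow_eq_smul (a b : Fin m → M)
    (e : Fin n → Subalgebra.center ℂ (ExteriorAlgebra ℂ M)) (he : ∀ ν, e ν ^ 2 = 0)
    (S : Fin m → Fin m → ℂ) :
    ∃ c : ℂ, c ≠ 0 ∧
      (∑ j, ∑ k, (I * S j k) • wedgeCenter M (a j) (b k) + I • ∑ ν, e ν) ^ (n + 1) *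
        (I • ∑ l, wedgeCenter M (a l) (b l)) ^ (m - 1) =
      (c * ∑ j, S j j) • ((∏ l, wedgeCenter M (a l) (b l)) * ∏ ν, e ν) := by
  set α := ∑ j, ∑ k, (I * S j k) • wedgeCenter M (a j) (b k) with hα
  set P := ∏ l, wedgeCenter M (a l) (b l) with hP
  set g := (∑ l, wedgeCenter M (a l) (b l)) ^ (m - 1) with hg
  have h1 : α * g = (I * ((m - 1).factorial : ℂ) * ∑ j, S j j) • P := by
    rw [hα, Finset.sum_mul]
    simp only [Finset.sum_mul, smul_mul_assoc, hg, wedgeCenter_mul_sum_pow, smul_ite,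
      smul_zero, Finset.sum_ite_eq, Finset.mem_univ, if_true]
    rw [← Finset.sum_smul, ← Finset.mul_sum, ← hP, ← nsmul_eq_mul, ← Nat.cast_smul_eq_nsmul ℂ,
      smul_smul]
    congr 1
    ring
  have hPa (j k : Fin m) : wedgeCenter M (a j) (b k) * P = 0 := by
    rw [hP, ← Finset.mul_prod_erase _ _ (Finset.mem_univ j), ← mul_assoc, wedgeCenter_mul_left,
      zero_mul]
  -- Already αg is a multiple of the full horizontal product, which one more horizontal factor
  -- annihilates. So α enters the (n+1)-st power only linearly, next to the n-th power of the
  -- vertical part.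
  have h2 : α ^ 2 * g = 0 := by
    rw [sq, mul_assoc, h1, mul_smul_comm, hα, Finset.sum_mul]
    simp only [Finset.sum_mul, smul_mul_assoc, hPa, smul_zero, Finset.sum_const_zero]
  have hn := sum_pow_card_eq_prod e he Finset.univ
  have hn' := sum_pow_card_lt_eq_zero e he Finset.univ (n + 1) (by simp)
  rw [Finset.card_univ, Fintype.card_fin] at hn
  refine ⟨I ^ (m - 1) * (n + 1) * I ^ n * n.factorial * (I * ((m - 1).factorial : ℂ)), ?_, ?_⟩
  · have : (n : ℂ) + 1 ≠ 0 := Nat.cast_add_one_ne_zero n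
    have := Nat.factorial_ne_zero n
    have := Nat.factorial_ne_zero (m - 1)
    have := I_ne_zero
    positivity
  · rw [smul_pow, ← hg, mul_smul_comm, add_pow_succ_mul_of_sq_mul_eq_zero h2, smul_pow, hn',
      smul_zero, zero_mul, zero_add, smul_pow, hn]
    have h3 : ((n : Subalgebra.center ℂ (ExteriorAlgebra ℂ M)) + 1) *
        (α * I ^ n • ((n.factorial : Subalgebra.center ℂ (ExteriorAlgebra ℂ M)) * ∏ ν, e ν)) * g =
        (((n : ℂ) + 1) * I ^ n * n.factorial) • ((α * g) * ∏ ν, e ν) := by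
      simp only [Algebra.smul_def, map_mul, map_add, map_natCast, map_one]
      ring
    rw [h3, h1, smul_mul_assoc, smul_smul, smul_smul]
    congr 1
    ring

end TraceForm

/-! ### The WZW expression in a coframe adapted to the slopes. -/

section AdaptedCoframe

open Complex

variable {m n : ℕ}

/-- The coframe `dz_j`, `dx_μ - ∑ p_j^μ dz_j`. -/
def adaptedCoord (p : Fin m → CSpace n) : Fin m ⊕ Fin n → CCotangent m n
  | .inl j => dCoord (.inl j)
  | .inr μ => dCoord (.inr μ) - ∑ j, p j μ • dCoord (.inl j)

/-- The conjugates of the adapted coframe. -/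
def adaptedCoordBar (p : Fin m → CSpace n) (a : Fin m ⊕ Fin n) : CCotangent m n :=
  Complex.conjAe.toLinearMap ∘ₗ adaptedCoord p a

lemma adaptedCoordBar_apply (p : Fin m → CSpace n) (a : Fin m ⊕ Fin n)
    (v : CSpace m × CSpace n) :
    adaptedCoordBar p a v = (starRingEnd ℂ) (adaptedCoord p a v) := rfl

/-- The frame dual to the adapted coframe. -/
def adaptedVec (p : Fin m → CSpace n) : Fin m ⊕ Fin n → CSpace m × CSpace n
  | .inl j => (EuclideanSpace.single j 1, p j)
  | .inr μ => (0, EuclideanSpace.single μ 1)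

/-- The matrix of the adapted frame in terms of the coordinate frame. -/
def adaptedMatrix (p : Fin m → CSpace n) : Fin m ⊕ Fin n → Fin m ⊕ Fin n → ℂ
  | .inl j, .inl k => if j = k then 1 else 0
  | .inl j, .inr μ => p j μ
  | .inr _, .inl _ => 0
  | .inr μ, .inr ν => if μ = ν then 1 else 0

lemma adaptedVec_eq (p : Fin m → CSpace n) (c : Fin m ⊕ Fin n) :
    adaptedVec p c = ∑ a, adaptedMatrix p c a • coordVec a := by
  cases c with
  | inl j =>
    ext i
    · simp [adaptedVec, adaptedMatrix, coordVec, Prod.fst_sum]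
    · simp [adaptedVec, adaptedMatrix, coordVec, Prod.snd_sum, Pi.single_apply]
  | inr ν =>
    ext i
    · simp [adaptedVec, adaptedMatrix, coordVec]
    · simp [adaptedVec, adaptedMatrix, coordVec]

lemma dCoord_eq (p : Fin m → CSpace n) (a : Fin m ⊕ Fin n) :
    dCoord a = ∑ c, adaptedMatrix p c a • adaptedCoord p c := by
  cases a with
  | inl j => simp [adaptedMatrix, adaptedCoord]
  | inr ν => simp [adaptedMatrix, adaptedCoord]

lemma dCoordBar_eq (p : Fin m → CSpace n) (a : Fin m ⊕ Fin n) :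
    dCoordBar a = ∑ c, (starRingEnd ℂ) (adaptedMatrix p c a) • adaptedCoordBar p c := by
  refine LinearMap.ext fun v => ?_
  have h := congrArg (fun l : CCotangent m n => (starRingEnd ℂ) (l v)) (dCoord_eq p a)
  simp only [LinearMap.sum_apply, LinearMap.smul_apply, map_sum, smul_eq_mul, map_mul] at h ⊢
  simpa [dCoordBar, adaptedCoordBar] using h

lemma adaptedCoord_inl_apply (p : Fin m → CSpace n) (j : Fin m) (v : CSpace m × CSpace n) :
    adaptedCoord p (.inl j) v = v.1 j := rfl

lemma adaptedCoord_inr_apply (p : Fin m → CSpace n) (μ : Fin n) (v : CSpace m × CSpace n) :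
    adaptedCoord p (.inr μ) v = v.2 μ - ∑ j, p j μ * v.1 j := by
  simp only [adaptedCoord, LinearMap.sub_apply, LinearMap.sum_apply, LinearMap.smul_apply]
  rfl

lemma adaptedCoord_smul (p : Fin m → CSpace n) (a : Fin m ⊕ Fin n) (c : ℂ)
    (v : CSpace m × CSpace n) : adaptedCoord p a (c • v) = c * adaptedCoord p a v := by
  cases a with
  | inl j => simp [adaptedCoord_inl_apply]
  | inr ν =>
    simp only [adaptedCoord_inr_apply, smul_eq_mul, Prod.smul_fst,
      Prod.smul_snd, PiLp.smul_apply, mul_sub, Finset.mul_sum]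
    congr 1
    exact Finset.sum_congr rfl fun _ _ => by ring

lemma adaptedCoord_adaptedVec (p : Fin m → CSpace n) (a c : Fin m ⊕ Fin n) :
    adaptedCoord p a (adaptedVec p c) = if a = c then 1 else 0 := by
  rcases a with j | μ <;> rcases c with k | ν <;>
    simp [adaptedCoord_inl_apply, adaptedCoord_inr_apply, adaptedVec]

/-- The `(1,0)` part of a covector evaluated at a vector. -/
def evalHol (v : CSpace m × CSpace n) : Module.Dual ℂ (CCotangent m n) where
  toFun l := (1 / 2) * (l v - I * l (I • v))
  map_add' l l' := by simp; ring
  map_smul' c l := by simp; ring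

/-- The `(0,1)` part of a covector evaluated at a vector. -/
def evalAntihol (v : CSpace m × CSpace n) : Module.Dual ℂ (CCotangent m n) where
  toFun l := (1 / 2) * (l v + I * l (I • v))
  map_add' l l' := by simp; ring
  map_smul' c l := by simp; ring

lemma evalHol_apply (v : CSpace m × CSpace n) (l : CCotangent m n) :
    evalHol v l = (1 / 2) * (l v - I * l (I • v)) := rfl

lemma evalHol_adaptedCoord (p : Fin m → CSpace n) (a : Fin m ⊕ Fin n) (v : CSpace m × CSpace n) :
    evalHol v (adaptedCoord p a) = adaptedCoord p a v := by
  rw [evalHol_apply, adaptedCoord_smul]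
  linear_combination (-1 / 2) * adaptedCoord p a v * I_mul_I

lemma evalAntihol_apply (v : CSpace m × CSpace n) (l : CCotangent m n) :
    evalAntihol v l = (1 / 2) * (l v + I * l (I • v)) := rfl

lemma evalAntihol_adaptedCoord (p : Fin m → CSpace n) (a : Fin m ⊕ Fin n)
    (v : CSpace m × CSpace n) : evalAntihol v (adaptedCoord p a) = 0 := by
  rw [evalAntihol_apply, adaptedCoord_smul]
  linear_combination (1 / 2) * adaptedCoord p a v * I_mul_I

lemma evalHol_adaptedCoordBar (p : Fin m → CSpace n) (a : Fin m ⊕ Fin n)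
    (v : CSpace m × CSpace n) : evalHol v (adaptedCoordBar p a) = 0 := by
  rw [evalHol_apply, adaptedCoordBar_apply, adaptedCoordBar_apply, adaptedCoord_smul, map_mul, conj_I]
  linear_combination (1 / 2) * (starRingEnd ℂ) (adaptedCoord p a v) * I_mul_I

lemma evalAntihol_adaptedCoordBar (p : Fin m → CSpace n) (a : Fin m ⊕ Fin n)
    (v : CSpace m × CSpace n) :
    evalAntihol v (adaptedCoordBar p a) = (starRingEnd ℂ) (adaptedCoord p a v) := by
  rw [evalAntihol_apply, adaptedCoordBar_apply, adaptedCoordBar_apply, adaptedCoord_smul, map_mul, conj_I]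
  linear_combination (-1 / 2) * (starRingEnd ℂ) (adaptedCoord p a v) * I_mul_I

/-- The 2-form `i ∑ T(c_a, c_b) dc_a ∧ dc̄_b`. -/
def twoFormOf (T : CSpace m × CSpace n → CSpace m × CSpace n → ℂ) :
    Subalgebra.center ℂ (ExteriorAlgebra ℂ (CCotangent m n)) :=
  ∑ a : Fin m ⊕ Fin n, ∑ b : Fin m ⊕ Fin n, (I * T (coordVec a) (coordVec b)) •
    wedgeCenter _ (dCoord a) (dCoordBar b)

/-- The 2-form does not depend on the frame: the conjugate-linear second slot of T absorbs the
conjugated matrix with which the conjugate coframe transforms. -/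
lemma twoFormOf_eq {T : CSpace m × CSpace n → CSpace m × CSpace n → ℂ} (hT : IsHermitianForm T)
    (p : Fin m → CSpace n) :
    twoFormOf T = ∑ c, ∑ d, (I * T (adaptedVec p c) (adaptedVec p d)) •
      wedgeCenter _ (adaptedCoord p c) (adaptedCoordBar p d) := by
  have hsum (F : Fin m ⊕ Fin n → Fin m ⊕ Fin n → Fin m ⊕ Fin n → Fin m ⊕ Fin n →
      Subalgebra.center ℂ (ExteriorAlgebra ℂ (CCotangent m n))) :
      ∑ a, ∑ b, ∑ c, ∑ d, F a b c d = ∑ c, ∑ d, ∑ a, ∑ b, F a b c d := by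
    calc _ = ∑ a, ∑ c, ∑ b, ∑ d, F a b c d := Finset.sum_congr rfl fun _ _ => Finset.sum_comm
      _ = ∑ c, ∑ a, ∑ b, ∑ d, F a b c d := Finset.sum_comm
      _ = ∑ c, ∑ a, ∑ d, ∑ b, F a b c d :=
        Finset.sum_congr rfl fun _ _ => Finset.sum_congr rfl fun _ _ => Finset.sum_comm
      _ = _ := Finset.sum_congr rfl fun _ _ => Finset.sum_comm
  calc twoFormOf T = ∑ a, ∑ b, ∑ c, ∑ d, (I * (adaptedMatrix p c a *
        ((starRingEnd ℂ) (adaptedMatrix p d b) * T (coordVec a) (coordVec b)))) •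
          wedgeCenter _ (adaptedCoord p c) (adaptedCoordBar p d) := by
        refine Finset.sum_congr rfl fun a _ => Finset.sum_congr rfl fun b _ => ?_
        rw [dCoord_eq p a, dCoordBar_eq p b, bilin_sum_smul_sum_smul]
        simp only [Finset.smul_sum, smul_smul]
        refine Finset.sum_congr rfl fun c _ => Finset.sum_congr rfl fun d _ => ?_
        congr 1
        ring
    _ = _ := by
        rw [hsum]
        refine Finset.sum_congr rfl fun c _ => Finset.sum_congr rfl fun d _ => ?_
        simp only [← Finset.sum_smul, ← Finset.mul_sum]
        rw [adaptedVec_eq p c, adaptedVec_eq p d, hT.sum_smul_left]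
        simp only [hT.sum_smul_right]

/-- The WZW expression at a point vanishes if and only if the horizontal trace does. -/
theorem twoFormOf_pow_mul_eq_zero_iff
    {T : CSpace m × CSpace n → CSpace m × CSpace n → ℂ} (hT : IsHermitianForm T)
    (hC : Matrix.PosDef (Matrix.of fun μ ν : Fin n =>
      T (0, EuclideanSpace.single μ 1) (0, EuclideanSpace.single ν 1)))
    (p : Fin m → CSpace n)
    (hp : ∀ j w, T (EuclideanSpace.single j 1, p j) (0, w) = 0) :
    (twoFormOf T : ExteriorAlgebra ℂ (CCotangent m n)) ^ (n + 1) * baseForm m n ^ (m - 1) = 0 ↔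
      ∑ j, T (EuclideanSpace.single j 1, p j) (EuclideanSpace.single j 1, p j) = 0 := by
  set C : Matrix (Fin n) (Fin n) ℂ := Matrix.of fun μ ν : Fin n =>
      T (0, EuclideanSpace.single μ 1) (0, EuclideanSpace.single ν 1) with hCdef
  have hp' : ∀ j w, T (0, w) (EuclideanSpace.single j 1, p j) = 0 := fun j w => by
    rw [← hT.conj, hp, map_zero]
  -- Absorbing the vertical matrix C into the (1,0)-covectors writes the vertical block as a sum of
  -- n elements of square zero.
  set θ : Fin n → CCotangent m n := fun ν => ∑ μ, C μ ν • adaptedCoord p (.inr μ) with hθ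
  set e : Fin n → Subalgebra.center ℂ (ExteriorAlgebra ℂ (CCotangent m n)) :=
    fun ν => wedgeCenter _ (θ ν) (adaptedCoordBar p (.inr ν)) with he
  have h1 : twoFormOf T = ∑ j : Fin m, ∑ k : Fin m,
      (I * T (EuclideanSpace.single j 1, p j) (EuclideanSpace.single k 1, p k)) •
        wedgeCenter _ (dCoord (.inl j)) (dCoordBar (.inl k)) + I • ∑ ν, e ν := by
    rw [twoFormOf_eq hT p]
    simp only [Fintype.sum_sum_type, adaptedVec, hp, hp', mul_zero, zero_smul,
      Finset.sum_const_zero, add_zero, zero_add]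
    congr 1
    rw [Finset.sum_comm, Finset.smul_sum]
    refine Finset.sum_congr rfl fun ν _ => ?_
    simp only [he, hθ, map_sum, LinearMap.sum_apply, map_smul, LinearMap.smul_apply,
      Finset.smul_sum, smul_smul]
    rfl
  obtain ⟨c, hc, hmain⟩ := pow_mul_pow_eq_smul (fun j => dCoord (n := n) (.inl j))
    (fun j => dCoordBar (.inl j)) e (fun ν => wedgeCenter_sq _ _)
    (fun j k => T (EuclideanSpace.single j 1, p j) (EuclideanSpace.single k 1, p k))
  have hbase : baseForm m n = ((I • ∑ l : Fin m, wedgeCenter (CCotangent m n) (dCoord (.inl l))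
      (dCoordBar (.inl l)) : Subalgebra.center ℂ (ExteriorAlgebra ℂ (CCotangent m n))) :
        ExteriorAlgebra ℂ (CCotangent m n)) := by
    simp [baseForm, wedgeOne, coe_wedgeCenter]
  rw [← h1] at hmain
  have hne : (∏ l : Fin m, wedgeCenter (CCotangent m n) (dCoord (.inl l)) (dCoordBar (.inl l))) *
      ∏ ν, e ν ≠ 0 := by
    have hdet : IsUnit C.det := (Matrix.isUnit_iff_isUnit_det _).1 hC.isUnit
    have hinv := Matrix.nonsing_inv_mul C hdet
    -- Invertibility of C is used here: C⁻¹ supplies the vectors dual to θ, so the top form is not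
    -- zero.
    have hθ_eval (ν ν' : Fin n) : evalHol (∑ μ, C⁻¹ ν μ • adaptedVec p (.inr μ)) (θ ν') =
        (C⁻¹ * C) ν ν' := by
      simp only [hθ, map_sum, map_smul, evalHol_adaptedCoord, adaptedCoord_smul,
        adaptedCoord_adaptedVec, Matrix.mul_apply, smul_eq_mul]
      refine Finset.sum_congr rfl fun μ _ => ?_
      simp [mul_comm]
    have := prod_wedgeCenter_ne_zero (M := CCotangent m n) (ι := Fin m ⊕ Fin n)
      (Sum.elim (fun j => adaptedCoord p (.inl j)) θ) (adaptedCoordBar p)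
      (Sum.elim (fun j => evalHol (adaptedVec p (.inl j)))
        fun ν => evalHol (∑ μ, C⁻¹ ν μ • adaptedVec p (.inr μ)))
      (fun a => evalAntihol (adaptedVec p a)) ?_ ?_ ?_ ?_ ?_ ?_ Finset.univ
    · rw [Fintype.prod_sum_type] at this
      exact this
    · rintro (j | ν)
      · simp [evalHol_adaptedCoord, adaptedCoord_adaptedVec]
      · simp only [Sum.elim_inr, hθ_eval, hinv]
        simp
    · rintro (j | ν) (k | μ) hne
      · simpa [evalHol_adaptedCoord, adaptedCoord_adaptedVec] using fun h => hne (by rw [h])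
      · simp [hθ, map_sum, evalHol_adaptedCoord, adaptedCoord_adaptedVec]
      · simp [evalHol_adaptedCoord, adaptedCoord_adaptedVec, adaptedCoord_smul]
      · simp only [Sum.elim_inr, hθ_eval, hinv]
        exact Matrix.one_apply_ne fun h => hne (by rw [h])
    · rintro (j | ν) b
      · exact evalHol_adaptedCoordBar _ _ _
      · exact evalHol_adaptedCoordBar _ _ _
    · intro i
      simp [evalAntihol_adaptedCoordBar, adaptedCoord_adaptedVec]
    · intro i j hij
      simp [evalAntihol_adaptedCoordBar, adaptedCoord_adaptedVec, hij.symm]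
    · rintro i (j | ν)
      · exact evalAntihol_adaptedCoord p (.inl j) _
      · simp [hθ, evalAntihol_adaptedCoord]
  rw [hbase, ← SubmonoidClass.coe_pow, ← SubmonoidClass.coe_pow, ← MulMemClass.coe_mul, hmain,
    ZeroMemClass.coe_eq_zero, smul_eq_zero, mul_eq_zero]
  tauto

end AdaptedCoframe

/-! ### Orthogonal complements of the vertical space. -/

section Slopes

open Complex

variable {m n : ℕ} {T : CSpace m × CSpace n → CSpace m × CSpace n → ℂ}

lemma IsHermitianForm.vertical (hT : IsHermitianForm T) :
    IsHermitianForm fun v w : CSpace n => T (0, v) (0, w) :=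
  hT.comp (LinearMap.inr ℂ (CSpace m) (CSpace n))

/-- The vertical vectors have a complement orthogonal to them, given by slopes. -/
lemma exists_slopes (hT : IsHermitianForm T)
    (hC : Matrix.PosDef (Matrix.of fun μ ν : Fin n =>
      T (0, EuclideanSpace.single μ 1) (0, EuclideanSpace.single ν 1))) :
    ∃ p : Fin m → CSpace n, ∀ j w, T (EuclideanSpace.single j 1, p j) (0, w) = 0 := by
  set C : Matrix (Fin n) (Fin n) ℂ := Matrix.of fun μ ν : Fin n =>
      T (0, EuclideanSpace.single μ 1) (0, EuclideanSpace.single ν 1) with hCdef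
  have hdet : IsUnit C.det := (Matrix.isUnit_iff_isUnit_det _).1 hC.isUnit
  have hinv := Matrix.nonsing_inv_mul C hdet
  set B : Fin m → Fin n → ℂ := fun j ν =>
    T (EuclideanSpace.single j 1, 0) (0, EuclideanSpace.single ν 1) with hB
  -- Orthogonality to the vertical basis is the linear system p_j C = -B_j, with B_j the mixed block
  -- of T.
  refine ⟨fun j => -WithLp.toLp 2 (Matrix.vecMul (B j) C⁻¹), fun j w => ?_⟩
  set q := WithLp.toLp 2 (Matrix.vecMul (B j) C⁻¹) with hq
  have hsplit : ((EuclideanSpace.single j 1, -q) : CSpace m × CSpace n) =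
      (EuclideanSpace.single j 1, 0) + (-1 : ℂ) • (0, q) := by
    ext <;> simp
  have hw : ((0, w) : CSpace m × CSpace n) =
      ∑ ν, w ν • ((0, EuclideanSpace.single ν 1) : CSpace m × CSpace n) := by
    conv_lhs => rw [← sum_smul_single w]
    refine Prod.ext ?_ ?_ <;> simp [Prod.fst_sum, Prod.snd_sum]
  have hv : ((0, q) : CSpace m × CSpace n) =
      ∑ ν, q ν • ((0, EuclideanSpace.single ν 1) : CSpace m × CSpace n) := by
    conv_lhs => rw [← sum_smul_single q]
    refine Prod.ext ?_ ?_ <;> simp [Prod.fst_sum, Prod.snd_sum]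
  have hker (ν : Fin n) :
      T (EuclideanSpace.single j 1, -q) (0, EuclideanSpace.single ν 1) = 0 := by
    have h1 : ∑ μ, q μ * C μ ν = B j ν := by
      have h2 := congrFun (Matrix.vecMul_vecMul (B j) C⁻¹ C) ν
      rw [hinv, Matrix.vecMul_one] at h2
      exact h2
    rw [hsplit, hT.add_left, hT.smul_left, hv, hT.sum_smul_left]
    change B j ν + -1 * ∑ μ, q μ * C μ ν = 0
    rw [h1]; ring
  rw [hw, hT.sum_smul_right]
  exact Finset.sum_eq_zero fun ν _ => (congrArg _ (hker ν)).trans (mul_zero _)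

/-- Completing the square: the cross terms between the orthogonal lift and the vertical remainder
vanish. The scalar c is kept so that c = 0, a purely vertical vector, is included. -/
lemma IsHermitianForm.apply_smul_single_eq (hT : IsHermitianForm T) {p : Fin m → CSpace n}
    (hp : ∀ j w, T (EuclideanSpace.single j 1, p j) (0, w) = 0) (j : Fin m) (c : ℂ)
    (w : CSpace n) :
    T (c • EuclideanSpace.single j 1, w) (c • EuclideanSpace.single j 1, w) =
      c * (starRingEnd ℂ) c * T (EuclideanSpace.single j 1, p j) (EuclideanSpace.single j 1, p j) +
        T (0, w - c • p j) (0, w - c • p j) := by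
  have hsplit : ((c • EuclideanSpace.single j 1, w) : CSpace m × CSpace n) =
      c • (EuclideanSpace.single j 1, p j) + (0, w - c • p j) := by
    ext <;> simp
  have hp' : T (0, w - c • p j) (EuclideanSpace.single j 1, p j) = 0 := by
    rw [← hT.conj, hp, map_zero]
  rw [hsplit]
  simp only [hT.add_left, hT.add_right, hT.smul_left, hT.smul_right, hp, hp']
  ring

lemma IsHermitianForm.re_pos_of_posDef {Q : CSpace n → CSpace n → ℂ} (hQ : IsHermitianForm Q)
    (hC : Matrix.PosDef (Matrix.of fun μ ν : Fin n =>
      Q (EuclideanSpace.single μ 1) (EuclideanSpace.single ν 1))) {w : CSpace n} (hw : w ≠ 0) :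
    0 < (Q w w).re := by
  -- The coordinates are conjugated because Q is linear in its first slot, whereas the matrix
  -- quadratic form conjugates the first vector.
  have h := hC.dotProduct_mulVec_pos (x := fun μ => (starRingEnd ℂ) (w μ)) (by
    intro h
    apply hw
    ext μ
    simpa using congrFun h μ)
  have h2 : Q w w = star (fun μ => (starRingEnd ℂ) (w μ)) ⬝ᵥ (Matrix.of fun μ ν : Fin n =>
      Q (EuclideanSpace.single μ 1) (EuclideanSpace.single ν 1)).mulVec
        (fun μ => (starRingEnd ℂ) (w μ)) := by
    conv_lhs => rw [← sum_smul_single w, hQ.sum_smul_left]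
    simp only [hQ.sum_smul_right, dotProduct, Matrix.mulVec, Matrix.of_apply, Pi.star_apply]
    refine Finset.sum_congr rfl fun μ _ => ?_
    rw [← starRingEnd_apply, conj_conj]
    congr 1
    exact Finset.sum_congr rfl fun ν _ => mul_comm _ _
  rw [h2]
  exact (Complex.lt_def.1 h).1

lemma IsHermitianForm.re_nonneg_of_posDef {Q : CSpace n → CSpace n → ℂ} (hQ : IsHermitianForm Q)
    (hC : Matrix.PosDef (Matrix.of fun μ ν : Fin n =>
      Q (EuclideanSpace.single μ 1) (EuclideanSpace.single ν 1))) (w : CSpace n) :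
    0 ≤ (Q w w).re := by
  rcases eq_or_ne w 0 with rfl | hw
  · simp [hQ.zero_left]
  · exact (hQ.re_pos_of_posDef hC hw).le

end Slopes

/-! ### The functions u and u + ψ in charts, and their Hessians. -/

section Lift

open Complex Filter Topology Set

variable {m n : ℕ} {X : Type*} [TopologicalSpace X] [ChartedSpace (CSpace n) X]

/-- The function `u` in the chart at `x`. -/
def chartLift (u : CSpace m × X → ℝ) (x : X) (p : CSpace m × CSpace n) : ℝ :=
  u (p.1, (chartAt (CSpace n) x).symm p.2)

/-- The Hermitian form of `i∂∂̄u + π^*ω` at `(z, x)`. -/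
def totalHermitian (Ω : KaehlerForm n X) (u : CSpace m × X → ℝ) (z : CSpace m) (x : X)
    (a b : CSpace m × CSpace n) : ℂ :=
  complexHessian (chartLift u x) (z, chartAt (CSpace n) x x) a b + Ω.coeff x a.2 b.2

lemma totalForm_eq (Ω : KaehlerForm n X) (u : CSpace m × X → ℝ) (z : CSpace m) (x : X) :
    totalForm Ω u z x = (twoFormOf (totalHermitian Ω u z x) :
      ExteriorAlgebra ℂ (CCotangent m n)) := by
  simp only [totalForm, twoFormOf, AddSubmonoidClass.coe_finsetSum]
  rfl

lemma complexHessian_comp_snd {ψ : CSpace n → ℝ} {p : CSpace m × CSpace n}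
    (h : ContDiffAt ℝ 2 ψ p.2) (a b : CSpace m × CSpace n) :
    complexHessian (fun q : CSpace m × CSpace n => ψ q.2) p a b = complexHessian ψ p.2 a.2 b.2 := by
  have := complexHessian_comp (F := fun q : CSpace m × CSpace n => q.2) (p := p) h
    contDiffAt_snd a b
  rw [this, fderiv_snd]
  rfl

lemma complexHessian_comp_fst {ψ : CSpace m → ℝ} {p : CSpace m × CSpace n}
    (h : ContDiffAt ℝ 2 ψ p.1) (a b : CSpace m × CSpace n) :
    complexHessian (fun q : CSpace m × CSpace n => ψ q.1) p a b = complexHessian ψ p.1 a.1 b.1 := by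
  have := complexHessian_comp (F := fun q : CSpace m × CSpace n => q.1) (p := p) h
    contDiffAt_fst a b
  rw [this, fderiv_fst]
  rfl

lemma complexHessian_slice {φ : CSpace m × CSpace n → ℝ} {z : CSpace m} {y : CSpace n}
    (h : ContDiffAt ℝ 2 φ (z, y)) (v w : CSpace n) :
    complexHessian (fun y => φ (z, y)) y v w = complexHessian φ (z, y) (0, v) (0, w) := by
  have hF : HasFDerivAt (fun y : CSpace n => (z, y)) (ContinuousLinearMap.inr ℂ (CSpace m) (CSpace n))
      y := hasFDerivAt_prodMk_right z y
  have := complexHessian_comp (F := fun y : CSpace n => (z, y)) (p := y) h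
    (contDiffAt_const.prodMk contDiffAt_id) v w
  rw [this, hF.fderiv]
  rfl

variable [IsManifold 𝓘(ℂ, CSpace n) ω X] {D : Set (CSpace m)} {u : CSpace m × X → ℝ}

lemma contDiffAt_chartLift (hD : IsOpen D)
    (hu : ContMDiffOn (𝓘(ℝ, CSpace m).prod 𝓘(ℝ, CSpace n)) 𝓘(ℝ, ℝ) 2 u (D ×ˢ univ))
    (x : X) {z : CSpace m} (hz : z ∈ D) {y : CSpace n} (hy : y ∈ (chartAt (CSpace n) x).target) :
    ContDiffAt ℝ 2 (chartLift u x) (z, y) := by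
  have := isManifold_real n X
  have : IsManifold 𝓘(ℝ, CSpace n) 2 X := IsManifold.of_le (n := ω) le_top
  rw [← contMDiffAt_iff_contDiffAt]
  have h1 : ContMDiffAt (𝓘(ℝ, CSpace m).prod 𝓘(ℝ, CSpace n)) 𝓘(ℝ, ℝ) 2 u
      (z, (chartAt (CSpace n) x).symm y) :=
    hu.contMDiffAt ((hD.prod isOpen_univ).mem_nhds ⟨hz, mem_univ _⟩)
  have h2 : ContMDiffAt 𝓘(ℝ, CSpace m × CSpace n) 𝓘(ℝ, CSpace m) 2
      (fun p : CSpace m × CSpace n => p.1) (z, y) := contDiffAt_fst.contMDiffAt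
  have h3 : ContMDiffAt 𝓘(ℝ, CSpace m × CSpace n) 𝓘(ℝ, CSpace n) 2
      (fun p : CSpace m × CSpace n => p.2) (z, y) := contDiffAt_snd.contMDiffAt
  have h4 : ContMDiffAt 𝓘(ℝ, CSpace n) 𝓘(ℝ, CSpace n) 2 (chartAt (CSpace n) x).symm y :=
    (contMDiffOn_chart_symm (x := x)).contMDiffAt
      ((chartAt (CSpace n) x).open_target.mem_nhds hy)
  exact ContMDiffAt.comp (z, y) (g := u)
    (f := fun p : CSpace m × CSpace n => (p.1, (chartAt (CSpace n) x).symm p.2)) h1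
    (h2.prodMk (ContMDiffAt.comp (z, y) (f := fun p : CSpace m × CSpace n => p.2) h4 h3))

lemma isHermitianForm_totalHermitian (Ω : KaehlerForm n X) (hD : IsOpen D)
    (hu : ContMDiffOn (𝓘(ℝ, CSpace m).prod 𝓘(ℝ, CSpace n)) 𝓘(ℝ, ℝ) 2 u (D ×ˢ univ))
    {z : CSpace m} (hz : z ∈ D) (x : X) : IsHermitianForm (totalHermitian Ω u z x) :=
  (isHermitianForm_complexHessian
    (contDiffAt_chartLift hD hu x hz (mem_chart_target _ x))).add
    ((isHermitianForm_coeff Ω x).comp (LinearMap.snd ℂ (CSpace m) (CSpace n)))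

lemma IsPositiveAt.posDef {Ω : KaehlerForm n X} (hD : IsOpen D)
    (hu : ContMDiffOn (𝓘(ℝ, CSpace m).prod 𝓘(ℝ, CSpace n)) 𝓘(ℝ, ℝ) 2 u (D ×ˢ univ))
    {z : CSpace m} (hz : z ∈ D) {x : X} (hpos : IsPositiveAt Ω u z x) :
    Matrix.PosDef (Matrix.of fun μ ν : Fin n => totalHermitian Ω u z x
      (0, EuclideanSpace.single μ 1) (0, EuclideanSpace.single ν 1)) := by
  have h := contDiffAt_chartLift hD hu x hz (mem_chart_target _ x)
  unfold IsPositiveAt at hpos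
  convert hpos using 4 with μ ν
  rw [totalHermitian, ← complexHessian_slice h, add_comm]
  rfl

variable {Ω : KaehlerForm n X} {ψ : X → ℝ} {O : Set X}

lemma KaehlerForm.IsPotentialOn.contDiffAt_chart (hψ : Ω.IsPotentialOn ψ O) (x : X)
    {y : CSpace n} (hy : y ∈ (chartAt (CSpace n) x).target)
    (hO : (chartAt (CSpace n) x).symm y ∈ O) :
    ContDiffAt ℝ 2 (fun y => ψ ((chartAt (CSpace n) x).symm y)) y := by
  have := isManifold_real n X
  have : IsManifold 𝓘(ℝ, CSpace n) 2 X := IsManifold.of_le (n := ω) le_top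
  rw [← contMDiffAt_iff_contDiffAt]
  exact ContMDiffAt.comp y (hψ.2.1.contMDiffAt (hψ.1.mem_nhds hO))
    ((contMDiffOn_chart_symm (x := x)).contMDiffAt ((chartAt (CSpace n) x).open_target.mem_nhds hy))

/-- The complex Hessian of a potential in any chart is given by the Kähler form. -/
lemma KaehlerForm.IsPotentialOn.complexHessian_chart (hψ : Ω.IsPotentialOn ψ O) (x : X)
    {y : CSpace n} (hy : y ∈ (chartAt (CSpace n) x).target)
    (hO : (chartAt (CSpace n) x).symm y ∈ O) (v w : CSpace n) :
    complexHessian (fun y => ψ ((chartAt (CSpace n) x).symm y)) y v w =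
      hermitianOfForm (formInChart Ω.form x y) v w := by
  rw [hermitianOfForm_formInChart Ω x hy]
  set x' := (chartAt (CSpace n) x).symm y with hx'
  have hs := mem_chart_source (CSpace n) x'
  have hback : (chartAt (CSpace n) x').symm (chartAt (CSpace n) x' x') = x' :=
    (chartAt (CSpace n) x').left_inv hs
  have ht := contDiffAt_transition x x' hy hs
  have h1 := hψ.contDiffAt_chart x' (mem_chart_target (CSpace n) x') (by rw [hback]; exact hO)
  have h2 := complexHessian_comp
    (F := fun y => chartAt (CSpace n) x' ((chartAt (CSpace n) x).symm y)) h1 ht v w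
  rw [hψ.2.2 x' hO] at h2
  rw [← h2]
  apply complexHessian_congr
  have hc : ∀ᶠ q in 𝓝 y, (chartAt (CSpace n) x).symm q ∈ (chartAt (CSpace n) x').source :=
    ((chartAt (CSpace n) x).continuousAt_symm hy).preimage_mem_nhds
      ((chartAt (CSpace n) x').open_source.mem_nhds hs)
  filter_upwards [hc] with q hq
  rw [(chartAt (CSpace n) x').left_inv hq]

/-- The function `u + ψ` in the chart at `x`. -/
def potentialLift (u : CSpace m × X → ℝ) (ψ : X → ℝ) (x : X) (p : CSpace m × CSpace n) : ℝ :=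
  chartLift u x p + ψ ((chartAt (CSpace n) x).symm p.2)

lemma contDiffAt_potentialLift (hD : IsOpen D)
    (hu : ContMDiffOn (𝓘(ℝ, CSpace m).prod 𝓘(ℝ, CSpace n)) 𝓘(ℝ, ℝ) 2 u (D ×ˢ univ))
    (hψ : Ω.IsPotentialOn ψ O) (x : X) {z : CSpace m} (hz : z ∈ D) {y : CSpace n}
    (hy : y ∈ (chartAt (CSpace n) x).target) (hO : (chartAt (CSpace n) x).symm y ∈ O) :
    ContDiffAt ℝ 2 (potentialLift u ψ x) (z, y) :=
  (contDiffAt_chartLift hD hu x hz hy).add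
    (ContDiffAt.comp (g := fun y => ψ ((chartAt (CSpace n) x).symm y)) (z, y)
      (hψ.contDiffAt_chart x hy hO) contDiffAt_snd)

lemma complexHessian_potentialLift (hD : IsOpen D)
    (hu : ContMDiffOn (𝓘(ℝ, CSpace m).prod 𝓘(ℝ, CSpace n)) 𝓘(ℝ, ℝ) 2 u (D ×ˢ univ))
    (hψ : Ω.IsPotentialOn ψ O) (x : X) {z : CSpace m} (hz : z ∈ D) {y : CSpace n}
    (hy : y ∈ (chartAt (CSpace n) x).target) (hO : (chartAt (CSpace n) x).symm y ∈ O)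
    (a b : CSpace m × CSpace n) :
    complexHessian (potentialLift u ψ x) (z, y) a b =
      complexHessian (chartLift u x) (z, y) a b +
        hermitianOfForm (formInChart Ω.form x y) a.2 b.2 := by
  have h2 := hψ.contDiffAt_chart x hy hO
  rw [← hψ.complexHessian_chart x hy hO,
    ← complexHessian_comp_snd (ψ := fun y => ψ ((chartAt (CSpace n) x).symm y)) (p := (z, y)) h2]
  exact complexHessian_add (contDiffAt_chartLift hD hu x hz hy)
    (ContDiffAt.comp (g := fun y => ψ ((chartAt (CSpace n) x).symm y)) (z, y) h2 contDiffAt_snd) a b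

lemma complexHessian_potentialLift_self (hD : IsOpen D)
    (hu : ContMDiffOn (𝓘(ℝ, CSpace m).prod 𝓘(ℝ, CSpace n)) 𝓘(ℝ, ℝ) 2 u (D ×ˢ univ))
    (hψ : Ω.IsPotentialOn ψ O) {x : X} {z : CSpace m} (hz : z ∈ D) (hO : x ∈ O)
    (a b : CSpace m × CSpace n) :
    complexHessian (potentialLift u ψ x) (z, chartAt (CSpace n) x x) a b =
      totalHermitian Ω u z x a b := by
  have hback : (chartAt (CSpace n) x).symm (chartAt (CSpace n) x x) = x :=
    (chartAt (CSpace n) x).left_inv (mem_chart_source _ x)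
  have hO' : (chartAt (CSpace n) x).symm (chartAt (CSpace n) x x) ∈ O := by rwa [hback]
  rw [complexHessian_potentialLift hD hu hψ x hz (mem_chart_target _ x) hO',
    ← hψ.complexHessian_chart x (mem_chart_target _ x) hO', hψ.2.2 x hO, totalHermitian]

end Lift

/-! ### Touching functions along holomorphic graphs. -/

section Graphs

open Complex Filter Topology Set

variable {m n : ℕ} {X : Type*} [TopologicalSpace X] [ChartedSpace (CSpace n) X]
  [IsManifold 𝓘(ℂ, CSpace n) ω X]

/-- Holomorphic maps are `C²` along complex lines. -/
lemma contDiffAt_chart_comp_line {W : Set (CSpace m)} {f : CSpace m → X} (hW : IsOpen W)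
    (hf : MDifferentiableOn 𝓘(ℂ, CSpace m) 𝓘(ℂ, CSpace n) f W) {z : CSpace m} (hz : z ∈ W) (x : X)
    (hx : f z ∈ (chartAt (CSpace n) x).source) (v : CSpace m) :
    ContDiffAt ℂ 2 (fun ζ : ℂ => chartAt (CSpace n) x (f (z + ζ • v))) 0 := by
  have : IsManifold 𝓘(ℂ, CSpace n) 1 X := IsManifold.of_le (n := ω) le_top
  have hl : Continuous fun ζ : ℂ => z + ζ • v := by fun_prop
  have hO : IsOpen (W ∩ f ⁻¹' (chartAt (CSpace n) x).source) :=
    hf.continuousOn.isOpen_inter_preimage hW (chartAt (CSpace n) x).open_source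
  have hS : IsOpen ((fun ζ : ℂ => z + ζ • v) ⁻¹' (W ∩ f ⁻¹' (chartAt (CSpace n) x).source)) :=
    hO.preimage hl
  have h0 : (0 : ℂ) ∈ (fun ζ : ℂ => z + ζ • v) ⁻¹' (W ∩ f ⁻¹' (chartAt (CSpace n) x).source) := by
    simpa using ⟨hz, hx⟩
  have hd : DifferentiableOn ℂ (fun ζ : ℂ => chartAt (CSpace n) x (f (z + ζ • v)))
      ((fun ζ : ℂ => z + ζ • v) ⁻¹' (W ∩ f ⁻¹' (chartAt (CSpace n) x).source)) := by
    rw [← mdifferentiableOn_iff_differentiableOn]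
    have hl' : MDifferentiableOn 𝓘(ℂ, ℂ) 𝓘(ℂ, CSpace m) (fun ζ : ℂ => z + ζ • v)
        ((fun ζ : ℂ => z + ζ • v) ⁻¹' (W ∩ f ⁻¹' (chartAt (CSpace n) x).source)) := by
      rw [mdifferentiableOn_iff_differentiableOn]
      fun_prop
    have hfl := hf.comp hl' fun ζ hζ => hζ.1
    exact (mdifferentiableOn_atlas (chart_mem_atlas (CSpace n) x)).comp hfl fun ζ hζ => hζ.2
  -- Restricting to a complex line reduces regularity to one variable, where differentiability on an
  -- open set gives analyticity.
  exact (hd.analyticAt (hS.mem_nhds h0)).contDiffAt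

/-- A function which lies above a `C²` function along a holomorphic graph, with equality at a
point, has there at least the Levi trace along some lift of the coordinate directions. -/
lemma exists_sum_complexHessian_le_leviTrace {W : Set (CSpace m)} {f : CSpace m → X}
    (hW : IsOpen W) (hf : MDifferentiableOn 𝓘(ℂ, CSpace m) 𝓘(ℂ, CSpace n) f W) {z : CSpace m}
    (hz : z ∈ W) (x : X) (hx : f z ∈ (chartAt (CSpace n) x).source)
    {Φ : CSpace m × CSpace n → ℝ} (hΦ : ContDiffAt ℝ 2 Φ (z, chartAt (CSpace n) x (f z)))
    {G : CSpace m → ℝ} (hG : ContDiffAt ℝ 2 G z)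
    (hle : ∀ᶠ w in 𝓝 z, Φ (w, chartAt (CSpace n) x (f w)) ≤ G w)
    (heq : Φ (z, chartAt (CSpace n) x (f z)) = G z) :
    ∃ w : Fin m → CSpace n, ∑ j, (complexHessian Φ (z, chartAt (CSpace n) x (f z))
      (EuclideanSpace.single j 1, w j) (EuclideanSpace.single j 1, w j)).re ≤ leviTrace G z := by
  -- The lifts are the derivatives of the graph itself in the coordinate directions, read in the
  -- chart.
  refine ⟨fun j => fderiv ℂ (fun ζ : ℂ => chartAt (CSpace n) x
    (f (z + ζ • EuclideanSpace.single j 1))) 0 1, Finset.sum_le_sum fun j _ => ?_⟩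
  set v : CSpace m := EuclideanSpace.single j 1
  have h1 := contDiffAt_chart_comp_line hW hf hz x hx v
  set γ : ℂ → CSpace n := fun ζ => chartAt (CSpace n) x (f (z + ζ • v)) with hγ
  set F : ℂ → CSpace m × CSpace n := fun ζ => (z + ζ • v, γ ζ) with hF
  have hF0 : F 0 = (z, chartAt (CSpace n) x (f z)) := by simp [hF, hγ]
  have hl : ContDiffAt ℂ 2 (fun ζ : ℂ => z + ζ • v) 0 := by fun_prop
  have hFc : ContDiffAt ℂ 2 F 0 := hl.prodMk h1
  have hld : HasFDerivAt (fun ζ : ℂ => z + ζ • v) ((ContinuousLinearMap.id ℂ ℂ).smulRight v) 0 :=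
    ((ContinuousLinearMap.id ℂ ℂ).smulRight v).hasFDerivAt.const_add z
  have hFd : HasFDerivAt F (((ContinuousLinearMap.id ℂ ℂ).smulRight v).prod (fderiv ℂ γ 0)) 0 :=
    hld.prodMk (h1.differentiableAt (by norm_num)).hasFDerivAt
  have hΦ' : ContDiffAt ℝ 2 Φ (F 0) := by rwa [hF0]
  have h2 := complexHessian_comp hΦ' hFc 1 1
  have h3 : fderiv ℂ F 0 1 = (v, fderiv ℂ γ 0 1) := by rw [hFd.fderiv]; simp
  rw [h3, hF0] at h2
  rw [← h2]
  refine complexHessian_re_le_of_touch v (hΦ'.comp 0 (hFc.restrict_scalars ℝ)) hG ?_ ?_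
  · have hc : Tendsto (fun ζ : ℂ => z + ζ • v) (𝓝 0) (𝓝 z) := by
      simpa using hl.continuousAt.tendsto
    exact hc.eventually hle
  · rw [hF0, heq]

variable {Ω : KaehlerForm n X} {D : Set (CSpace m)} {u : CSpace m × X → ℝ}

/-- A function that is subharmonic on graphs and touched from above by `G + u` at a point, along
all of `X`, forces the trace of the Hessian of `G + u` along any slopes to be nonnegative. -/
lemma leviTrace_add_sum_nonneg (hD : IsOpen D)
    (hu : ContMDiffOn (𝓘(ℝ, CSpace m).prod 𝓘(ℝ, CSpace n)) 𝓘(ℝ, ℝ) 2 u (D ×ˢ univ))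
    {U : Set (CSpace m)} (hU : IsOpen U) (hUD : U ⊆ D) {v : CSpace m × X → EReal}
    (hv : IsSubharmonicOnGraphs Ω U v) {z : CSpace m} (hz : z ∈ U) {x : X} {G : CSpace m → ℝ}
    (hG : ContDiffAt ℝ 2 G z)
    (hle : ∀ᶠ w in 𝓝 z, ∀ y, v (w, y) ≤ ((G w + u (w, y) : ℝ) : EReal))
    (heq : v (z, x) = ((G z + u (z, x) : ℝ) : EReal)) (p : Fin m → CSpace n) :
    0 ≤ leviTrace G z + ∑ j, (totalHermitian Ω u z x (EuclideanSpace.single j 1, p j)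
      (EuclideanSpace.single j 1, p j)).re := by
  obtain ⟨O, ψ, hxO, hψ⟩ := Ω.exists_isPotentialOn x
  have : IsManifold 𝓘(ℂ, CSpace n) 1 X := IsManifold.of_le (n := ω) le_top
  set e := chartAt (CSpace n) x with he
  have hback : e.symm (e x) = x := e.left_inv (mem_chart_source _ x)
  -- The test graph is affine in the chart, passes through (z, x), and has the prescribed slopes.
  set A : CSpace m →L[ℂ] CSpace n := ∑ j, (EuclideanSpace.proj j : CSpace m →L[ℂ] ℂ).smulRight (p j)
    with hA
  have hAj (j : Fin m) : A (EuclideanSpace.single j 1) = p j := by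
    simp [hA]
  set g : CSpace m → CSpace n := fun w => e x + A (w - z) with hg
  have hgz : g z = e x := by simp [hg]
  have hgc : Continuous g := by fun_prop
  set f : CSpace m → X := fun w => e.symm (g w) with hf
  have hfz : f z = x := by simp only [hf, hgz, hback]
  have hWo : IsOpen (U ∩ g ⁻¹' e.target) := hU.inter (e.open_target.preimage hgc)
  have hfd : MDifferentiableOn 𝓘(ℂ, CSpace m) 𝓘(ℂ, CSpace n) f (U ∩ g ⁻¹' e.target) := by
    have h1 : MDifferentiableOn 𝓘(ℂ, CSpace m) 𝓘(ℂ, CSpace n) g (U ∩ g ⁻¹' e.target) := by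
      rw [mdifferentiableOn_iff_differentiableOn]
      fun_prop
    exact (mdifferentiableOn_atlas_symm (chart_mem_atlas (CSpace n) x)).comp h1 fun w hw => hw.2
  have hsub := hv.2.2 _ f hWo inter_subset_left hfd O ψ hψ
  have hO' := hfd.continuousOn.isOpen_inter_preimage hWo hψ.1
  have hgt : g z ∈ e.target := by rw [hgz]; exact mem_chart_target (CSpace n) x
  have hzW : z ∈ (U ∩ g ⁻¹' e.target) ∩ f ⁻¹' O := ⟨⟨hz, hgt⟩, by rw [mem_preimage, hfz]; exact hxO⟩
  have hvis := hsub.isViscositySubharmonicAt hO' hzW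
  set Φ := potentialLift (n := n) u ψ x with hΦ
  have hΦc : ContDiffAt ℝ 2 Φ (z, g z) := by
    rw [hgz]
    exact contDiffAt_potentialLift hD hu hψ x (hUD hz) (mem_chart_target (CSpace n) x)
      (by rw [← he, hback]; exact hxO)
  set F : CSpace m → CSpace m × CSpace n := fun w => (w, g w) with hF
  have hFd : HasFDerivAt F ((ContinuousLinearMap.id ℂ (CSpace m)).prod A) z := by
    refine (hasFDerivAt_id z).prodMk ?_
    have := (A.hasFDerivAt (x := z)).const_add (e x - A z)
    refine this.congr_of_eventuallyEq (Eventually.of_forall fun w => ?_)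
    simp only [hg, map_sub]
    abel
  have hFc : ContDiffAt ℂ 2 F z := by
    refine contDiffAt_id.prodMk ?_
    have : ContDiff ℂ 2 g := by fun_prop
    exact this.contDiffAt
  have hGF : ContDiffAt ℝ 2 (fun w => Φ (F w)) z :=
    ContDiffAt.comp z (g := Φ) (f := F) hΦc (hFc.restrict_scalars ℝ)
  -- Since v ≤ G + u near z, the function G + (u + ψ) along the graph touches ψ(f) + v(·, f) from
  -- above at z.
  have h0 := hvis (fun w => G w + Φ (F w)) (hG.add hGF) ?_ ?_
  · rw [leviTrace_add hG hGF] at h0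
    refine h0.trans_eq (congrArg _ (Finset.sum_congr rfl fun j _ => ?_))
    have h4 : fderiv ℂ F z (EuclideanSpace.single j 1) = (EuclideanSpace.single j 1, p j) := by
      rw [hFd.fderiv]; simp [hAj]
    rw [complexHessian_comp (F := F) hΦc hFc, h4, hF]
    simp only [hgz]
    rw [complexHessian_potentialLift_self hD hu hψ (hUD hz) hxO]
  · filter_upwards [hle] with w hw
    have h5 := hw (f w)
    have h6 : G w + Φ (F w) = ψ (f w) + (G w + u (w, f w)) := by
      simp only [hΦ, hF, potentialLift, chartLift, hf, he]; ring
    rw [h6, EReal.coe_add]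
    gcongr
  · have h6 : G z + Φ (F z) = ψ (f z) + (G z + u (z, f z)) := by
      simp only [hΦ, hF, potentialLift, chartLift, hf, he]; ring
    change (ψ (f z) : EReal) + v (z, f z) = _
    rw [h6, EReal.coe_add, hfz, heq]

/-- Real continuous functions are subharmonic on graphs if they are so in the viscosity sense. -/
lemma isSubharmonicOnGraphs_of_viscosity (hm : 1 ≤ m) {U : Set (CSpace m)} {v : CSpace m × X → ℝ}
    (hvc : ContinuousOn v (U ×ˢ univ))
    (H : ∀ (W : Set (CSpace m)) (f : CSpace m → X), IsOpen W → W ⊆ U →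
      MDifferentiableOn 𝓘(ℂ, CSpace m) 𝓘(ℂ, CSpace n) f W →
      ∀ (O : Set X) (ψ : X → ℝ), Ω.IsPotentialOn ψ O → ∀ z ∈ W, f z ∈ O → ∀ G : CSpace m → ℝ,
        ContDiffAt ℝ 2 G z → (∀ᶠ w in 𝓝 z, ψ (f w) + v (w, f w) ≤ G w) →
        ψ (f z) + v (z, f z) = G z → 0 ≤ leviTrace G z) :
    IsSubharmonicOnGraphs Ω U (fun p => (v p : EReal)) := by
  refine ⟨(continuous_coe_real_ereal.comp_continuousOn hvc).upperSemicontinuousOn,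
    fun p _ => EReal.coe_lt_top _, fun W f hW hWU hf O ψ hψ => ?_⟩
  refine isSubharmonicOn_of_viscosity hm ?_ (fun z _ => ?_) fun z hz => ?_
  · refine ContinuousOn.upperSemicontinuousOn ?_
    have h1 : ContinuousOn (fun z => ψ (f z) + v (z, f z)) (W ∩ f ⁻¹' O) := by
      refine (hψ.2.1.continuousOn.comp (hf.continuousOn.mono inter_subset_left)
        fun z hz => hz.2).add (hvc.comp (continuousOn_id.prodMk
          (hf.continuousOn.mono inter_subset_left)) fun z hz => ⟨hWU hz.1, mem_univ _⟩)
    exact continuous_coe_real_ereal.comp_continuousOn h1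
  · exact EReal.add_lt_top (EReal.coe_ne_top _) (EReal.coe_ne_top _)
  · intro G hG hle heq
    refine H W f hW hWU hf O ψ hψ z hz.1 hz.2 G hG ?_ ?_
    · filter_upwards [hle] with w hw
      exact_mod_cast hw
    · have h : ((ψ (f z) + v (z, f z) : ℝ) : EReal) = G z := by rw [EReal.coe_add]; exact heq
      exact_mod_cast h

end Graphs

/-! ### From the sign of the trace to sub- and superharmonicity on graphs. -/

section HarmonicOfWZW

open Complex Filter Topology Set

variable {m n : ℕ} {X : Type*} [TopologicalSpace X] [ChartedSpace (CSpace n) X]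
  [IsManifold 𝓘(ℂ, CSpace n) ω X]
  {Ω : KaehlerForm n X} {D : Set (CSpace m)} {u : CSpace m × X → ℝ}

/-- The trace of the Hessian over the slopes is minimal for the orthogonal slopes. -/
lemma sum_totalHermitian_le (hD : IsOpen D)
    (hu : ContMDiffOn (𝓘(ℝ, CSpace m).prod 𝓘(ℝ, CSpace n)) 𝓘(ℝ, ℝ) 2 u (D ×ˢ univ))
    {z : CSpace m} (hz : z ∈ D) {x : X} (hpos : IsPositiveAt Ω u z x) {p : Fin m → CSpace n}
    (hp : ∀ j w, totalHermitian Ω u z x (EuclideanSpace.single j 1, p j) (0, w) = 0)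
    (q : Fin m → CSpace n) :
    ∑ j, (totalHermitian Ω u z x (EuclideanSpace.single j 1, p j)
        (EuclideanSpace.single j 1, p j)).re ≤
      ∑ j, (totalHermitian Ω u z x (EuclideanSpace.single j 1, q j)
        (EuclideanSpace.single j 1, q j)).re := by
  have hT := isHermitianForm_totalHermitian Ω hD hu hz x
  refine Finset.sum_le_sum fun j _ => ?_
  have h := hT.apply_smul_single_eq hp j 1 (q j)
  simp only [one_smul, map_one, one_mul] at h
  rw [h, add_re]
  have := hT.vertical.re_nonneg_of_posDef (hpos.posDef hD hu hz) (q j - p j)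
  linarith

/-- The trace of a function touching ψ(f) + u(·, f) from above is at least the trace of the
Hermitian form over the slopes of f. -/
lemma isSubharmonicOnGraphs_of_trace_nonneg (hm : 1 ≤ m) (hD : IsOpen D)
    (hu : ContMDiffOn (𝓘(ℝ, CSpace m).prod 𝓘(ℝ, CSpace n)) 𝓘(ℝ, ℝ) 2 u (D ×ˢ univ))
    (H : ∀ z ∈ D, ∀ (x : X) (q : Fin m → CSpace n), 0 ≤ ∑ j, (totalHermitian Ω u z x
      (EuclideanSpace.single j 1, q j) (EuclideanSpace.single j 1, q j)).re) :
    IsSubharmonicOnGraphs Ω D (fun p => (u p : EReal)) := by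
  refine isSubharmonicOnGraphs_of_viscosity hm hu.continuousOn
    fun W f hW hWD hf O ψ hψ z hz hzO G hG hle heq => ?_
  set e := chartAt (CSpace n) (f z) with he
  have hback : e.symm (e (f z)) = f z := e.left_inv (mem_chart_source _ _)
  have hΦ : ∀ w, f w ∈ e.source → potentialLift u ψ (f z) (w, e (f w)) = ψ (f w) + u (w, f w) := by
    intro w hw
    simp only [potentialLift, chartLift]
    rw [← he, e.left_inv hw, add_comm]
  have hΦc := contDiffAt_potentialLift hD hu hψ (f z) (hWD hz) (mem_chart_target (CSpace n) (f z))
      (by rw [← he, hback]; exact hzO)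
  have hc : ∀ᶠ w in 𝓝 z, f w ∈ e.source :=
    (hf.continuousOn.continuousAt (hW.mem_nhds hz)).preimage_mem_nhds
      (e.open_source.mem_nhds (mem_chart_source (CSpace n) (f z)))
  have hle' : ∀ᶠ w in 𝓝 z, potentialLift u ψ (f z) (w, e (f w)) ≤ G w := by
    filter_upwards [hle, hc] with w hw hw'
    exact (hΦ w hw').trans_le hw
  obtain ⟨w, hw⟩ := exists_sum_complexHessian_le_leviTrace hW hf hz (f z)
    (mem_chart_source _ _) hΦc hG hle' ((hΦ z (mem_chart_source _ _)).trans heq)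
  refine le_trans ?_ hw
  simp only [complexHessian_potentialLift_self hD hu hψ (hWD hz) hzO]
  exact H z (hWD hz) (f z) w

variable [CompactSpace X]

/-- Compactness of X makes the supremum attained, so a function touching it from above touches v - u
at an actual point. Testing v on a graph with the slopes q through that point transfers the
inequality to the touching function. -/
lemma isSuperharmonicOnGraphs_of_trace_nonpos (hm : 1 ≤ m) (hD : IsOpen D)
    (hu : ContMDiffOn (𝓘(ℝ, CSpace m).prod 𝓘(ℝ, CSpace n)) 𝓘(ℝ, ℝ) 2 u (D ×ˢ univ))
    (H : ∀ z ∈ D, ∀ x : X, ∃ q : Fin m → CSpace n, ∑ j, (totalHermitian Ω u z x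
      (EuclideanSpace.single j 1, q j) (EuclideanSpace.single j 1, q j)).re ≤ 0) :
    IsSuperharmonicOnGraphs Ω D (fun p => (u p : EReal)) := by
  refine ⟨(continuous_coe_real_ereal.comp_continuousOn hu.continuousOn).lowerSemicontinuousOn,
    fun p _ => EReal.bot_lt_coe _, fun U v hU hUD hv => ?_⟩
  have husc : UpperSemicontinuousOn (fun p => v p - (u p : EReal)) (U ×ˢ univ) := by
    have h1 : UpperSemicontinuousOn (fun p => ((-u p : ℝ) : EReal)) (U ×ˢ univ) :=
      (continuous_coe_real_ereal.comp_continuousOn (hu.continuousOn.neg.mono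
        (prod_mono hUD subset_rfl))).upperSemicontinuousOn
    refine UpperSemicontinuousOn.add' hv.1 h1 fun p hp => ?_
    exact EReal.continuousAt_add (Or.inr (EReal.coe_ne_bot _)) (Or.inr (EReal.coe_ne_top _))
  have hmax (hX : Nonempty X) (z : CSpace m) (hz : z ∈ U) :
      ∃ x, ⨆ y : X, (v (z, y) - (u (z, y) : EReal)) = v (z, x) - (u (z, x) : EReal) := by
    have h1 : UpperSemicontinuousOn (fun x : X => v (z, x) - (u (z, x) : EReal)) univ :=
      husc.comp (by fun_prop : Continuous fun x : X => (z, x)).continuousOn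
        fun x _ => ⟨hz, mem_univ _⟩
    obtain ⟨x, -, hx⟩ := h1.exists_isMaxOn univ_nonempty isCompact_univ
    exact ⟨x, le_antisymm (iSup_le fun y => hx (mem_univ y))
      (le_iSup (fun y : X => v (z, y) - (u (z, y) : EReal)) x)⟩
  have htop : ∀ z ∈ U, ⨆ y : X, (v (z, y) - (u (z, y) : EReal)) < ⊤ := by
    intro z hz
    rcases isEmpty_or_nonempty X with hX | hX
    · simp
    · obtain ⟨x, hx⟩ := hmax hX z hz
      rw [hx, sub_eq_add_neg, ← EReal.coe_neg]
      exact EReal.add_lt_top (hv.2.1 (z, x) ⟨hz, mem_univ _⟩).ne (EReal.coe_ne_top _)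
  refine isSubharmonicOn_of_viscosity hm (fun z hz a ha => ?_) htop fun z hz G hG hle heq => ?_
  · obtain ⟨b, hb, hba⟩ := exists_between ha
    -- Tube argument: over compact X the pointwise upper semicontinuity bounds hold uniformly for
    -- nearby w, giving semicontinuity of the supremum.
    have h1 := isCompact_univ.eventually_forall_of_forall_eventually (x₀ := z) (K := (univ : Set X))
      (P := fun w x => v (w, x) - (u (w, x) : EReal) < b) fun x _ => by
        have := husc (z, x) ⟨hz, mem_univ _⟩ b
          ((le_iSup (fun y : X => v (z, y) - (u (z, y) : EReal)) x).trans_lt hb)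
        rwa [(hU.prod isOpen_univ).nhdsWithin_eq (⟨hz, mem_univ _⟩ : (z, x) ∈ U ×ˢ univ)] at this
    filter_upwards [nhdsWithin_le_nhds h1] with w hw
    exact (iSup_le fun y => (hw y (mem_univ y)).le).trans_lt hba
  -- If X is empty the supremum is -∞ and no real function touches it.
  · have hX : Nonempty X := by
      by_contra hX
      rw [not_nonempty_iff] at hX
      simp at heq
    obtain ⟨x, hx⟩ := hmax hX z hz
    obtain ⟨q, hq⟩ := H z (hUD hz) x
    rw [hx] at heq
    have hcancel : v (z, x) = ((G z + u (z, x) : ℝ) : EReal) := by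
      rw [EReal.coe_add, ← heq, EReal.sub_add_cancel]
    have h1 := leviTrace_add_sum_nonneg hD hu hU hUD hv hz hG ?_ hcancel q
    · linarith
    · filter_upwards [hle] with w hw y
      rw [EReal.coe_add]
      exact EReal.sub_le_iff_le_add (Or.inl (EReal.coe_ne_bot _)) (Or.inl (EReal.coe_ne_top _)) |>.1
        ((le_iSup (fun y : X => v (w, y) - (u (w, y) : EReal)) y).trans hw)

end HarmonicOfWZW

/-! ### Positivity of the trace over all lifts is stable. -/

section Positivity

open Complex Filter Topology Set

variable {m n : ℕ}

/-- The sum of a complex Hessian over the lifts `(s e_j, w_j)` of multiples of the coordinate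
directions. -/
def liftTrace (Φ : CSpace m × CSpace n → ℝ) (p : CSpace m × CSpace n)
    (a : ℝ × (Fin m → CSpace n)) : ℝ :=
  ∑ j, (complexHessian Φ p ((a.1 : ℂ) • EuclideanSpace.single j 1, a.2 j)
    ((a.1 : ℂ) • EuclideanSpace.single j 1, a.2 j)).re

lemma continuousAt_liftTrace {Φ : CSpace m × CSpace n → ℝ} {p : CSpace m × CSpace n}
    (hΦ : ContDiffAt ℝ 2 Φ p) (a : ℝ × (Fin m → CSpace n)) :
    ContinuousAt (fun q : (CSpace m × CSpace n) × (ℝ × (Fin m → CSpace n)) =>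
      liftTrace Φ q.1 q.2) (p, a) := by
  unfold liftTrace
  refine tendsto_finsetSum _ fun j _ => ?_
  have h1 := continuousAt_complexHessian hΦ
    ((a.1 : ℂ) • (EuclideanSpace.single j 1 : CSpace m), a.2 j)
    ((a.1 : ℂ) • (EuclideanSpace.single j 1 : CSpace m), a.2 j)
  set F := fun q : (CSpace m × CSpace n) × (ℝ × (Fin m → CSpace n)) =>
      (q.1, ((q.2.1 : ℂ) • (EuclideanSpace.single j 1 : CSpace m), q.2.2 j),
        ((q.2.1 : ℂ) • (EuclideanSpace.single j 1 : CSpace m), q.2.2 j)) with hF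
  have h2 : Continuous F := by fun_prop
  exact continuous_re.continuousAt.comp (ContinuousAt.comp (x := (p, a)) (f := F)
    (g := fun q : (CSpace m × CSpace n) × (CSpace m × CSpace n) × (CSpace m × CSpace n) =>
      complexHessian Φ q.1 q.2.1 q.2.2) h1 h2.continuousAt)

/-- Homogeneity reduces bounds over the noncompact set of lifts (1, w) to the unit sphere; the
multiplier of the coordinate directions is a variable so that limits (0, w) at infinity are
included. -/
lemma liftTrace_smul {Φ : CSpace m × CSpace n → ℝ} {p : CSpace m × CSpace n}
    (hΦ : ContDiffAt ℝ 2 Φ p) (t : ℝ) (a : ℝ × (Fin m → CSpace n)) :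
    liftTrace Φ p (t • a) = t ^ 2 * liftTrace Φ p a := by
  have hT := isHermitianForm_complexHessian hΦ
  simp only [liftTrace, Finset.mul_sum]
  refine Finset.sum_congr rfl fun j _ => ?_
  have h : ((((t • a).1 : ℝ) : ℂ) • (EuclideanSpace.single j 1 : CSpace m), (t • a).2 j) =
      (t : ℂ) • ((a.1 : ℂ) • (EuclideanSpace.single j 1 : CSpace m), a.2 j) := by
    refine Prod.ext ?_ ?_
    · simp only [Prod.smul_fst, smul_eq_mul, ofReal_mul, smul_smul]
    · simp
  rw [h, hT.smul_left, hT.smul_right, conj_ofReal, ← mul_assoc, ← ofReal_mul, re_ofReal_mul, sq]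

/-- Positivity of the Hessian trace over all lifts is an open condition. -/
lemma eventually_liftTrace_ge {Φ : CSpace m × CSpace n → ℝ} {p : CSpace m × CSpace n}
    (hΦ : ContDiffAt ℝ 2 Φ p)
    (hpos : ∀ a : ℝ × (Fin m → CSpace n), a ≠ 0 → 0 < liftTrace Φ p a) :
    ∃ c > 0, ∀ᶠ q in 𝓝 p, ∀ w : Fin m → CSpace n,
      c * (m + ∑ j, ‖w j‖ ^ 2) ≤ liftTrace Φ q (1, w) := by
  set K := Metric.sphere (0 : ℝ × (Fin m → CSpace n)) 1 with hK
  have hKc : IsCompact K := isCompact_sphere _ _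
  have hKne : K.Nonempty := ⟨(1, 0), by simp [hK, Prod.norm_def]⟩
  have hcont : ContinuousOn (liftTrace Φ p) K := fun a _ =>
    (ContinuousAt.comp (f := fun a : ℝ × (Fin m → CSpace n) => (p, a)) (x := a)
      (continuousAt_liftTrace hΦ a) (by fun_prop)).continuousWithinAt
  obtain ⟨a₀, ha₀, hmin⟩ := hKc.exists_isMinOn hKne hcont
  have hμ : 0 < liftTrace Φ p a₀ := hpos a₀ (by
    rintro rfl
    simp [hK] at ha₀)
  set μ := liftTrace Φ p a₀ with hμdef
  have hev : ∀ᶠ q in 𝓝 p, ∀ a ∈ K, μ / 2 < liftTrace Φ q a :=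
    hKc.eventually_forall_of_forall_eventually fun a ha =>
      (continuousAt_liftTrace hΦ a).eventually
        (lt_mem_nhds ((half_lt_self hμ).trans_le (hmin ha)))
  -- With t the norm of (1, w), the sum m + ∑‖w_j‖² is at most 2(m+1)t², while the trace exceeds
  -- t²μ/2.
  refine ⟨μ / (4 * (m + 1)), by positivity, ?_⟩
  filter_upwards [hev, hΦ.eventually (by simp)] with q hq hΦq w
  set a : ℝ × (Fin m → CSpace n) := (1, w) with ha
  set t := ‖a‖ with ht
  have ht1 : 1 ≤ t := by
    have := norm_fst_le a
    simp only [ha, norm_one] at this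
    exact this
  have hmem : t⁻¹ • a ∈ K := by
    simp only [hK, mem_sphere_zero_iff_norm, norm_smul, norm_inv, Real.norm_eq_abs,
      abs_of_pos (by linarith : 0 < t)]
    exact inv_mul_cancel₀ (by linarith)
  have h1 := hq _ hmem
  have h2 := liftTrace_smul hΦq t (t⁻¹ • a)
  rw [smul_inv_smul₀ (by linarith : t ≠ 0)] at h2
  have hw : ∑ j, ‖w j‖ ^ 2 ≤ m * t ^ 2 := by
    calc ∑ j, ‖w j‖ ^ 2 ≤ ∑ _j : Fin m, t ^ 2 := by
          refine Finset.sum_le_sum fun j _ => ?_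
          gcongr
          exact (norm_le_pi_norm w j).trans (norm_snd_le a)
      _ = m * t ^ 2 := by simp
  have ht2 : 1 ≤ t ^ 2 := one_le_pow₀ ht1
  have hm0 : (0 : ℝ) ≤ m := Nat.cast_nonneg m
  calc μ / (4 * (m + 1)) * (m + ∑ j, ‖w j‖ ^ 2)
      ≤ μ / (4 * (m + 1)) * (2 * (m + 1) * t ^ 2) := by
        gcongr
        nlinarith
    _ = t ^ 2 * (μ / 2) := by field_simp; ring
    _ ≤ t ^ 2 * liftTrace Φ q (t⁻¹ • a) := by gcongr
    _ = _ := h2.symm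

end Positivity

/-! ### A truncated quadratic bump on the manifold. -/

section Bump

open Filter Topology Set

variable {m n : ℕ} {X : Type*} [TopologicalSpace X] [ChartedSpace (CSpace n) X]

open scoped Classical in
/-- The function `-c (|z - z₀|² + |x - x₀|²)` near `(z₀, x₀)`, in the chart at `x₀`, truncated
below by the constant `-cρ²/4`. -/
def chartBump (c ρ : ℝ) (z₀ : CSpace m) (x₀ : X) (q : CSpace m × X) : ℝ :=
  if q.2 ∈ (chartAt (CSpace n) x₀).source ∩
      chartAt (CSpace n) x₀ ⁻¹' Metric.ball (chartAt (CSpace n) x₀ x₀) ρ then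
    max (-c * (‖q.1 - z₀‖ ^ 2 + ‖chartAt (CSpace n) x₀ q.2 - chartAt (CSpace n) x₀ x₀‖ ^ 2))
      (-(c * ρ ^ 2 / 4))
  else -(c * ρ ^ 2 / 4)

variable {c ρ : ℝ} {z₀ : CSpace m} {x₀ : X}

lemma neg_le_chartBump (q : CSpace m × X) :
    -(c * ρ ^ 2 / 4) ≤ chartBump (n := n) c ρ z₀ x₀ q := by
  unfold chartBump
  split_ifs
  · exact le_max_right _ _
  · exact le_rfl

/-- The quadratic branch is below the truncation level beyond distance ρ/2, so the function is
constant off the image of the closed half-radius ball. That image is compact, hence closed because X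
is Hausdorff, and it lies inside the region of the first branch. -/
lemma continuous_chartBump [T2Space X] (hc : 0 < c) (hρ : 0 < ρ)
    (hball : Metric.closedBall (chartAt (CSpace n) x₀ x₀) (ρ / 2) ⊆ (chartAt (CSpace n) x₀).target) :
    Continuous (chartBump (n := n) c ρ z₀ x₀) := by
  set e := chartAt (CSpace n) x₀ with he
  rw [continuous_iff_continuousAt]
  rintro ⟨z, x⟩
  have hN : IsOpen (e.source ∩ e ⁻¹' Metric.ball (e x₀) ρ) :=
    e.isOpen_inter_preimage Metric.isOpen_ball
  by_cases hx : x ∈ e.source ∩ e ⁻¹' Metric.ball (e x₀) ρ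
  · have hev : chartBump (n := n) c ρ z₀ x₀ =ᶠ[𝓝 (z, x)]
        fun q => max (-c * (‖q.1 - z₀‖ ^ 2 + ‖e q.2 - e x₀‖ ^ 2)) (-(c * ρ ^ 2 / 4)) := by
      filter_upwards [continuousAt_snd.preimage_mem_nhds (hN.mem_nhds hx)] with q hq
      exact if_pos hq
    refine ContinuousAt.congr ?_ hev.symm
    have h1 : ContinuousAt (fun q : CSpace m × X => e q.2) (z, x) :=
      ContinuousAt.comp (x := (z, x)) (e.continuousAt hx.1) continuousAt_snd
    have h2 : ContinuousAt (fun q : CSpace m × X => q.1) (z, x) := continuousAt_fst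
    exact (continuousAt_const.mul (((h2.sub continuousAt_const).norm.pow 2).add
      ((h1.sub continuousAt_const).norm.pow 2))).max continuousAt_const
  · have hKc : IsClosed (e.symm '' Metric.closedBall (e x₀) (ρ / 2)) :=
      ((isCompact_closedBall _ _).image_of_continuousOn
        (e.continuousOn_symm.mono hball)).isClosed
    have hxK : x ∈ (e.symm '' Metric.closedBall (e x₀) (ρ / 2))ᶜ := by
      rintro ⟨y, hy, rfl⟩
      refine hx ⟨e.map_target (hball hy), ?_⟩
      rw [mem_preimage, e.right_inv (hball hy)]
      exact Metric.closedBall_subset_ball (by linarith) hy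
    have hev : chartBump (n := n) c ρ z₀ x₀ =ᶠ[𝓝 (z, x)] fun _ => -(c * ρ ^ 2 / 4) := by
      filter_upwards [continuousAt_snd.preimage_mem_nhds (hKc.isOpen_compl.mem_nhds hxK)] with q hq
      unfold chartBump
      split_ifs with h
      · refine max_eq_right ?_
        have h1 : ρ / 2 < ‖e q.2 - e x₀‖ := by
          by_contra! h2
          exact hq ⟨e q.2, by rwa [Metric.mem_closedBall, dist_eq_norm], e.left_inv h.1⟩
        have h2 : (ρ / 2) ^ 2 ≤ ‖e q.2 - e x₀‖ ^ 2 := by gcongr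
        nlinarith [sq_nonneg ‖q.1 - z₀‖]
      · rfl
    exact continuousAt_const.congr hev.symm

/-- For such z the truncation level is itself at most -c‖z - z₀‖². Together with the value at x₀
this determines the supremum of the bump over X. -/
lemma chartBump_le (hc : 0 < c) {z : CSpace m} (hz : ‖z - z₀‖ < ρ / 2) (x : X) :
    chartBump (n := n) c ρ z₀ x₀ (z, x) ≤ -c * ‖z - z₀‖ ^ 2 := by
  have h : ‖z - z₀‖ ^ 2 ≤ (ρ / 2) ^ 2 := by gcongr
  have h' : -(c * ρ ^ 2 / 4) ≤ -c * ‖z - z₀‖ ^ 2 := by nlinarith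
  unfold chartBump
  split_ifs
  · refine max_le ?_ h'
    have := sq_nonneg ‖chartAt (CSpace n) x₀ x - chartAt (CSpace n) x₀ x₀‖
    dsimp only
    nlinarith
  · exact h'

lemma chartBump_center (hc : 0 < c) (hρ : 0 < ρ) {z : CSpace m} (hz : ‖z - z₀‖ < ρ / 2) :
    chartBump (n := n) c ρ z₀ x₀ (z, x₀) = -c * ‖z - z₀‖ ^ 2 := by
  refine le_antisymm (chartBump_le hc hz x₀) ?_
  unfold chartBump
  rw [if_pos ⟨mem_chart_source _ x₀, by simpa using hρ⟩]
  refine le_trans (le_of_eq ?_) (le_max_left _ _)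
  simp

end Bump

/-! ### Harmonicity on graphs excludes a positive horizontal trace. -/

section WZWOfHarmonic

open Complex Filter Topology Set

variable {m n : ℕ} {X : Type*} [TopologicalSpace X] [ChartedSpace (CSpace n) X]
  [IsManifold 𝓘(ℂ, CSpace n) ω X]
  {Ω : KaehlerForm n X} {D : Set (CSpace m)} {u : CSpace m × X → ℝ}

lemma complexHessian_add_neg_norm_sq {Φ : CSpace m × CSpace n → ℝ} {p : CSpace m × CSpace n}
    (hΦ : ContDiffAt ℝ 2 Φ p) (c : ℝ) (z₀ : CSpace m) (y₀ : CSpace n)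
    (a : CSpace m × CSpace n) :
    (complexHessian (fun q => Φ q + -c * (‖q.1 - z₀‖ ^ 2 + ‖q.2 - y₀‖ ^ 2)) p a a).re =
      (complexHessian Φ p a a).re - c * (‖a.1‖ ^ 2 + ‖a.2‖ ^ 2) := by
  have h1 : ContDiffAt ℝ 2 (fun z : CSpace m => ‖z - z₀‖ ^ 2) p.1 :=
    ((contDiff_id.sub contDiff_const).norm_sq ℝ).contDiffAt
  have h2 : ContDiffAt ℝ 2 (fun y : CSpace n => ‖y - y₀‖ ^ 2) p.2 :=
    ((contDiff_id.sub contDiff_const).norm_sq ℝ).contDiffAt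
  have h1' : ContDiffAt ℝ 2 (fun q : CSpace m × CSpace n => ‖q.1 - z₀‖ ^ 2) p :=
    ((contDiff_fst.sub contDiff_const).norm_sq ℝ).contDiffAt
  have h2' : ContDiffAt ℝ 2 (fun q : CSpace m × CSpace n => ‖q.2 - y₀‖ ^ 2) p :=
    ((contDiff_snd.sub contDiff_const).norm_sq ℝ).contDiffAt
  rw [complexHessian_add hΦ (contDiffAt_const.mul (h1'.add h2')),
    complexHessian_const_mul _ (h1'.add h2'), complexHessian_add h1' h2',
    complexHessian_comp_fst (ψ := fun z => ‖z - z₀‖ ^ 2) h1,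
    complexHessian_comp_snd (ψ := fun y => ‖y - y₀‖ ^ 2) h2, complexHessian_norm_sub_sq,
    complexHessian_norm_sub_sq, ← ofReal_add, ← ofReal_mul, add_re, ofReal_re]
  ring

/-- Adding a small truncated bump keeps subharmonicity on graphs where the Hessian trace is
positive. -/
lemma isSubharmonicOnGraphs_add_chartBump [T2Space X] (hm : 1 ≤ m) (hD : IsOpen D)
    (hu : ContMDiffOn (𝓘(ℝ, CSpace m).prod 𝓘(ℝ, CSpace n)) 𝓘(ℝ, ℝ) 2 u (D ×ˢ univ))
    (hsub : IsSubharmonicOnGraphs Ω D (fun p => (u p : EReal))) {c ρ : ℝ} (hc : 0 < c)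
    (hρ : 0 < ρ) {z₀ : CSpace m} {x₀ : X} {O₀ : Set X} {ψ₀ : X → ℝ} (hψ₀ : Ω.IsPotentialOn ψ₀ O₀)
    (hUD : Metric.ball z₀ (ρ / 2) ⊆ D)
    (hO : ∀ y ∈ Metric.ball (chartAt (CSpace n) x₀ x₀) ρ, y ∈ (chartAt (CSpace n) x₀).target ∧
      (chartAt (CSpace n) x₀).symm y ∈ O₀)
    (hpos : ∀ z ∈ Metric.ball z₀ (ρ / 2), ∀ y ∈ Metric.ball (chartAt (CSpace n) x₀ x₀) ρ,
      ∀ w : Fin m → CSpace n, c * (m + ∑ j, ‖w j‖ ^ 2) ≤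
        liftTrace (potentialLift u ψ₀ x₀) (z, y) (1, w)) :
    IsSubharmonicOnGraphs Ω (Metric.ball z₀ (ρ / 2))
      (fun p => ((u p + chartBump (n := n) c ρ z₀ x₀ p : ℝ) : EReal)) := by
  set e := chartAt (CSpace n) x₀ with he
  have hcont : Continuous (chartBump (n := n) (m := m) c ρ z₀ x₀) :=
    continuous_chartBump hc hρ fun y hy =>
      (hO y (Metric.closedBall_subset_ball (by linarith) hy)).1
  refine isSubharmonicOnGraphs_of_viscosity hm
    ((hu.continuousOn.mono (prod_mono hUD subset_rfl)).add hcont.continuousOn)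
    fun W f hW hWU hf O ψ hψ z hz hzO G hG hle heq => ?_
  have hfc := hf.continuousOn.continuousAt (hW.mem_nhds hz)
  have hOopen := hf.continuousOn.isOpen_inter_preimage hW hψ.1
  -- Where the bump takes its minimum, G plus a constant touches u along the graph and
  -- subharmonicity of u suffices. Elsewhere the bump equals the quadratic branch at the point and
  -- dominates it nearby, so G touches the smooth function from above.
  rcases (neg_le_chartBump (n := n) (c := c) (ρ := ρ) (z₀ := z₀) (x₀ := x₀) (z, f z)).eq_or_lt with
    heqk | hlt
  · have hvis := (hsub.2.2 W f hW (hWU.trans hUD) hf O ψ hψ).isViscositySubharmonicAt hOopen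
      (⟨hz, hzO⟩ : z ∈ W ∩ f ⁻¹' O)
    have h := hvis (fun w => G w + c * ρ ^ 2 / 4) (hG.add contDiffAt_const) ?_ ?_
    · rwa [leviTrace_add hG contDiffAt_const, leviTrace_const, add_zero] at h
    · filter_upwards [hle] with w hw
      have hk := neg_le_chartBump (n := n) (c := c) (ρ := ρ) (z₀ := z₀) (x₀ := x₀) (w, f w)
      have : ψ (f w) + u (w, f w) ≤ G w + c * ρ ^ 2 / 4 := by linarith
      exact_mod_cast this
    · have : ψ (f z) + u (z, f z) = G z + c * ρ ^ 2 / 4 := by linarith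
      rw [← this, EReal.coe_add]
  · have hN : f z ∈ e.source ∩ e ⁻¹' Metric.ball (e x₀) ρ := by
      by_contra hN
      unfold chartBump at hlt
      rw [if_neg hN] at hlt
      exact lt_irrefl _ hlt
    have hNo : IsOpen (e.source ∩ e ⁻¹' Metric.ball (e x₀) ρ) :=
      e.isOpen_inter_preimage Metric.isOpen_ball
    have hback : e.symm (e (f z)) = f z := e.left_inv hN.1
    have hy := hO _ hN.2
    have hzD : z ∈ D := hUD (hWU hz)
    have hΦc := contDiffAt_potentialLift hD hu hψ x₀ hzD hy.1 (by rw [← he, hback]; exact hzO)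
    set Φ : CSpace m × CSpace n → ℝ := potentialLift u ψ x₀ with hΦ
    have hΦ' : ContDiffAt ℝ 2 (fun q : CSpace m × CSpace n =>
        Φ q + -c * (‖q.1 - z₀‖ ^ 2 + ‖q.2 - e x₀‖ ^ 2)) (z, e (f z)) :=
      hΦc.add (contDiff_const.mul (((contDiff_fst.sub contDiff_const).norm_sq ℝ).add
        ((contDiff_snd.sub contDiff_const).norm_sq ℝ))).contDiffAt
    have hΦf : ∀ w, f w ∈ e.source → Φ (w, e (f w)) = ψ (f w) + u (w, f w) := by
      intro w hw
      simp only [hΦ, potentialLift, chartLift]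
      rw [← he, e.left_inv hw, add_comm]
    have hle' : ∀ᶠ w in 𝓝 z,
        Φ (w, e (f w)) + -c * (‖w - z₀‖ ^ 2 + ‖e (f w) - e x₀‖ ^ 2) ≤ G w := by
      filter_upwards [hle, hfc.preimage_mem_nhds (hNo.mem_nhds hN)] with w hw hw'
      replace hw' : f w ∈ e.source ∩ e ⁻¹' Metric.ball (e x₀) ρ := hw'
      have hk : -c * (‖w - z₀‖ ^ 2 + ‖e (f w) - e x₀‖ ^ 2) ≤
          chartBump (n := n) c ρ z₀ x₀ (w, f w) := by
        unfold chartBump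
        rw [if_pos hw']
        exact le_max_left _ _
      rw [hΦf w hw'.1]
      linarith
    have heq' : Φ (z, e (f z)) + -c * (‖z - z₀‖ ^ 2 + ‖e (f z) - e x₀‖ ^ 2) = G z := by
      have hk : chartBump (n := n) c ρ z₀ x₀ (z, f z) =
          -c * (‖z - z₀‖ ^ 2 + ‖e (f z) - e x₀‖ ^ 2) := by
        unfold chartBump at hlt ⊢
        rw [if_pos hN] at hlt ⊢
        exact max_eq_left ((lt_max_iff.1 hlt).resolve_right (lt_irrefl _)).le
      rw [hΦf z hN.1, ← heq, hk]
      ring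
    obtain ⟨w, hw⟩ := exists_sum_complexHessian_le_leviTrace hW hf hz x₀ hN.1 hΦ' hG hle' heq'
    refine le_trans ?_ hw
    simp only [← he, complexHessian_add_neg_norm_sq hΦc]
    -- The lower bound is known for one potential only, but the Hessian of u + ψ does not depend on
    -- the choice of ψ.
    have hsame (a : CSpace m × CSpace n) : complexHessian Φ (z, e (f z)) a a =
        complexHessian (potentialLift u ψ₀ x₀) (z, e (f z)) a a := by
      rw [hΦ, complexHessian_potentialLift hD hu hψ x₀ hzD hy.1 (by rw [← he, hback]; exact hzO),
        complexHessian_potentialLift hD hu hψ₀ x₀ hzD hy.1 hy.2]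
    have h := hpos z (hWU hz) _ hN.2 w
    simp only [liftTrace, ofReal_one, one_smul] at h
    simp only [hsame, Finset.sum_sub_distrib, ← Finset.mul_sum, Finset.sum_add_distrib]
    simp only [PiLp.norm_single, norm_one, one_pow, Finset.sum_const, Finset.card_univ,
      Fintype.card_fin, nsmul_eq_mul, mul_one]
    linarith

/-- If `u` is harmonic on graphs, the horizontal trace of the Hessian is nowhere positive. -/
theorem sum_totalHermitian_nonpos_of_isHarmonicOnGraphs [T2Space X] (hm : 1 ≤ m) (hD : IsOpen D)
    (hu : ContMDiffOn (𝓘(ℝ, CSpace m).prod 𝓘(ℝ, CSpace n)) 𝓘(ℝ, ℝ) 2 u (D ×ˢ univ))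
    (hh : IsHarmonicOnGraphs Ω D (fun p => (u p : EReal))) {z₀ : CSpace m} (hz₀ : z₀ ∈ D) {x₀ : X}
    (hpos : IsPositiveAt Ω u z₀ x₀) {p : Fin m → CSpace n}
    (hp : ∀ j w, totalHermitian Ω u z₀ x₀ (EuclideanSpace.single j 1, p j) (0, w) = 0) :
    ∑ j, (totalHermitian Ω u z₀ x₀ (EuclideanSpace.single j 1, p j)
      (EuclideanSpace.single j 1, p j)).re ≤ 0 := by
  by_contra! htr
  obtain ⟨O₀, ψ₀, hxO, hψ₀⟩ := Ω.exists_isPotentialOn x₀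
  set e := chartAt (CSpace n) x₀ with he
  have hback : e.symm (e x₀) = x₀ := e.left_inv (mem_chart_source _ _)
  have hT := isHermitianForm_totalHermitian Ω hD hu hz₀ x₀
  have hΦc := contDiffAt_potentialLift hD hu hψ₀ x₀ hz₀ (mem_chart_target (CSpace n) x₀)
    (by rw [← he, hback]; exact hxO)
  have hV := hT.vertical.re_nonneg_of_posDef (hpos.posDef hD hu hz₀)
  have hV' (w : CSpace n) (hw : w ≠ 0) : 0 < (totalHermitian Ω u z₀ x₀ (0, w) (0, w)).re :=
    hT.vertical.re_pos_of_posDef (hpos.posDef hD hu hz₀) hw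
  -- After completing the square, the trace over a lift (s, w) is s²τ plus vertical terms. For s ≠ 0
  -- the first part is positive; for s = 0 the vertical part is, since w ≠ 0.
  obtain ⟨c, hc, hev⟩ := eventually_liftTrace_ge hΦc fun a ha => by
    have hterm : liftTrace (potentialLift u ψ₀ x₀) (z₀, e x₀) a =
        a.1 ^ 2 * ∑ j, (totalHermitian Ω u z₀ x₀ (EuclideanSpace.single j 1, p j)
          (EuclideanSpace.single j 1, p j)).re +
        ∑ j, (totalHermitian Ω u z₀ x₀ (0, a.2 j - (a.1 : ℂ) • p j)
          (0, a.2 j - (a.1 : ℂ) • p j)).re := by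
      rw [Finset.mul_sum, ← Finset.sum_add_distrib]
      refine Finset.sum_congr rfl fun j _ => ?_
      rw [complexHessian_potentialLift_self hD hu hψ₀ hz₀ hxO, hT.apply_smul_single_eq hp,
        conj_ofReal, ← ofReal_mul, add_re, re_ofReal_mul, sq]
    rw [hterm]
    by_cases h1 : a.1 = 0
    · have h2 : a.2 ≠ 0 := fun h2 => ha (Prod.ext h1 h2)
      obtain ⟨j, hj⟩ := Function.ne_iff.1 h2
      simp only [h1, ofReal_zero, zero_smul, sub_zero]
      have := Finset.sum_pos' (s := Finset.univ) (f := fun j => (totalHermitian Ω u z₀ x₀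
        (0, a.2 j) (0, a.2 j)).re) (fun j _ => hV _) ⟨j, Finset.mem_univ j, hV' _ hj⟩
      linarith
    · have h2 : 0 < a.1 ^ 2 := by positivity
      have := Finset.sum_nonneg (s := Finset.univ) (f := fun j => (totalHermitian Ω u z₀ x₀
        (0, a.2 j - (a.1 : ℂ) • p j) (0, a.2 j - (a.1 : ℂ) • p j)).re) (fun j _ => hV _)
      have := mul_pos h2 htr
      linarith
  have hOo : IsOpen (e.target ∩ e.symm ⁻¹' O₀) := e.isOpen_inter_preimage_symm hψ₀.1
  have hOmem : e x₀ ∈ e.target ∩ e.symm ⁻¹' O₀ :=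
    ⟨mem_chart_target (CSpace n) x₀, by rw [mem_preimage, hback]; exact hxO⟩
  obtain ⟨r₁, hr₁, h₁⟩ := Metric.eventually_nhds_iff_ball.1 hev
  obtain ⟨r₂, hr₂, h₂⟩ := Metric.isOpen_iff.1 hOo _ hOmem
  obtain ⟨r₃, hr₃, h₃⟩ := Metric.isOpen_iff.1 hD _ hz₀
  set ρ := min r₁ (min r₂ r₃) with hρdef
  have hρ : 0 < ρ := lt_min hr₁ (lt_min hr₂ hr₃)
  have hρ1 : ρ ≤ r₁ := min_le_left _ _
  have hρ2 : ρ ≤ r₂ := (min_le_right _ _).trans (min_le_left _ _)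
  have hρ3 : ρ ≤ r₃ := (min_le_right _ _).trans (min_le_right _ _)
  have hUD : Metric.ball z₀ (ρ / 2) ⊆ D :=
    (Metric.ball_subset_ball (by linarith)).trans h₃
  have hsub := isSubharmonicOnGraphs_add_chartBump hm hD hu hh.1 hc hρ hψ₀ hUD
    (fun y hy => h₂ (Metric.ball_subset_ball hρ2 hy)) fun z hz y hy w => h₁ (z, y) (by
      rw [← ball_prod_same]
      exact ⟨Metric.ball_subset_ball (by linarith) hz, Metric.ball_subset_ball hρ1 hy⟩) w
  -- Superharmonicity of u is tested against u plus the bump; the supremum of the difference is -c‖z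
  -- - z₀‖², whose trace -cm is negative.
  have hsup := hh.2.2.2 _ _ Metric.isOpen_ball hUD hsub
  have hval : ∀ z ∈ Metric.ball z₀ (ρ / 2), ⨆ x : X, (((u (z, x) +
      chartBump (n := n) c ρ z₀ x₀ (z, x) : ℝ) : EReal) - (u (z, x) : EReal)) =
      ((-c * ‖z - z₀‖ ^ 2 : ℝ) : EReal) := by
    intro z hz
    rw [mem_ball_iff_norm] at hz
    simp only [← EReal.coe_sub, add_sub_cancel_left]
    refine le_antisymm (iSup_le fun x => ?_) ?_
    · exact_mod_cast chartBump_le hc hz x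
    · rw [← chartBump_center (n := n) (x₀ := x₀) hc hρ hz]
      exact le_iSup (fun x => ((chartBump (n := n) c ρ z₀ x₀ (z, x) : ℝ) : EReal)) x₀
  have hz₀U : z₀ ∈ Metric.ball z₀ (ρ / 2) := Metric.mem_ball_self (by positivity)
  have hN : ContDiffAt ℝ 2 (fun z : CSpace m => ‖z - z₀‖ ^ 2) z₀ :=
    ((contDiff_id.sub contDiff_const).norm_sq ℝ).contDiffAt
  have h := hsup.isViscositySubharmonicAt Metric.isOpen_ball hz₀U (fun z => -c * ‖z - z₀‖ ^ 2)
    (contDiffAt_const.mul hN) (by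
      filter_upwards [Metric.isOpen_ball.mem_nhds hz₀U] with z hz using (hval z hz).le)
    (hval z₀ hz₀U)
  rw [leviTrace_const_mul _ hN, leviTrace_norm_sub_sq] at h
  have hm' : (1 : ℝ) ≤ m := by exact_mod_cast hm
  nlinarith

end WZWOfHarmonic

/-! ### The equivalence. -/

theorem mainTheorem1 {m n : ℕ} (hm : 1 ≤ m)
    {X : Type*} [TopologicalSpace X] [T2Space X] [CompactSpace X]
    [ChartedSpace (CSpace n) X] [IsManifold 𝓘(ℂ, CSpace n) ω X]
    (Ω : KaehlerForm n X) (D : Set (CSpace m)) (hD : IsOpen D)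
    (u : CSpace m × X → ℝ)
    (hu : ContMDiffOn (𝓘(ℝ, CSpace m).prod 𝓘(ℝ, CSpace n)) 𝓘(ℝ, ℝ) 2 u (D ×ˢ Set.univ))
    (hpos : ∀ z ∈ D, ∀ x : X, IsPositiveAt Ω u z x) :
    IsHarmonicOnGraphs Ω D (fun p => (u p : EReal)) ↔ SolvesWZW Ω D u := by
  have hslopes : ∀ z ∈ D, ∀ x : X, ∃ p : Fin m → CSpace n, ∀ j w,
      totalHermitian Ω u z x (EuclideanSpace.single j 1, p j) (0, w) = 0 := fun z hz x =>
    exists_slopes (isHermitianForm_totalHermitian Ω hD hu hz x) ((hpos z hz x).posDef hD hu hz)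
  have hiff : ∀ z ∈ D, ∀ x : X, ∀ p : Fin m → CSpace n,
      (∀ j w, totalHermitian Ω u z x (EuclideanSpace.single j 1, p j) (0, w) = 0) →
      (totalForm Ω u z x ^ (n + 1) * baseForm m n ^ (m - 1) = 0 ↔
        ∑ j, (totalHermitian Ω u z x (EuclideanSpace.single j 1, p j)
          (EuclideanSpace.single j 1, p j)).re = 0) := fun z hz x p hp => by
    have hT := isHermitianForm_totalHermitian Ω hD hu hz x
    rw [totalForm_eq, twoFormOf_pow_mul_eq_zero_iff hT ((hpos z hz x).posDef hD hu hz) p hp,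
      ← Complex.ofReal_eq_zero, Complex.ofReal_sum]
    simp only [hT.re_self]
  constructor
  · intro hh z hz x
    obtain ⟨p, hp⟩ := hslopes z hz x
    rw [hiff z hz x p hp]
    refine le_antisymm
      (sum_totalHermitian_nonpos_of_isHarmonicOnGraphs hm hD hu hh hz (hpos z hz x) hp) ?_
    -- Here u touches itself, with G = 0, so its subharmonicity on graphs gives the reverse
    -- inequality.
    have h := leviTrace_add_sum_nonneg hD hu hD subset_rfl hh.1 hz (x := x)
      (contDiffAt_const (c := (0 : ℝ))) (by simp) (by simp) p
    rwa [leviTrace_const, zero_add] at h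
  · intro hW
    refine ⟨isSubharmonicOnGraphs_of_trace_nonneg hm hD hu fun z hz x q => ?_,
      isSuperharmonicOnGraphs_of_trace_nonpos hm hD hu fun z hz x => ?_⟩
    · obtain ⟨p, hp⟩ := hslopes z hz x
      rw [← (hiff z hz x p hp).1 (hW z hz x)]
      exact sum_totalHermitian_le hD hu hz (hpos z hz x) hp q
    · obtain ⟨p, hp⟩ := hslopes z hz x
      exact ⟨p, ((hiff z hz x p hp).1 (hW z hz x)).le⟩

end
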